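/- Let $F$ be a field, $A$ a finite-dimensional $F$-algebra and $\Lambda$ a poset, and let $\Delta(\lambda)$, $\lambda\in\Lambda$, be $A$-modules. Modules are left modules, and $\mathrm{Rad}(M)$ denotes the intersection of the maximal submodules of $M$. We say that $A$ with the standard modules $\Delta(\lambda)$, $\lambda\in\Lambda$, *satisfies the axioms* if $\Lambda$ is finite, every $\Delta(\lambda)$ is finite-dimensional, and (a) the modules $L(\lambda)=\Delta(\lambda)/\mathrm{Rad}(\Delta(\lambda))$ are simple, pairwise non-isomorphic for distinct $\lambda$, and every simple $A$-module is isomorphic to one of them; (b) $\mathrm{End}_A(\Delta(\lambda))=F=\mathrm{End}_A(L(\lambda))$ for all $\lambda$; (c) if the composition multiplicity $[\mathrm{Rad}(\Delta(\lambda)):L(\mu)]$ is non-zero, then $\mu<\lambda$. For such data consider the following conditions (which are equivalent to each other when the axioms hold): (1) $\dim_F\mathrm{Hom}_A(\Delta(\mu),\Delta(\lambda))=[\Delta(\lambda):L(\mu)]$ for all $\lambda,\mu$ (tight multiplicities); (2) every simple $A$-module $L$ has a BGG resolution, that is, an exact sequence $\cdots\to\Delta_1\to\Delta_0\to L\to 0$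 in which every $\Delta_m$ is a (possibly empty) finite direct sum of standard modules; (3) for every $\lambda$, $\mathrm{Rad}(\Delta(\lambda))$ is the sum of the images of all homomorphisms to it from standard modules. Let now $I$ be a finite poset and let $\Delta(i)$, $i\in I$, be $A$-modules such that $A$ with the standard modules $\Delta(i)$ satisfies the axioms and one (hence each) of the conditions (1)–(3). Let $n$ be a positive integer such that $n!$ is non-zero in $F$ (that is, $\mathrm{char}\,F=0$ or $\mathrm{char}\,F>n$), and let $A_n=A^{\otimes n}\rtimes S_n$ be the wreath product. An $I$-partition of $n$ is a family $\lambda=(\lambda^i)_{i\in I}$ of partitions with $\sum_i|\lambda^i|=n$. For such $\lambda$ let $A_\lambda=\bigotimes_{i\in I}A_{|\lambda^i|}\subseteq A_n$ and $$\Delta(\lambda)=\mathrm{Ind}_{A_\lambda}^{A_n}\bigotimes_{i\in I}\Delta(i)^{\otimes|\lambda^i|}\otimes S^{\lambda^i},$$ where $S^{\lambda^i}$ is the Specht module over $F$ and $S_{|\lambda^i|}$ acts diagonally on $\Delta(i)^{\otimes|\lambda^i|}\otimes S^{\lambda^i}$. Order the $I$-partitions of $n$ by $\lambda\le\mu$ if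 $\lambda=\mu$, or $\sum_{j\ge i}|\lambda^j|\le\sum_{j\ge i}|\mu^j|$ for all $i\in I$ with strict inequality for some $i$. Then $A_n$, with the standard modules $\Delta(\lambda)$ indexed by the poset of $I$-partitions $\lambda$ of $n$, satisfies the axioms and all of the conditions (1), (2) and (3). -/

import Mathlib

open scoped TensorProduct

universe u v w x

noncomputable section

namespace BGG

/-! ### Categories of finite-dimensional modules with standard objects

Throughout, `F` is a field, `A` an `F`-algebra and `Δ l`, for `l` in a poset `Λ`, are `A`-modules.
Together with the finite-dimensionality of `A`, the objects of the category `A-mod` are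
the finite-dimensional `A`-modules. -/

/-- The composition multiplicity `[M : L]`: the number of factors isomorphic to `L` in a
composition series of `M` from `0` to `M` (by the Jordan-Hölder theorem the choice of the series
does not matter; every finite-dimensional module has one). The value is `0` if `M` does not have
finite length. -/
def compMult (A : Type*) [Ring A] (M L : Type*) [AddCommGroup M] [Module A M]
    [AddCommGroup L] [Module A L] : ℕ :=
  open Classical in
  if h : ∃ s : CompositionSeries (Submodule A M), s.head = ⊥ ∧ s.last = ⊤ then
    Nat.card {j : Fin h.choose.length //
      Nonempty ((h.choose j.succ ⧸ (h.choose j.castSucc).submoduleOf (h.choose j.succ)) ≃ₗ[A] L)}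
  else 0

/-- The head `M / Rad M` of a module, `Rad M` being the intersection of the maximal submodules. -/
abbrev Head (A : Type*) [Ring A] (M : Type*) [AddCommGroup M] [Module A M] : Type _ :=
  M ⧸ Module.jacobson A M

section Standard

variable (F : Type u) [Field F] (A : Type v) [Ring A] [Algebra F A]
variable {Λ : Type w} (Δ : Λ → Type x) [∀ l, AddCommGroup (Δ l)] [∀ l, Module F (Δ l)]
  [∀ l, Module A (Δ l)] [∀ l, IsScalarTower F A (Δ l)]

/-- The axioms on the standard objects `Δ l` of `A-mod`, indexed by a finite poset `Λ`. We write
`L l = Head A (Δ l)`. -/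
structure StandardAxioms [PartialOrder Λ] : Prop where
  /-- The poset is finite. -/
  finite_index : Finite Λ
  /-- The `Δ l` are objects of the category of finite-dimensional modules. -/
  finiteDimensional (l : Λ) : FiniteDimensional F (Δ l)
  /-- The `L l` are simple... -/
  simple_head (l : Λ) : IsSimpleModule A (Head A (Δ l))
  /-- ... pairwise non-isomorphic ... -/
  head_injective (l m : Λ) : Nonempty (Head A (Δ l) ≃ₗ[A] Head A (Δ m)) → l = m
  /-- ... and exhaust the simple modules. -/
  head_complete (S : Type v) [AddCommGroup S] [Module A S] [IsSimpleModule A S] :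
    ∃ l : Λ, Nonempty (S ≃ₗ[A] Head A (Δ l))
  /-- `End (Δ l) = F`. -/
  end_standard (l : Λ) (f : Δ l →ₗ[A] Δ l) : ∃! c : F, ∀ y, f y = c • y
  /-- `End (L l) = F`. -/
  end_head (l : Λ) (f : Head A (Δ l) →ₗ[A] Head A (Δ l)) : ∃! c : F, ∀ y, f y = c • y
  /-- If `[Rad (Δ l) : L m] ≠ 0` then `m < l`. -/
  lt_of_compMult (l m : Λ) :
    compMult A (Module.jacobson A (Δ l)) (Head A (Δ m)) ≠ 0 → m < l

/-- `M` has tight multiplicities: `dim Hom (Δ l, M) = [M : L l]` for all `l`. -/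
def HasTightMult (M : Type*) [AddCommGroup M] [Module F M] [Module A M] [IsScalarTower F A M] :
    Prop :=
  ∀ l : Λ, Module.finrank F (Δ l →ₗ[A] M) = compMult A M (Head A (Δ l))

/-- The category has tight multiplicities: every standard object does. -/
def TightMultiplicities : Prop :=
  ∀ l : Λ, HasTightMult F A Δ (Δ l)

/-- `M` is generated by singular vectors: the smallest submodule containing the images of all
homomorphisms from standard objects to `M` is `M`. -/
def GeneratedBySingular (M : Type*) [AddCommGroup M] [Module A M] : Prop :=
  (⨆ (l : Λ) (f : Δ l →ₗ[A] M), LinearMap.range f) = ⊤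

/-- The radical of every standard object is generated by singular vectors. -/
def RadicalsGenerated : Prop :=
  ∀ l : Λ, GeneratedBySingular A Δ (Module.jacobson A (Δ l))

/-- `M` has a BGG resolution: there is an exact sequence `⋯ → Δ_1 → Δ_0 → M → 0` in which `Δ_m` is
a (possibly empty) finite direct sum of standard objects `Δ (idx m j)`, `j < k m`. -/
def HasBGGResolution (M : Type*) [AddCommGroup M] [Module A M] : Prop :=
  ∃ (k : ℕ → ℕ) (idx : ∀ m, Fin (k m) → Λ)
    (d : ∀ m, (∀ j, Δ (idx (m + 1) j)) →ₗ[A] (∀ j, Δ (idx m j)))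
    (ε : (∀ j, Δ (idx 0 j)) →ₗ[A] M),
    Function.Surjective ε ∧ Function.Exact (d 0) ε ∧
      ∀ m, Function.Exact (d (m + 1)) (d m)

/-- Every simple object has a BGG resolution. -/
def SimplesHaveBGG : Prop :=
  ∀ (S : Type v) [AddCommGroup S] [Module A S] [IsSimpleModule A S], HasBGGResolution A Δ S

end Standard

/-! ### Tensor powers and wreath products -/

section TensorPower

variable (F : Type u) [Field F] (A : Type v) [Ring A] [Algebra F A]

/-- The tensor power `A^{⊗ X}` over `F`, with its factorwise multiplication. -/
abbrev TensorPow (X : Type*) : Type _ := ⨂[F] _ : X, A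

/-- A bijection `e : X ≃ Y` induces an isomorphism `A^{⊗ X} ≃ A^{⊗ Y}` moving the factor at `x`
to the place `e x`. -/
def tensorReindex {X Y : Type*} (e : X ≃ Y) : TensorPow F A X →ₐ[F] TensorPow F A Y :=
  AlgHom.ofLinearMap (PiTensorProduct.reindex F (fun _ : X => A) e).toLinearMap
    (by
      change PiTensorProduct.reindex F (fun _ : X => A) e (PiTensorProduct.tprod F 1) = _
      rw [PiTensorProduct.reindex_tprod]; rfl)
    ((LinearMap.map_mul_iff _).2 (by
      ext a b
      change PiTensorProduct.reindex F (fun _ : X => A) e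
          (PiTensorProduct.tprod F a * PiTensorProduct.tprod F b) =
        PiTensorProduct.reindex F (fun _ : X => A) e (PiTensorProduct.tprod F a) *
          PiTensorProduct.reindex F (fun _ : X => A) e (PiTensorProduct.tprod F b)
      rw [PiTensorProduct.tprod_mul_tprod, PiTensorProduct.reindex_tprod,
        PiTensorProduct.reindex_tprod, PiTensorProduct.reindex_tprod]
      exact (PiTensorProduct.tprod_mul_tprod _ _).symm))

@[simp] theorem tensorReindex_tprod {X Y : Type*} (e : X ≃ Y) (a : X → A) :
    tensorReindex F A e (PiTensorProduct.tprod F a) =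
      PiTensorProduct.tprod F (fun y => a (e.symm y)) :=
  PiTensorProduct.reindex_tprod e a

/-- Two linear maps on `A^{⊗ X}` agreeing on pure tensors are equal, applied form. -/
theorem tensorPow_ext {X : Type*} {E : Type*} [AddCommMonoid E] [Module F E]
    {f g : TensorPow F A X →ₗ[F] E}
    (h : ∀ a : X → A, f (PiTensorProduct.tprod F a) = g (PiTensorProduct.tprod F a))
    (t : TensorPow F A X) : f t = g t :=
  LinearMap.congr_fun (PiTensorProduct.ext (MultilinearMap.ext h)) t

/-- The symmetric group on `X` permutes the tensor factors of `A^{⊗ X}`. -/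
instance permAction (X : Type*) : MulSemiringAction (Equiv.Perm X) (TensorPow F A X) where
  smul σ t := tensorReindex F A σ t
  one_smul t := tensorPow_ext F A (f := (tensorReindex F A (1 : Equiv.Perm X)).toLinearMap)
    (g := LinearMap.id) (fun a => by simp; rfl) t
  mul_smul σ τ t := tensorPow_ext F A (f := (tensorReindex F A (σ * τ)).toLinearMap)
    (g := ((tensorReindex F A σ).comp (tensorReindex F A τ)).toLinearMap)
    (fun a => by simp; rfl) t
  smul_zero σ := map_zero (tensorReindex F A σ)
  smul_add σ := map_add (tensorReindex F A σ)
  smul_one σ := map_one (tensorReindex F A σ)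
  smul_mul σ := map_mul (tensorReindex F A σ)

theorem perm_smul_def {X : Type*} (σ : Equiv.Perm X) (t : TensorPow F A X) :
    σ • t = tensorReindex F A σ t := rfl

instance permAction_smulCommClass (X : Type*) :
    SMulCommClass (Equiv.Perm X) F (TensorPow F A X) where
  smul_comm σ c t := map_smul (tensorReindex F A σ) c t

/-- The wreath product `A_n = A^{⊗ n} ⋊ S_n`: the skew group algebra of `S_n` over `A^{⊗ n}`. -/
abbrev WreathAlg (n : ℕ) : Type _ :=
  SkewMonoidAlgebra (TensorPow F A (Fin n)) (Equiv.Perm (Fin n))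

section Young

variable {I : Type w} (Y : I → Type*)

/-- The Young subgroup `∏ i, S_{Y i}` of the symmetric group on the disjoint union `X` of the `Y i`
permutes the tensor factors of `A^{⊗ X}`. -/
instance youngAction :
    MulSemiringAction (∀ i, Equiv.Perm (Y i)) (TensorPow F A (Σ i, Y i)) :=
  MulSemiringAction.compHom _ (Equiv.Perm.sigmaCongrRightHom Y)

theorem young_smul_def (h : ∀ i, Equiv.Perm (Y i)) (t : TensorPow F A (Σ i, Y i)) :
    h • t = tensorReindex F A (Equiv.Perm.sigmaCongrRight h) t := rfl

instance youngAction_smulCommClass :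
    SMulCommClass (∀ i, Equiv.Perm (Y i)) F (TensorPow F A (Σ i, Y i)) where
  smul_comm h c t := map_smul (tensorReindex F A (Equiv.Perm.sigmaCongrRight h)) c t

/-- For a finite family of finite sets `Y i`, this is the algebra `⨂ i, (A^{⊗ Y i} ⋊ S_{Y i})`,
written as the skew group algebra `(A^{⊗ X}) ⋊ ∏ i, S_{Y i}` where `X` is the disjoint union of
the `Y i`. -/
abbrev YoungAlg : Type _ :=
  SkewMonoidAlgebra (TensorPow F A (Σ i, Y i)) (∀ i, Equiv.Perm (Y i))

/-- The inclusion of `A^{⊗ n}` into `A_n`. -/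
def tensorIncl (n : ℕ) : TensorPow F A (Fin n) →ₐ[F] WreathAlg F A n where
  __ := (SkewMonoidAlgebra.singleOneRingHom : TensorPow F A (Fin n) →+* WreathAlg F A n)
  commutes' _ := rfl

/-- The inclusion of `S_n` into `A_n`. -/
def permIncl (n : ℕ) : Equiv.Perm (Fin n) →* WreathAlg F A n :=
  SkewMonoidAlgebra.of (TensorPow F A (Fin n)) (Equiv.Perm (Fin n))

theorem permIncl_mul_tensorIncl {n : ℕ} (σ : Equiv.Perm (Fin n)) (t : TensorPow F A (Fin n)) :
    permIncl F A n σ * tensorIncl F A n t = tensorIncl F A n (σ • t) * permIncl F A n σ := by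
  change SkewMonoidAlgebra.single σ 1 * SkewMonoidAlgebra.single 1 t =
    SkewMonoidAlgebra.single 1 (σ • t) * SkewMonoidAlgebra.single σ 1
  simp [SkewMonoidAlgebra.single_mul_single]

/-- A numbering `e` of the elements of the disjoint union of the `Y i` embeds
`A^{⊗ X} ⋊ ∏ i, S_{Y i}` into `A_n`. -/
def youngIncl {n : ℕ} (e : (Σ i, Y i) ≃ Fin n) : YoungAlg F A Y →ₐ[F] WreathAlg F A n :=
  SkewMonoidAlgebra.liftNCAlgHom
    ((tensorIncl F A n).comp (tensorReindex F A e))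
    ((permIncl F A n).comp (e.permCongrHom.toMonoidHom.comp (Equiv.Perm.sigmaCongrRightHom Y)))
    (by
      intro t h
      refine Eq.trans ?_ (permIncl_mul_tensorIncl F A _ _).symm
      refine congrArg (fun z => tensorIncl F A n z * _) ?_
      exact tensorPow_ext F A
        (f := ((tensorReindex F A e).comp
          (tensorReindex F A (Equiv.Perm.sigmaCongrRight h))).toLinearMap)
        (g := ((tensorReindex F A (e.permCongr (Equiv.Perm.sigmaCongrRight h))).comp
          (tensorReindex F A e)).toLinearMap)
        (fun a => by simp [Equiv.permCongr_def]) t)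

end Young

end TensorPower

/-! ### Modules over wreath products -/

section Modules

variable (F : Type u) [Field F] (A : Type v) [Ring A] [Algebra F A]

/-- `A^{⊗ X}` acts factorwise on a tensor product `⨂ x, M x` of `A`-modules. -/
def tensorAct {X : Type*} (M : X → Type*) [∀ x, AddCommGroup (M x)] [∀ x, Module F (M x)]
    [∀ x, Module A (M x)] [∀ x, IsScalarTower F A (M x)] :
    TensorPow F A X →ₐ[F] Module.End F (⨂[F] x, M x) :=
  PiTensorProduct.liftAlgHom
    ((PiTensorProduct.mapMultilinear F M M).compLinearMap
      (fun x => (Algebra.lsmul F F (M x) : A →ₐ[F] Module.End F (M x)).toLinearMap))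
    (by ext; simp)
    (by intro a b; ext; simp)

theorem tensorAct_tprod {X : Type*} (M : X → Type*) [∀ x, AddCommGroup (M x)]
    [∀ x, Module F (M x)] [∀ x, Module A (M x)] [∀ x, IsScalarTower F A (M x)]
    (a : X → A) (m : ∀ x, M x) :
    tensorAct F A M (PiTensorProduct.tprod F a) (PiTensorProduct.tprod F m) =
      PiTensorProduct.tprod F (fun x => a x • m x) := by
  simp [tensorAct]

section Perm

variable {I : Type w} (Y : I → Type*) (M : I → Type x) [∀ i, AddCommGroup (M i)]
  [∀ i, Module F (M i)]

/-- The permutation of the tensor factors of `⨂ i, (M i)^{⊗ Y i}` by an element of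
the Young subgroup `∏ i, S_{Y i}`. -/
def youngPermuteMap (h : ∀ i, Equiv.Perm (Y i)) :
    (⨂[F] y : (Σ i, Y i), M y.1) →ₗ[F] (⨂[F] y : (Σ i, Y i), M y.1) :=
  (PiTensorProduct.reindex F (fun y : (Σ i, Y i) => M y.1)
    (Equiv.Perm.sigmaCongrRight h)).toLinearMap

theorem youngPermuteMap_tprod (h : ∀ i, Equiv.Perm (Y i)) (m : ∀ y : (Σ i, Y i), M y.1) :
    youngPermuteMap F Y M h (PiTensorProduct.tprod F m) =
      PiTensorProduct.tprod F (fun y : (Σ i, Y i) => m ⟨y.1, (h y.1).symm y.2⟩) :=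
  PiTensorProduct.reindex_tprod (Equiv.Perm.sigmaCongrRight h) m

/-- `youngPermuteMap` as a representation of the Young subgroup. -/
def youngPermute : (∀ i, Equiv.Perm (Y i)) →* Module.End F (⨂[F] y : (Σ i, Y i), M y.1) where
  toFun := youngPermuteMap F Y M
  map_one' := PiTensorProduct.ext (MultilinearMap.ext fun m => youngPermuteMap_tprod F Y M 1 m)
  map_mul' g h := PiTensorProduct.ext (MultilinearMap.ext fun m => by
    change youngPermuteMap F Y M (g * h) (PiTensorProduct.tprod F m) =
      youngPermuteMap F Y M g (youngPermuteMap F Y M h (PiTensorProduct.tprod F m))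
    rw [youngPermuteMap_tprod, youngPermuteMap_tprod, youngPermuteMap_tprod]
    rfl)

variable [∀ i, Module A (M i)] [∀ i, IsScalarTower F A (M i)]

theorem youngPermute_mul_tensorAct (h : ∀ i, Equiv.Perm (Y i)) (t : TensorPow F A (Σ i, Y i)) :
    tensorAct F A (fun y : (Σ i, Y i) => M y.1) (h • t) * youngPermute F Y M h =
      youngPermute F Y M h * tensorAct F A (fun y : (Σ i, Y i) => M y.1) t := by
  refine tensorPow_ext F A
    (f := (LinearMap.mulRight F (youngPermute F Y M h)) ∘ₗ
      ((tensorAct F A (fun y : (Σ i, Y i) => M y.1)).comp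
        (tensorReindex F A (Equiv.Perm.sigmaCongrRight h))).toLinearMap)
    (g := (LinearMap.mulLeft F (youngPermute F Y M h)) ∘ₗ
      (tensorAct F A (fun y : (Σ i, Y i) => M y.1)).toLinearMap) (fun a => ?_) t
  refine PiTensorProduct.ext (MultilinearMap.ext fun m => ?_)
  change tensorAct F A _ (tensorReindex F A _ (PiTensorProduct.tprod F a))
      (youngPermuteMap F Y M h (PiTensorProduct.tprod F m)) =
    youngPermuteMap F Y M h (tensorAct F A _ (PiTensorProduct.tprod F a)
      (PiTensorProduct.tprod F m))
  rw [tensorReindex_tprod, youngPermuteMap_tprod, tensorAct_tprod, tensorAct_tprod,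
    youngPermuteMap_tprod]
  rfl

end Perm

/-- The Specht module `S^μ` of the symmetric group on the cells of the Young diagram `μ`: the left
ideal of the group algebra generated by `κ ρ`, where `ρ` is the sum of the row stabilizer and `κ`
the signed sum of the column stabilizer. (Up to isomorphism this is the span of the polytabloids;
for one row it is the trivial module.) -/
def specht (μ : YoungDiagram) :
    Submodule (MonoidAlgebra F (Equiv.Perm μ.cells)) (MonoidAlgebra F (Equiv.Perm μ.cells)) :=
  Ideal.span
    {(∑ σ : Equiv.Perm μ.cells with ∀ c, (σ c).1.2 = c.1.2,
        MonoidAlgebra.single σ ((Equiv.Perm.sign σ : ℤ) : F)) *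
      (∑ σ : Equiv.Perm μ.cells with ∀ c, (σ c).1.1 = c.1.1, MonoidAlgebra.single σ (1 : F))}

/-- The symmetric group on the cells of `μ` acts on the Specht module `S^μ`. -/
def spechtRep (μ : YoungDiagram) : Equiv.Perm μ.cells →* Module.End F (specht F μ) :=
  ((Algebra.lsmul F F (specht F μ) :
    MonoidAlgebra F (Equiv.Perm μ.cells) →ₐ[F] Module.End F (specht F μ)) :
      MonoidAlgebra F (Equiv.Perm μ.cells) →* Module.End F (specht F μ)).comp
    (MonoidAlgebra.of F (Equiv.Perm μ.cells))

section Induction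

variable {F}
variable {B₀ : Type*} {B : Type*} [Ring B₀] [Ring B] [Algebra F B₀] [Algebra F B]
  (φ : B₀ →ₐ[F] B) (N : Type*) [AddCommGroup N] [Module F N] [Module B₀ N]

/-- The relations `b φ(a) ⊗ m = b ⊗ a m` defining `B ⊗_{B₀} N` as a quotient of `B ⊗_F N`. -/
def indRel : Submodule B (B ⊗[F] N) :=
  Submodule.span B {t | ∃ (b : B) (a : B₀) (m : N), t = (b * φ a) ⊗ₜ[F] m - b ⊗ₜ[F] (a • m)}

/-- The induced module `Ind N = B ⊗_{B₀} N`, for an algebra homomorphism `φ : B₀ → B` and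
a `B₀`-module `N`. -/
abbrev Ind : Type _ := (B ⊗[F] N) ⧸ indRel φ N

end Induction

end Modules

/-! ### Standard modules of wreath products -/

/-- An `I`-partition of `n`: a family of partitions (Young diagrams) indexed by `I` of total
size `n`. -/
@[ext] structure IPartition (I : Type w) [Fintype I] (n : ℕ) where
  /-- The partition at `i`. -/
  shape : I → YoungDiagram
  /-- The sizes add up to `n`. -/
  sum_card : ∑ i, (shape i).card = n

namespace IPartition

variable {I : Type w} [Fintype I] {n : ℕ}

open Classical in
/-- `∑_{j ≥ i} |λ^j|`. -/
def upperSize [PartialOrder I] (l : IPartition I n) (i : I) : ℕ :=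
  ∑ j : I with i ≤ j, (l.shape j).card

/-- `l ≤ m` if `l = m`, or `∑_{j ≥ i} |l^j| ≤ ∑_{j ≥ i} |m^j|` for all `i`, with a strict
inequality for some `i`. -/
instance [PartialOrder I] : PartialOrder (IPartition I n) where
  le l m := l = m ∨
    ((∀ i, l.upperSize i ≤ m.upperSize i) ∧ ∃ i, l.upperSize i < m.upperSize i)
  le_refl l := Or.inl rfl
  le_trans := by
    rintro l m k (rfl | ⟨h, i, hi⟩) (rfl | ⟨h', j, hj⟩)
    · exact Or.inl rfl
    · exact Or.inr ⟨h', j, hj⟩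
    · exact Or.inr ⟨h, i, hi⟩
    · exact Or.inr ⟨fun i => (h i).trans (h' i), i, hi.trans_le (h' i)⟩
  le_antisymm := by
    rintro l m (rfl | ⟨h, i, hi⟩) (h' | ⟨h', j, hj⟩)
    · rfl
    · rfl
    · exact h'.symm
    · exact absurd hi (not_lt.2 (h' i))

/-- A numbering of the cells of an `I`-partition of `n` by `1, …, n`. -/
def numbering (l : IPartition I n) : (Σ i, (l.shape i).cells) ≃ Fin n :=
  Fintype.equivFinOfCardEq (by
    simpa [Fintype.card_sigma] using l.sum_card)

end IPartition

section WreathStandard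

variable (F : Type u) [Field F] (A : Type v) [Ring A] [Algebra F A]
variable {I : Type w} [Fintype I] (M : I → Type x) [∀ i, AddCommGroup (M i)]
  [∀ i, Module F (M i)] [∀ i, Module A (M i)] [∀ i, IsScalarTower F A (M i)] {n : ℕ}

/-- The algebra `A_l = ⨂ i, A_{|l^i|}`, where the `|l^i|` tensor factors of `A_{|l^i|}` are
indexed by the cells of `l^i`. -/
abbrev ParabolicAlg (l : IPartition I n) : Type _ :=
  YoungAlg F A (fun i => (l.shape i).cells)

/-- The vector space `⨂ i, (M i)^{⊗ |l^i|} ⊗ S^{l^i}`. -/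
def OuterTensor (l : IPartition I n) : Type _ :=
  (⨂[F] y : (Σ i, (l.shape i).cells), M y.1) ⊗[F] (⨂[F] i, specht F (l.shape i))

instance (l : IPartition I n) : AddCommGroup (OuterTensor F M l) :=
  inferInstanceAs (AddCommGroup
    ((⨂[F] y : (Σ i, (l.shape i).cells), M y.1) ⊗[F] (⨂[F] i, specht F (l.shape i))))

instance (l : IPartition I n) : Module F (OuterTensor F M l) :=
  inferInstanceAs (Module F
    ((⨂[F] y : (Σ i, (l.shape i).cells), M y.1) ⊗[F] (⨂[F] i, specht F (l.shape i))))

/-- The action of `A_l` on `⨂ i, (M i)^{⊗ |l^i|} ⊗ S^{l^i}`: a pure tensor in the tensor power of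
`A` acts factorwise on the `(M i)^{⊗ |l^i|}`, and `∏ i, S_{|l^i|}` permutes the factors of
`(M i)^{⊗ |l^i|}` and acts on the Specht modules simultaneously. -/
def outerAct (l : IPartition I n) :
    ParabolicAlg F A l →ₐ[F] Module.End F (OuterTensor F M l) :=
  SkewMonoidAlgebra.liftNCAlgHom
    ((Module.End.rTensorAlgHom F (⨂[F] y : (Σ i, (l.shape i).cells), M y.1)
        (⨂[F] i, specht F (l.shape i))).comp
      (tensorAct F A (fun y : (Σ i, (l.shape i).cells) => M y.1)))
    { toFun := fun h => TensorProduct.map (youngPermute F (fun i => (l.shape i).cells) M h)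
        (PiTensorProduct.map (fun i => spechtRep F (l.shape i) (h i)))
      map_one' := by
        simp only [map_one, Pi.one_apply, PiTensorProduct.map_one]
        exact TensorProduct.map_one
      map_mul' := fun g h => by
        simp only [map_mul, Pi.mul_apply, PiTensorProduct.map_mul]
        exact TensorProduct.map_mul _ _ _ _ }
    (by
      intro t h
      have key := youngPermute_mul_tensorAct F A (fun i => (l.shape i).cells) M h t
      change TensorProduct.map _ LinearMap.id * TensorProduct.map _ _ =
        TensorProduct.map _ _ * TensorProduct.map _ LinearMap.id
      refine (TensorProduct.map_mul _ _ _ _).symm.trans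
        (Eq.trans ?_ (TensorProduct.map_mul _ _ _ _))
      exact congrArg₂ TensorProduct.map key rfl)

instance (l : IPartition I n) : Module (ParabolicAlg F A l) (OuterTensor F M l) :=
  Module.compHom _ (outerAct F A M l).toRingHom

/-- The `A_n`-module `M(l) = Ind_{A_l}^{A_n} ⨂ i, (M i)^{⊗ |l^i|} ⊗ S^{l^i}`. -/
abbrev WreathModule (l : IPartition I n) : Type _ :=
  Ind (youngIncl F A (fun i => (l.shape i).cells) l.numbering) (OuterTensor F M l)

end WreathStandard

end BGG

end

noncomputable section

set_option linter.unusedSectionVars false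

/-! The axioms are translated into weights. A `WeightData` consists of idempotents `e l` and vectors
`u l` such that `e l • D l` is the line through `u l`, the vector `u l` generates `D l`, `e m` is
non-zero on `D l` only if `m ≤ l`, the `e l` generate the unit two-sided ideal, and `e l B e l` is
`F e l` modulo the radical. Then the head `L l` is the only simple module on which `e l` does not
vanish, and its weight space is a line. Hence `[M : L l] = dim (e l M)`, and the axioms follow
(`WeightData.standardAxioms`). Conversely, for a finite-dimensional algebra the density theorem and
lifting of idempotents produce weight data from the axioms (`StandardAxioms.exists_weightData`).

A homomorphism from `D l` to `M` is determined by the image of `u l`, which lies in `e l M`. So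
tightness of `M` means that every vector of `e l M` is the image of `u l` under some homomorphism
(`WeightsSingular`). This property passes to products, quotients and submodules, so kernels of maps
between sums of standard modules can be covered by standard modules again and again; this gives BGG
resolutions and generated radicals. Conversely, each of the three conditions implies the property
for all standard modules (`WeightData.weightsSingular`).

It remains to carry both notions over to the wreath product. The idempotent of an `I`-partition is
the tensor of the `e i`, placed according to the colours of the cells, times a commuting product of
Young idempotents (`wreathIdem`). `WeightData.wreath` rests on three facts. As `n!` is invertible,
Young symmetrizers are idempotent up to non-zero scalars, those of different shapes are orthogonal,
and together they generate the group algebra. A factor `e j • Δ i` vanishes unless `j ≤ i`, and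
counting colours turns this into the order on `I`-partitions. A pure tensor with a factor in the
radical of `A` lies in the radical of the wreath product.

For `WeightsSingular.wreath`, homomorphisms between the `Δ i` are tensored to a map compatible with
the tensor power of `A` which has the required value on the tensor of the `u i`
(`exists_tensorLift`); twisting it by the Specht modules makes it equivariant under the Young
subgroup, and Frobenius reciprocity extends it to the induced module (`exists_wreathLift`). -/

namespace BGG

/-! ### Tableaux -/

section Tableaux

variable {X : Type*}

/-- The functions `r` and `c` on `X` give the rows and the columns of the entries of a tableau of
shape `μ` with entries in `X`. -/
structure IsTableau (μ : YoungDiagram) (r c : X → ℕ) : Prop where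
  inj : Function.Injective fun x => (r x, c x)
  mem : ∀ x, (r x, c x) ∈ μ
  surj : ∀ p ∈ μ, ∃ x, (r x, c x) = p

theorem IsTableau.comp_equiv {Z : Type*} {μ : YoungDiagram} {r c : X → ℕ}
    (h : IsTableau μ r c) (g : Z ≃ X) : IsTableau μ (r ∘ g) (c ∘ g) where
  inj := h.inj.comp g.injective
  mem x := h.mem (g x)
  surj p hp := by
    obtain ⟨x, hx⟩ := h.surj p hp
    exact ⟨g.symm x, by simpa using hx⟩

theorem isTableau_cells (μ : YoungDiagram) :
    IsTableau μ (fun x : μ.cells => x.1.1) (fun x : μ.cells => x.1.2) where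
  inj _ _ h := Subtype.ext h
  mem x := (YoungDiagram.mem_cells _).1 x.2
  surj p hp := ⟨⟨p, (YoungDiagram.mem_cells _).2 hp⟩, rfl⟩

variable [Fintype X]

theorem IsTableau.card_col {μ : YoungDiagram} {r c : X → ℕ} (h : IsTableau μ r c) (j k : ℕ) :
    (Finset.univ.filter fun x => c x = j ∧ r x < k).card = min k (μ.colLen j) := by
  rw [← Finset.card_range (min k (μ.colLen j))]
  refine Finset.card_nbij r ?_ ?_ ?_
  · intro x hx
    simp only [Finset.coe_filter, Finset.mem_univ, true_and, Set.mem_ofPred_eq] at hx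
    have := YoungDiagram.mem_iff_lt_colLen.1 (h.mem x)
    simp only [Finset.coe_range, Set.mem_Iio, lt_min_iff]
    exact ⟨hx.2, hx.1 ▸ this⟩
  · intro x hx y hy hxy
    simp only [Finset.coe_filter, Finset.mem_univ, true_and, Set.mem_ofPred_eq] at hx hy
    exact h.inj (Prod.ext hxy (hx.1.trans hy.1.symm))
  · intro i hi
    simp only [Finset.coe_range, Set.mem_Iio, lt_min_iff] at hi
    obtain ⟨x, hx⟩ := h.surj (i, j) (YoungDiagram.mem_iff_lt_colLen.2 hi.2)
    rw [Prod.mk.injEq] at hx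
    exact ⟨x, by simp [hx.1, hx.2, hi.1], hx.1⟩

theorem IsTableau.card_row {μ : YoungDiagram} {r c : X → ℕ} (h : IsTableau μ r c) (i : ℕ) :
    (Finset.univ.filter fun x => r x = i).card = μ.rowLen i := by
  rw [← Finset.card_range (μ.rowLen i)]
  refine Finset.card_nbij c ?_ ?_ ?_
  · intro x hx
    simp only [Finset.coe_filter, Finset.mem_univ, true_and, Set.mem_ofPred_eq] at hx
    have := YoungDiagram.mem_iff_lt_rowLen.1 (h.mem x)
    simpa using hx ▸ this
  · intro x hx y hy hxy
    simp only [Finset.coe_filter, Finset.mem_univ, true_and, Set.mem_ofPred_eq] at hx hy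
    exact h.inj (Prod.ext (hx.trans hy.symm) hxy)
  · intro j hj
    obtain ⟨x, hx⟩ := h.surj (i, j) (YoungDiagram.mem_iff_lt_rowLen.2 (by simpa using hj))
    rw [Prod.mk.injEq] at hx
    exact ⟨x, by simp [hx.1], hx.2⟩

/-- On a single column `r'` is injective, so at most `k` entries have a value below `k`; and the
column has only `colLen` entries altogether. -/
theorem IsTableau.card_col_le {μ : YoungDiagram} {r c r' : X → ℕ} (h : IsTableau μ r c)
    (inj : Function.Injective fun x => (r' x, c x)) (j k : ℕ) :
    (Finset.univ.filter fun x => c x = j ∧ r' x < k).card ≤ min k (μ.colLen j) := by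
  refine le_min ?_ ?_
  · rw [← Finset.card_range k]
    refine Finset.card_le_card_of_injOn r' ?_ ?_
    · intro x hx
      simp only [Finset.coe_filter, Finset.mem_univ, true_and, Set.mem_ofPred_eq] at hx
      simpa using hx.2
    · intro x hx y hy hxy
      simp only [Finset.coe_filter, Finset.mem_univ, true_and, Set.mem_ofPred_eq] at hx hy
      exact inj (Prod.ext hxy (hx.1.trans hy.1.symm))
  · refine le_trans ?_ ((h.card_col j (μ.colLen j)).trans_le (min_le_left _ _))
    refine Finset.card_le_card fun x hx => ?_
    simp only [Finset.mem_filter, Finset.mem_univ, true_and] at hx ⊢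
    exact ⟨hx.1, hx.1 ▸ YoungDiagram.mem_iff_lt_colLen.1 (h.mem x)⟩

theorem card_rows_lt_eq_sum (r c : X → ℕ) (k : ℕ) :
    (Finset.univ.filter fun x => r x < k).card =
      ∑ j ∈ Finset.univ.image c, (Finset.univ.filter fun x => c x = j ∧ r x < k).card := by
  rw [Finset.card_eq_sum_card_fiberwise (f := c) (t := Finset.univ.image c)
    fun x _ => Finset.mem_coe.2 (Finset.mem_image_of_mem _ (Finset.mem_univ _))]
  refine Finset.sum_congr rfl fun j _ => congrArg _ ?_
  ext x; simp [and_comm]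

/-- If entries in the same row of a tableau `(r', c')` lie in different columns of `(r, c)`, then
the shape of `(r', c')` is dominated by the shape of `(r, c)`. -/
theorem IsTableau.card_rows_lt_le {μ : YoungDiagram} {r c r' : X → ℕ} (h : IsTableau μ r c)
    (inj : Function.Injective fun x => (r' x, c x)) (k : ℕ) :
    (Finset.univ.filter fun x => r' x < k).card ≤ (Finset.univ.filter fun x => r x < k).card := by
  -- Both counts are split along the columns of `c`. In each column the tableau `(r, c)` has as many
  -- entries in the first `k` rows as is possible at all.
  rw [card_rows_lt_eq_sum r' c, card_rows_lt_eq_sum r c]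
  refine Finset.sum_le_sum fun j _ => ?_
  rw [h.card_col]
  exact h.card_col_le inj j k

/-- The row lengths are the successive differences of these counts, and they determine the diagram.
-/
theorem IsTableau.shape_eq {μ ν : YoungDiagram} {r c r' c' : X → ℕ} (h : IsTableau μ r c)
    (h' : IsTableau ν r' c')
    (hk : ∀ k, (Finset.univ.filter fun x => r' x < k).card =
      (Finset.univ.filter fun x => r x < k).card) : μ = ν := by
  have key : ∀ (s : X → ℕ) (k : ℕ), (Finset.univ.filter fun x => s x < k + 1).card =
      (Finset.univ.filter fun x => s x < k).card + (Finset.univ.filter fun x => s x = k).card := by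
    classical
    intro s k
    rw [← Finset.card_union_of_disjoint]
    · congr 1; ext x; simp; omega
    · rw [Finset.disjoint_left]; intro x; simp; omega
  refine YoungDiagram.ext (Finset.ext fun p => ?_)
  obtain ⟨i, j⟩ := p
  rw [YoungDiagram.mem_cells, YoungDiagram.mem_cells, YoungDiagram.mem_iff_lt_rowLen,
    YoungDiagram.mem_iff_lt_rowLen, ← h.card_row, ← h'.card_row]
  have h1 := key r i
  have h2 := key r' i
  rw [hk, hk] at h2
  rw [show (Finset.univ.filter fun x => r x = i).card = (Finset.univ.filter fun x => r' x = i).card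
    by omega]

/-- If entries in the same row of a tableau `(r, c')` of shape `μ` lie in different columns of a
tableau `(r', c)` of the same shape, then `(r, c)` is also a tableau of shape `μ`. -/
theorem IsTableau.mem_of_injective {μ : YoungDiagram} {r c r' c' : X → ℕ} (h : IsTableau μ r' c)
    (h' : IsTableau μ r c') (inj : Function.Injective fun x => (r x, c x)) (x : X) :
    (r x, c x) ∈ μ := by
  rw [YoungDiagram.mem_iff_lt_colLen]
  by_contra! hx
  set k := r x
  -- The tableaux `(r, c')` and `(r', c)` have the same shape, so their first `k` rows contain
  -- equally many entries.
  have hrow : (Finset.univ.filter fun x => r x < k).card =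
      (Finset.univ.filter fun x => r' x < k).card := by
    rw [card_rows_lt_eq_sum r c', card_rows_lt_eq_sum r' c]
    simp only [h.card_col, h'.card_col]
    -- Empty columns contribute nothing, so both sums may be taken over the union of the two sets of
    -- columns.
    have hbig : ∀ (d : X → ℕ) (s : X → ℕ) (hd : IsTableau μ s d) (t : Finset ℕ),
        Finset.univ.image d ⊆ t → ∑ j ∈ Finset.univ.image d, min k (μ.colLen j) =
        ∑ j ∈ t, min k (μ.colLen j) := by
      intro d s hd t ht
      refine Finset.sum_subset ht fun j _ hj => ?_
      rw [← hd.card_col, Finset.card_eq_zero, Finset.filter_eq_empty_iff]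
      rintro y - ⟨rfl, -⟩
      exact hj (Finset.mem_image_of_mem _ (Finset.mem_univ _))
    rw [hbig c' r h' _ Finset.subset_union_left, hbig c r' h _ Finset.subset_union_right]
  rw [card_rows_lt_eq_sum r c, card_rows_lt_eq_sum r' c] at hrow
  have hle : ∀ j ∈ Finset.univ.image c, (Finset.univ.filter fun x => c x = j ∧ r x < k).card ≤
      (Finset.univ.filter fun x => c x = j ∧ r' x < k).card := fun j _ => by
    rw [h.card_col]; exact h.card_col_le inj j k
  -- Equal totals force equality in every column. So the column of `x` already has all its `colLen`
  -- entries in rows below `k`, while `x` itself has row `k`: one entry too many.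
  have heq := (Finset.sum_eq_sum_iff_of_le hle).1 hrow (c x)
    (Finset.mem_image_of_mem _ (Finset.mem_univ _))
  rw [h.card_col, min_eq_right hx] at heq
  have hlt : (Finset.univ.filter fun y => c y = c x ∧ r y < k).card <
      (Finset.univ.filter fun y => c y = c x ∧ r y < k + 1).card := by
    refine Finset.card_lt_card (Finset.ssubset_iff_of_subset ?_ |>.2 ⟨x, ?_, ?_⟩)
    · intro y; simp only [Finset.mem_filter]; rintro ⟨a, b, d⟩; exact ⟨a, b, by omega⟩
    · simp [k]
    · simp [k]
  have := h.card_col_le inj (c x) (k + 1)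
  have := min_le_right (k + 1) (μ.colLen (c x))
  omega

end Tableaux

end BGG

namespace BGG

/-! ### Young symmetrizers -/

section Symmetrizers

open Equiv MonoidAlgebra

variable (F : Type*) [Field F] {X : Type*} [Fintype X] [DecidableEq X]

/-- The signed sum of the column stabilizer. -/
def colAlt (c : X → ℕ) : MonoidAlgebra F (Perm X) :=
  ∑ σ : Perm X with ∀ x, c (σ x) = c x, single σ ((Perm.sign σ : ℤ) : F)

/-- The sum of the row stabilizer. -/
def rowSum (r : X → ℕ) : MonoidAlgebra F (Perm X) :=
  ∑ σ : Perm X with ∀ x, r (σ x) = r x, single σ (1 : F)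

/-- The Young symmetrizer. -/
def youngSym (r c : X → ℕ) : MonoidAlgebra F (Perm X) := colAlt F c * rowSum F r

variable {F}

theorem single_mul_rowSum {r : X → ℕ} {τ : Perm X} (h : ∀ x, r (τ x) = r x) :
    single τ 1 * rowSum F r = rowSum F r := by
  rw [rowSum, Finset.mul_sum]
  refine Finset.sum_equiv (Equiv.mulLeft τ) (fun σ => ?_) fun σ _ => ?_
  · simp [h]
  · simp [single_mul_single]

theorem rowSum_mul_single {r : X → ℕ} {τ : Perm X} (h : ∀ x, r (τ x) = r x) :
    rowSum F r * single τ 1 = rowSum F r := by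
  rw [rowSum, Finset.sum_mul]
  refine Finset.sum_equiv (Equiv.mulRight τ) (fun σ => ?_) fun σ _ => ?_
  · simp only [Finset.mem_filter, Finset.mem_univ, true_and, coe_mulRight, Perm.coe_mul,
      Function.comp_apply]
    refine ⟨fun h' x => (h' _).trans (h x), fun h' x => ?_⟩
    have h1 := h' (τ.symm x)
    have h2 := h (τ.symm x)
    simp only [apply_symm_apply] at h1 h2
    exact h1.trans h2.symm
  · simp [single_mul_single]

theorem single_mul_colAlt {c : X → ℕ} {τ : Perm X} (h : ∀ x, c (τ x) = c x) :
    single τ 1 * colAlt F c = ((Perm.sign τ : ℤ) : F) • colAlt F c := by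
  rw [colAlt, Finset.mul_sum, Finset.smul_sum]
  refine Finset.sum_equiv (Equiv.mulLeft τ) (fun σ => ?_) fun σ _ => ?_
  · simp [h]
  · rcases Int.units_eq_one_or (Perm.sign τ) with h1 | h1 <;>
      simp [single_mul_single, h1]

theorem colAlt_mul_single {c : X → ℕ} {τ : Perm X} (h : ∀ x, c (τ x) = c x) :
    colAlt F c * single τ 1 = ((Perm.sign τ : ℤ) : F) • colAlt F c := by
  rw [colAlt, Finset.sum_mul, Finset.smul_sum]
  refine Finset.sum_equiv (Equiv.mulRight τ) (fun σ => ?_) fun σ _ => ?_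
  · simp only [Finset.mem_filter, Finset.mem_univ, true_and, coe_mulRight, Perm.coe_mul,
      Function.comp_apply]
    refine ⟨fun h' x => (h' _).trans (h x), fun h' x => ?_⟩
    have h1 := h' (τ.symm x)
    have h2 := h (τ.symm x)
    simp only [apply_symm_apply] at h1 h2
    exact h1.trans h2.symm
  · rcases Int.units_eq_one_or (Perm.sign τ) with h1 | h1 <;>
      simp [single_mul_single, h1]

/-- Relabelling the entries of a tableau along a bijection, in the group algebra. -/
def permAlgMap {Z : Type*} (g : X ≃ Z) :
    MonoidAlgebra F (Perm X) →ₐ[F] MonoidAlgebra F (Perm Z) :=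
  MonoidAlgebra.mapDomainAlgHom F F g.permCongrHom.toMonoidHom

theorem permAlgMap_single {Z : Type*} (g : X ≃ Z) (σ : Perm X) (a : F) :
    permAlgMap g (single σ a) = single (g.permCongr σ) a := by
  simp [permAlgMap]

variable {Z : Type*} [Fintype Z] [DecidableEq Z]

theorem permAlgMap_rowSum (g : X ≃ Z) (r : X → ℕ) :
    permAlgMap g (rowSum F r) = rowSum F (r ∘ g.symm) := by
  rw [rowSum, rowSum, map_sum]
  refine Finset.sum_equiv g.permCongr (fun σ => ?_) fun σ _ => permAlgMap_single g σ 1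
  simp only [Finset.mem_filter, Finset.mem_univ, true_and, permCongr_apply, Function.comp_apply,
    symm_apply_apply]
  exact g.forall_congr (by simp)

theorem permAlgMap_colAlt (g : X ≃ Z) (c : X → ℕ) :
    permAlgMap g (colAlt F c) = colAlt F (c ∘ g.symm) := by
  rw [colAlt, colAlt, map_sum]
  refine Finset.sum_equiv g.permCongr (fun σ => ?_) fun σ _ => ?_
  · simp only [Finset.mem_filter, Finset.mem_univ, true_and, permCongr_apply, Function.comp_apply,
      symm_apply_apply]
    exact g.forall_congr (by simp)
  · rw [permAlgMap_single, Perm.sign_permCongr]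

theorem permAlgMap_youngSym (g : X ≃ Z) (r c : X → ℕ) :
    permAlgMap g (youngSym F r c) = youngSym F (r ∘ g.symm) (c ∘ g.symm) := by
  rw [youngSym, map_mul, permAlgMap_rowSum, permAlgMap_colAlt, youngSym]

theorem two_ne_zero_of_factorial {m : ℕ} (hm : (m.factorial : F) ≠ 0) (h2 : 2 ≤ m) :
    (2 : F) ≠ 0 := by
  intro h
  obtain ⟨k, hk⟩ := Nat.dvd_factorial (by norm_num) h2
  apply hm
  rw [hk]
  push_cast
  rw [h, zero_mul]

theorem eq_zero_of_eq_neg {V : Type*} [AddCommGroup V] [Module F V] (h2 : (2 : F) ≠ 0) {v : V}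
    (h : v = -v) : v = 0 := by
  have : (2 : F) • v = 0 := by rw [two_smul]; nth_rw 2 [h]; exact add_neg_cancel v
  exact (smul_eq_zero.1 this).resolve_left h2

theorem swap_stab {c : X → ℕ} {x y : X} (h : c x = c y) (z : X) : c (swap x y z) = c z := by
  rcases eq_or_ne z x with rfl | hx
  · simp [h]
  rcases eq_or_ne z y with rfl | hy
  · simp [h]
  rw [swap_apply_of_ne_of_ne hx hy]

theorem two_le_card_of_ne {x y : X} (h : x ≠ y) : 2 ≤ Fintype.card X :=
  Fintype.one_lt_card_iff.2 ⟨x, y, h⟩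

theorem single_swap_mul_single (g : Perm X) (x y : X) :
    single (swap (g x) (g y)) (1 : F) * single g 1 = single g 1 * single (swap x y) 1 := by
  rw [single_mul_single, single_mul_single]
  congr 1
  rw [mul_swap_eq_swap_mul]

/-- If `x ≠ y` share a row and `g x`, `g y` share a column, the transposition of `x` and `y` is
absorbed by the row sum. Moved across `g` it becomes the transposition of `g x` and `g y`, which the
column sum absorbs with sign `-1`. So the product equals its own negative. -/
theorem injective_of_colAlt_mul_ne_zero (hX : ((Fintype.card X).factorial : F) ≠ 0)
    {r c : X → ℕ} {g : Perm X} (h : colAlt F c * single g 1 * rowSum F r ≠ 0) :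
    Function.Injective fun x => (r x, c (g x)) := by
  intro x y hxy
  by_contra hne
  rw [Prod.mk.injEq] at hxy
  refine h (eq_zero_of_eq_neg (two_ne_zero_of_factorial hX (two_le_card_of_ne hne)) ?_)
  have h1 := colAlt_mul_single (F := F) (swap_stab hxy.2)
  rw [Perm.sign_swap (g.injective.ne hne)] at h1
  simp only [Units.val_neg, Units.val_one, Int.cast_neg, Int.cast_one, neg_smul, one_smul] at h1
  calc colAlt F c * single g 1 * rowSum F r
      = colAlt F c * (single g 1 * single (swap x y) 1) * rowSum F r := by
        rw [mul_assoc, mul_assoc, mul_assoc, single_mul_rowSum (swap_stab hxy.1)]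
    _ = _ := by rw [← single_swap_mul_single, ← mul_assoc, h1, neg_mul, neg_mul]

theorem injective_of_rowSum_mul_ne_zero (hX : ((Fintype.card X).factorial : F) ≠ 0)
    {r c : X → ℕ} {g : Perm X} (h : rowSum F r * single g 1 * colAlt F c ≠ 0) :
    Function.Injective fun x => (r (g x), c x) := by
  intro x y hxy
  by_contra hne
  rw [Prod.mk.injEq] at hxy
  refine h (eq_zero_of_eq_neg (two_ne_zero_of_factorial hX (two_le_card_of_ne hne)) ?_)
  have h1 := single_mul_colAlt (F := F) (swap_stab hxy.2)
  rw [Perm.sign_swap hne] at h1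
  simp only [Units.val_neg, Units.val_one, Int.cast_neg, Int.cast_one, neg_smul, one_smul] at h1
  calc rowSum F r * single g 1 * colAlt F c
      = rowSum F r * single (swap (g x) (g y)) 1 * single g 1 * colAlt F c := by
        rw [rowSum_mul_single (swap_stab hxy.1)]
    _ = rowSum F r * (single g 1 * single (swap x y) 1) * colAlt F c := by
        rw [← single_swap_mul_single, ← mul_assoc]
    _ = _ := by rw [← mul_assoc, mul_assoc _ _ (colAlt F c), h1, mul_neg]

theorem exists_single_ne_zero {a b y : MonoidAlgebra F (Perm X)} (h : a * y * b ≠ 0) :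
    ∃ g : Perm X, a * single g 1 * b ≠ 0 := by
  by_contra! hg
  refine h ?_
  induction y using MonoidAlgebra.induction_linear with
  | zero => simp
  | add p q hp hq =>
    have h1 : a * p * b = 0 := by_contra fun h => h (hp h)
    have h2 : a * q * b = 0 := by_contra fun h => h (hq h)
    rw [mul_add, add_mul, h1, h2, add_zero]
  | single σ t =>
    rw [show (single σ t : MonoidAlgebra F (Perm X)) = t • single σ 1 by simp [smul_single],
      mul_smul_comm, smul_mul_assoc, hg, smul_zero]

/-- Young symmetrizers of different shapes generate orthogonal two-sided ideals. -/
theorem youngSym_mul_youngSym_of_ne (hX : ((Fintype.card X).factorial : F) ≠ 0)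
    {μ ν : YoungDiagram} {r c r' c' : X → ℕ} (h : IsTableau μ r c) (h' : IsTableau ν r' c')
    (hne : μ ≠ ν) (y : MonoidAlgebra F (Perm X)) : youngSym F r c * y * youngSym F r' c' = 0 := by
  by_contra h0
  refine hne ?_
  -- The outer pair of column and row sums gives one dominance between the shapes, the inner pair
  -- the opposite one.
  have e1 : youngSym F r c * y * youngSym F r' c' =
      colAlt F c * (rowSum F r * y * colAlt F c') * rowSum F r' := by
    simp only [youngSym, mul_assoc]
  have h1 := h0
  rw [e1] at h1
  obtain ⟨g, hg⟩ := exists_single_ne_zero h1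
  have h2 : rowSum F r * y * colAlt F c' ≠ 0 := fun hz => h1 (by rw [hz]; simp)
  obtain ⟨g', hg'⟩ := exists_single_ne_zero h2
  have i1 := injective_of_colAlt_mul_ne_zero hX hg
  have i2 := injective_of_rowSum_mul_ne_zero hX hg'
  have cardeq : ∀ (e : Perm X) (s : X → ℕ) (k : ℕ),
      (Finset.univ.filter fun x => s (e x) < k).card = (Finset.univ.filter fun x => s x < k).card :=
    fun e s k => Finset.card_equiv e (by simp)
  refine h.shape_eq h' fun k => le_antisymm ?_ ?_
  · rw [← cardeq g r]
    exact (h.comp_equiv g).card_rows_lt_le i1 k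
  · rw [← cardeq g' r]
    exact h'.card_rows_lt_le i2 k

/-- It suffices to treat a permutation `g` with non-zero product. Such a `g` factors into a column
permutation times a row permutation, and these are absorbed on the left and on the right. -/
theorem colAlt_mul_mul_rowSum (hX : ((Fintype.card X).factorial : F) ≠ 0)
    {μ : YoungDiagram} {r c : X → ℕ} (h : IsTableau μ r c) (y : MonoidAlgebra F (Perm X)) :
    ∃ t : F, colAlt F c * y * rowSum F r = t • youngSym F r c := by
  induction y using MonoidAlgebra.induction_linear with
  | zero => exact ⟨0, by simp⟩
  | add p q hp hq =>
    obtain ⟨s, hs⟩ := hp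
    obtain ⟨t, ht⟩ := hq
    exact ⟨s + t, by rw [mul_add, add_mul, hs, ht, add_smul]⟩
  | single g t =>
    rw [show (single g t : MonoidAlgebra F (Perm X)) = t • single g 1 by simp [smul_single],
      mul_smul_comm, smul_mul_assoc]
    by_cases hg : colAlt F c * single g 1 * rowSum F r = 0
    · exact ⟨0, by rw [hg]; simp⟩
    have inj := injective_of_colAlt_mul_ne_zero hX hg
    -- The pair `(r, c ∘ g)` takes its values in the diagram, so there is an entry `p x` of the
    -- tableau `(r, c)` at the place `(r x, c (g x))`. By construction `p` preserves rows and `g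
    -- p⁻¹` preserves columns.
    have hmem := (h.comp_equiv g).mem_of_injective h inj
    choose p hp using fun x => h.surj _ (hmem x)
    simp only [Prod.mk.injEq, Function.comp_apply] at hp
    have pinj : Function.Injective p := fun x y hxy => inj (by
      change (r x, c (g x)) = (r y, c (g y))
      rw [← (hp x).1, ← (hp x).2, ← (hp y).1, ← (hp y).2, hxy])
    let P : Perm X := Equiv.ofBijective p (Finite.injective_iff_bijective.1 pinj)
    have hP : ∀ x, P x = p x := fun x => rfl
    have hq : ∀ x, c ((g * P⁻¹) x) = c x := fun x => by
      have h1 := (hp (P⁻¹ x)).2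
      rw [← hP, show P (P⁻¹ x) = x from P.apply_symm_apply x] at h1
      rw [Perm.mul_apply, h1]
    have e : (single g 1 : MonoidAlgebra F (Perm X)) = single (g * P⁻¹) 1 * single P 1 := by
      rw [single_mul_single]; simp
    refine ⟨t * ((Perm.sign (g * P⁻¹) : ℤ) : F), ?_⟩
    rw [e, ← mul_assoc, colAlt_mul_single hq, mul_assoc, single_mul_rowSum fun x => (hp x).1,
      smul_mul_assoc, mul_smul]
    rfl

theorem youngSym_mul_mul_youngSym (hX : ((Fintype.card X).factorial : F) ≠ 0)
    {μ : YoungDiagram} {r c : X → ℕ} (h : IsTableau μ r c) (y : MonoidAlgebra F (Perm X)) :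
    ∃ t : F, youngSym F r c * y * youngSym F r c = t • youngSym F r c := by
  obtain ⟨t, ht⟩ := colAlt_mul_mul_rowSum hX h (rowSum F r * y * colAlt F c)
  exact ⟨t, by rw [← ht]; simp only [youngSym, mul_assoc]⟩

/-- A permutation preserving all rows and all columns is the identity, so the identity arises only
as `1 * 1`, with sign `1`. -/
theorem youngSym_coeff_one {μ : YoungDiagram} {r c : X → ℕ} (h : IsTableau μ r c) :
    (youngSym F r c).coeff 1 = 1 := by
  rw [youngSym, colAlt, rowSum, Finset.sum_mul_sum, coeff_sum, Finset.sum_apply']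
  rw [Finset.sum_eq_single (1 : Perm X)]
  · rw [coeff_sum, Finset.sum_apply', Finset.sum_eq_single (1 : Perm X)]
    · simp [single_mul_single]
    · intro τ hτ hne
      simp [single_mul_single, hne]
    · simp
  · intro σ hσ hne
    rw [coeff_sum, Finset.sum_apply']
    refine Finset.sum_eq_zero fun τ hτ => ?_
    rw [single_mul_single, coeff_single, Finsupp.single_apply, if_neg]
    intro h1
    refine hne (Equiv.ext fun x => h.inj ?_)
    have h2 : σ = τ⁻¹ := mul_eq_one_iff_eq_inv.1 h1
    simp only [Finset.mem_filter, Finset.mem_univ, true_and] at hσ hτ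
    refine Prod.ext ?_ (hσ x)
    have := hτ (σ x)
    rw [h2, show τ (τ⁻¹ x) = x from τ.apply_symm_apply x] at this
    rw [h2]
    exact this.symm
  · simp

/-- The trace of an endomorphism of a group algebra. -/
theorem trace_eq_sum_coeff (f : MonoidAlgebra F (Perm X) →ₗ[F] MonoidAlgebra F (Perm X)) :
    LinearMap.trace F _ f = ∑ g, (f (single g 1)).coeff g := by
  let b : Module.Basis (Perm X) F (MonoidAlgebra F (Perm X)) :=
    Module.Basis.ofRepr (MonoidAlgebra.coeffLinearEquiv F)
  rw [LinearMap.trace_eq_matrix_trace F b, Matrix.trace]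
  refine Finset.sum_congr rfl fun g _ => ?_
  rw [Matrix.diag_apply, LinearMap.toMatrix_apply]
  rfl

/-- In the basis of permutations every diagonal entry of right multiplication by `a` is the
coefficient of `a` at the identity. -/
theorem trace_mulRight (a : MonoidAlgebra F (Perm X)) :
    LinearMap.trace F _ (LinearMap.mulRight F a) = ((Fintype.card X).factorial : F) * a.coeff 1 := by
  rw [trace_eq_sum_coeff]
  simp only [LinearMap.mulRight_apply, coeff_single_mul_apply, inv_mul_cancel, one_mul,
    Finset.sum_const, nsmul_eq_mul]
  rw [Finset.card_univ, Fintype.card_perm]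

/-- The scalar `h` with `c * c = h • c` for a Young symmetrizer `c` is non-zero. -/
theorem exists_youngSym_mul_self (hX : ((Fintype.card X).factorial : F) ≠ 0)
    {μ : YoungDiagram} {r c : X → ℕ} (h : IsTableau μ r c) :
    ∃ t : F, t ≠ 0 ∧ youngSym F r c * youngSym F r c = t • youngSym F r c := by
  obtain ⟨t, ht⟩ := youngSym_mul_mul_youngSym hX h 1
  rw [mul_one] at ht
  refine ⟨t, ?_, ht⟩
  rintro rfl
  rw [zero_smul] at ht
  -- If the scalar were zero, right multiplication would be nilpotent of trace zero; but its trace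
  -- is `|X|!`.
  have hnil : IsNilpotent (LinearMap.mulRight F (youngSym F r c)) := by
    refine ⟨2, ?_⟩
    refine LinearMap.ext fun x => ?_
    rw [pow_two, Module.End.mul_apply, LinearMap.mulRight_apply, LinearMap.mulRight_apply,
      mul_assoc, ht, mul_zero, LinearMap.zero_apply]
  have h1 := (LinearMap.isNilpotent_trace_of_isNilpotent hnil).eq_zero
  rw [trace_mulRight, youngSym_coeff_one h, mul_one] at h1
  exact hX h1

/-- The sum of the conjugates of an element of the group algebra. -/
def conjSum (a : MonoidAlgebra F (Perm X)) : MonoidAlgebra F (Perm X) :=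
  ∑ g : Perm X, single g 1 * a * single g⁻¹ 1

theorem single_mul_conjSum (a : MonoidAlgebra F (Perm X)) (g : Perm X) :
    single g 1 * conjSum a = conjSum a * single g 1 := by
  rw [conjSum, Finset.mul_sum, Finset.sum_mul]
  refine Finset.sum_equiv (Equiv.mulLeft g) (by simp) fun σ _ => ?_
  have h1 : (single σ⁻¹ 1 : MonoidAlgebra F (Perm X)) = single (g * σ)⁻¹ 1 * single g 1 := by
    rw [single_mul_single]; simp
  have h2 : (single (g * σ) 1 : MonoidAlgebra F (Perm X)) = single g 1 * single σ 1 := by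
    rw [single_mul_single]; simp
  rw [coe_mulLeft, h1, h2]
  simp only [mul_assoc]

/-- Left multiplications commute with right multiplications, so this is the invariance of the trace
under conjugation by left multiplication with `g`. -/
theorem trace_conj (g : Perm X) (a b : MonoidAlgebra F (Perm X)) :
    LinearMap.trace F _ (LinearMap.mulLeft F (single g 1 * a * single g⁻¹ 1) ∘ₗ
      LinearMap.mulRight F b) =
    LinearMap.trace F _ (LinearMap.mulLeft F a ∘ₗ LinearMap.mulRight F b) := by
  have h1 : LinearMap.mulLeft F (single g 1 * a * single g⁻¹ 1) ∘ₗ LinearMap.mulRight F b =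
      LinearMap.mulLeft F (single g 1) *
        ((LinearMap.mulLeft F a ∘ₗ LinearMap.mulRight F b) * LinearMap.mulLeft F (single g⁻¹ 1)) := by
    refine LinearMap.ext fun x => ?_
    simp [Module.End.mul_apply, mul_assoc]
  rw [h1, LinearMap.trace_mul_comm, mul_assoc,
    show LinearMap.mulLeft F (single g⁻¹ (1 : F)) * LinearMap.mulLeft F (single g 1) = 1 by
      refine LinearMap.ext fun x => ?_
      rw [Module.End.mul_apply, LinearMap.mulLeft_apply, LinearMap.mulLeft_apply, ← mul_assoc,
        single_mul_single, inv_mul_cancel,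
        mul_one, ← MonoidAlgebra.one_def, one_mul, Module.End.one_apply], mul_one]

/-- Let `a` be the symmetrizer, with `a * a = t • a`. If the product vanished, centrality of
`conjSum a` would make `x ↦ conjSum a * x * a` zero. But its trace is `|X|!` times the trace of `x ↦
a * x * a`, a rank one map onto the line of `a`, whose trace is the coefficient of `a * a * a` at
the identity, namely `t ^ 2`. -/
theorem conjSum_mul_youngSym_ne_zero (hX : ((Fintype.card X).factorial : F) ≠ 0)
    {μ : YoungDiagram} {r c : X → ℕ} (h : IsTableau μ r c) :
    conjSum (youngSym F r c) * youngSym F r c ≠ 0 := by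
  intro h0
  set a := youngSym F r c with ha
  obtain ⟨t, ht0, ht⟩ := exists_youngSym_mul_self hX h
  rw [← ha] at ht
  have comm : ∀ x, conjSum a * x = x * conjSum a := by
    intro x
    induction x using MonoidAlgebra.induction_linear with
    | zero => simp
    | add p q hp hq => rw [mul_add, add_mul, hp, hq]
    | single g s =>
      rw [show (single g s : MonoidAlgebra F (Perm X)) = s • single g 1 by simp [smul_single],
        mul_smul_comm, smul_mul_assoc, single_mul_conjSum]
  have z : LinearMap.mulLeft F (conjSum a) ∘ₗ LinearMap.mulRight F a = 0 := by
    refine LinearMap.ext fun x => ?_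
    simp only [LinearMap.comp_apply, LinearMap.mulLeft_apply, LinearMap.mulRight_apply,
      LinearMap.zero_apply]
    rw [← mul_assoc, comm, mul_assoc, h0, mul_zero]
  have e : LinearMap.mulLeft F (conjSum a) ∘ₗ LinearMap.mulRight F a =
      ∑ g : Perm X, LinearMap.mulLeft F (single g 1 * a * single g⁻¹ 1) ∘ₗ
        LinearMap.mulRight F a := by
    refine LinearMap.ext fun x => ?_
    simp [conjSum, Finset.sum_mul, LinearMap.sum_apply, mul_assoc]
  have tr := congrArg (LinearMap.trace F _) (e.symm.trans z)
  simp only [map_sum, trace_conj, Finset.sum_const, map_zero, nsmul_eq_mul] at tr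
  rw [Finset.card_univ, Fintype.card_perm] at tr
  have tr0 := (mul_eq_zero.1 tr).resolve_left hX
  let f : MonoidAlgebra F (Perm X) →ₗ[F] F :=
    (Finsupp.lapply 1 ∘ₗ (MonoidAlgebra.coeffLinearEquiv F).toLinearMap) ∘ₗ
      (LinearMap.mulLeft F a ∘ₗ LinearMap.mulRight F a)
  have hf : ∀ x, f x = (a * (x * a)).coeff 1 := fun x => rfl
  have e2 : LinearMap.mulLeft F a ∘ₗ LinearMap.mulRight F a = f.smulRight a := by
    refine LinearMap.ext fun x => ?_
    obtain ⟨s, hs⟩ := youngSym_mul_mul_youngSym hX h x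
    rw [← ha, mul_assoc] at hs
    have h1 : a.coeff 1 = 1 := youngSym_coeff_one h
    simp [hf, hs, h1]
  rw [e2, LinearMap.trace_smulRight, hf, ht, mul_smul_comm, ht, coeff_smul, Finsupp.smul_apply,
    coeff_smul, Finsupp.smul_apply, ha, youngSym_coeff_one h] at tr0
  simp only [smul_eq_mul, mul_one, mul_self_eq_zero] at tr0
  exact ht0 tr0

end Symmetrizers

end BGG

namespace BGG

/-! ### Young symmetrizers generate the group algebra: counting partitions against conjugacy
classes. -/

section Completeness

open Equiv MonoidAlgebra

theorem card_cellsOfRowLens (w : List ℕ) : (YoungDiagram.cellsOfRowLens w).card = w.sum := by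
  induction w with
  | nil => simp [YoungDiagram.cellsOfRowLens]
  | cons a w ih =>
    rw [YoungDiagram.cellsOfRowLens, Finset.card_union_of_disjoint, Finset.card_map, ih,
      Finset.card_product]
    · simp
    · rw [Finset.disjoint_left]
      rintro ⟨i, j⟩ h1 h2
      simp only [Finset.mem_product, Finset.mem_singleton] at h1
      simp only [Finset.mem_map] at h2
      obtain ⟨⟨a, b⟩, -, h3⟩ := h2
      simp [Function.Embedding.prodMap] at h3
      omega

/-- The Young diagram of a partition. -/
def diagramOfPartition {m : ℕ} (p : m.Partition) : YoungDiagram :=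
  YoungDiagram.ofRowLens (p.parts.sort (· ≥ ·)) (p.parts.pairwise_sort (· ≥ ·)).sortedGE

theorem card_diagramOfPartition {m : ℕ} (p : m.Partition) : (diagramOfPartition p).card = m := by
  refine (card_cellsOfRowLens _).trans ?_
  rw [← Multiset.sum_coe, Multiset.sort_eq, p.parts_sum]

theorem diagramOfPartition_injective {m : ℕ} :
    Function.Injective (diagramOfPartition : m.Partition → YoungDiagram) := by
  intro p q h
  have h1 : ∀ p : m.Partition, (diagramOfPartition p).rowLens = p.parts.sort (· ≥ ·) := fun p =>
    YoungDiagram.rowLens_ofRowLens_eq_self fun x hx =>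
      p.parts_pos ((Multiset.mem_sort _).1 hx)
  have h2 := (h1 p).symm.trans ((congrArg _ h).trans (h1 q))
  refine Nat.Partition.ext ?_
  rw [← Multiset.sort_eq p.parts (· ≥ ·), h2, Multiset.sort_eq]

theorem exists_isTableau {X : Type*} [Fintype X] {μ : YoungDiagram} (h : μ.card = Fintype.card X) :
    ∃ r c : X → ℕ, IsTableau μ r c := by
  have e : X ≃ μ.cells := Fintype.equivOfCardEq (by rw [← h]; simp)
  exact ⟨_, _, (isTableau_cells μ).comp_equiv e⟩

variable {F : Type*} [Field F] {X : Type*} [Fintype X] [DecidableEq X]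

variable (F X) in
/-- The class functions, as a subspace of the group algebra. -/
def classSubmodule : Submodule F (MonoidAlgebra F (Perm X)) where
  carrier := {z | ∀ g : Perm X, single g 1 * z = z * single g 1}
  add_mem' ha hb g := by rw [mul_add, add_mul, ha, hb]
  zero_mem' g := by simp
  smul_mem' c a ha g := by rw [mul_smul_comm, smul_mul_assoc, ha]

/-- Permutations of equal cycle type are conjugate, so a class function is determined by its values
at one permutation of each cycle type. -/
theorem finrank_classSubmodule_le :
    Module.finrank F (classSubmodule F X) ≤ Fintype.card (Fintype.card X).Partition := by
  let f : MonoidAlgebra F (Perm X) →ₗ[F] ((Fintype.card X).Partition → F) :=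
    -- A partition that is not a cycle type would get the zero functional; this does no harm, since
    -- only injectivity is used.
    LinearMap.pi fun p => open Classical in
      if h : ∃ σ : Perm X, σ.partition = p then
        Finsupp.lapply h.choose ∘ₗ (MonoidAlgebra.coeffLinearEquiv F).toLinearMap else 0
  have inj : Function.Injective (f ∘ₗ (classSubmodule F X).subtype) := by
    rw [injective_iff_map_eq_zero]
    rintro ⟨z, hz⟩ h0
    refine Subtype.ext (MonoidAlgebra.ext (Finsupp.ext fun σ => ?_))
    have h1 := congrFun h0 σ.partition
    have hex : ∃ τ : Perm X, τ.partition = σ.partition := ⟨σ, rfl⟩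
    simp only [f, LinearMap.comp_apply, LinearMap.pi_apply, dif_pos hex, Pi.zero_apply] at h1
    obtain ⟨g, hg⟩ := isConj_iff.1 (Perm.partition_eq_of_isConj.2 hex.choose_spec)
    have h2 := congrArg (fun y : MonoidAlgebra F (Perm X) => y.coeff (g * hex.choose)) (hz g)
    simp only [coeff_single_mul_apply, coeff_mul_single_apply, inv_mul_cancel_left, hg, one_mul,
      mul_one] at h2
    exact h2.symm.trans h1
  simpa using LinearMap.finrank_le_finrank_of_injective inj

/-- Over a field in which `|X|!` is invertible, the two-sided ideals generated by the Young
symmetrizers add up to the group algebra. -/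
theorem one_mem_span_youngSym (hX : ((Fintype.card X).factorial : F) ≠ 0) :
    (1 : MonoidAlgebra F (Perm X)) ∈ Submodule.span F
      {z | ∃ μ r c a b, IsTableau μ r c ∧ z = a * youngSym F r c * b} := by
  choose r c hT using fun p : (Fintype.card X).Partition =>
    exists_isTableau (X := X) (card_diagramOfPartition p)
  let z : (Fintype.card X).Partition → MonoidAlgebra F (Perm X) :=
    fun p => conjSum (youngSym F (r p) (c p))
  -- Multiplying a relation by the symmetrizer of shape `q` kills every term except the one at `q`.
  have hz : LinearIndependent F z := by
    rw [Fintype.linearIndependent_iff]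
    intro a ha q
    have h1 := congrArg (fun y => y * youngSym F (r q) (c q)) ha
    simp only [Finset.sum_mul, zero_mul] at h1
    rw [Finset.sum_eq_single q] at h1
    · rw [smul_mul_assoc] at h1
      exact (smul_eq_zero.1 h1).resolve_right (conjSum_mul_youngSym_ne_zero hX (hT q))
    · intro p _ hp
      have h2 : z p * youngSym F (r q) (c q) = 0 := by
        simp only [z, conjSum, Finset.sum_mul]
        refine Finset.sum_eq_zero fun g _ => ?_
        rw [mul_assoc, mul_assoc, ← mul_assoc (youngSym F (r p) (c p)),
          youngSym_mul_youngSym_of_ne hX (hT p) (hT q)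
            (fun h => hp (diagramOfPartition_injective h)), mul_zero]
      rw [smul_mul_assoc, h2, smul_zero]
    · simp
  have hle : Submodule.span F (Set.range z) ≤ classSubmodule F X := by
    rw [Submodule.span_le]
    rintro _ ⟨p, rfl⟩
    exact single_mul_conjSum _
  -- There are as many independent central elements `z p` as the dimension of the centre allows, so
  -- they span the centre, which contains `1`.
  have heq := Submodule.eq_of_le_of_finrank_le hle
    (by rw [finrank_span_eq_card hz]; exact finrank_classSubmodule_le)
  have h1 : (1 : MonoidAlgebra F (Perm X)) ∈ classSubmodule F X := fun g => by simp
  rw [← heq] at h1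
  refine Submodule.span_le.2 ?_ h1
  rintro _ ⟨p, rfl⟩
  refine Submodule.sum_mem _ fun g _ => Submodule.subset_span ⟨_, _, _, _, _, hT p, rfl⟩

end Completeness

end BGG

namespace BGG

/-! ### Weight spaces of idempotents -/

section WeightSpace

variable (F : Type*) [Field F] {B : Type*} [Ring B] [Algebra F B]
variable (e : B) (M : Type*) [AddCommGroup M] [Module F M] [Module B M] [IsScalarTower F B M]

/-- The vectors of a module fixed by an element `e` of the algebra. -/
def weightSpace : Submodule F M where
  carrier := {x | e • x = x}
  add_mem' ha hb := by
    simp only [Set.mem_ofPred_eq] at *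
    rw [smul_add, ha, hb]
  zero_mem' := smul_zero e
  smul_mem' c a ha := by
    simp only [Set.mem_ofPred_eq] at *
    rw [smul_comm, ha]

variable {e M}

theorem mem_weightSpace {x : M} : x ∈ weightSpace F e M ↔ e • x = x := Iff.rfl

theorem smul_mem_weightSpace (he : e * e = e) (x : M) : e • x ∈ weightSpace F e M := by
  rw [mem_weightSpace, smul_smul, he]

variable [FiniteDimensional F M]

/-- Passing to the image of an idempotent is exact: a fixed vector of the quotient, lifted
arbitrarily to `p`, is also lifted by the fixed vector `e • p`. -/
theorem finrank_weightSpace_inf (he : e * e = e) {N P : Submodule B M} (h : N ≤ P) :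
    Module.finrank F ↥(weightSpace F e M ⊓ P.restrictScalars F) =
      Module.finrank F ↥(weightSpace F e M ⊓ N.restrictScalars F) +
        Module.finrank F (weightSpace F e (P ⧸ N.submoduleOf P)) := by
  let φ : ↥(weightSpace F e M ⊓ P.restrictScalars F) →ₗ[F] (P ⧸ N.submoduleOf P) :=
    ((N.submoduleOf P).mkQ.restrictScalars F) ∘ₗ
      (Submodule.inclusion (inf_le_right : weightSpace F e M ⊓ P.restrictScalars F ≤ _))
  have hr : LinearMap.range φ = weightSpace F e (P ⧸ N.submoduleOf P) := by
    refine le_antisymm ?_ ?_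
    · rintro _ ⟨x, rfl⟩
      refine (map_smul (N.submoduleOf P).mkQ e _).symm.trans (congrArg _ (Subtype.ext ?_))
      exact x.2.1
    · intro y hy
      obtain ⟨p, rfl⟩ := Submodule.mkQ_surjective _ y
      refine ⟨⟨e • (p : M), smul_mem_weightSpace F he _, P.smul_mem e p.2⟩, ?_⟩
      rw [mem_weightSpace] at hy
      exact (map_smul (N.submoduleOf P).mkQ e p).trans hy
  have hk : LinearMap.ker φ = (weightSpace F e M ⊓ N.restrictScalars F).comap
      (weightSpace F e M ⊓ P.restrictScalars F).subtype := by
    ext x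
    rw [LinearMap.mem_ker, Submodule.mem_comap]
    change Submodule.Quotient.mk _ = (0 : P ⧸ N.submoduleOf P) ↔ _
    rw [Submodule.Quotient.mk_eq_zero]
    exact ⟨fun h => ⟨x.2.1, h⟩, fun h => h.2⟩
  rw [← LinearMap.finrank_range_add_finrank_ker φ, hr, hk, add_comm]
  congr 1
  exact (Submodule.comapSubtypeEquivOfLe
    (inf_le_inf_left _ (show N.restrictScalars F ≤ P.restrictScalars F from h))).finrank_eq

theorem last_eq_zero_add_sum (n : ℕ) (a : Fin (n + 1) → ℕ) (b : Fin n → ℕ)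
    (h : ∀ j : Fin n, a j.succ = a j.castSucc + b j) : a (Fin.last n) = a 0 + ∑ j, b j := by
  induction n with
  | zero => simp
  | succ n ih =>
    have h1 := ih (fun j => a j.castSucc) (fun j => b j.castSucc) fun j => by
      rw [← h j.castSucc, Fin.succ_castSucc]
    rw [Fin.sum_univ_castSucc, ← add_assoc, ← Fin.succ_last, h (Fin.last n), h1]
    rfl

/-- If the weight space of an idempotent is a line in modules isomorphic to `L` and zero in all
other simple modules, then its dimension is the multiplicity of `L`. -/
theorem compMult_eq_finrank {M : Type x} [AddCommGroup M] [Module F M] [Module B M]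
    [IsScalarTower F B M] [FiniteDimensional F M] (he : e * e = e)
    (L : Type*) [AddCommGroup L] [Module B L]
    (h1 : ∀ (S : Type x) [AddCommGroup S] [Module F S] [Module B S] [IsScalarTower F B S]
      [IsSimpleModule B S], Nonempty (S ≃ₗ[B] L) → Module.finrank F (weightSpace F e S) = 1)
    (h0 : ∀ (S : Type x) [AddCommGroup S] [Module F S] [Module B S] [IsScalarTower F B S]
      [IsSimpleModule B S], ¬ Nonempty (S ≃ₗ[B] L) → Module.finrank F (weightSpace F e S) = 0) :
    compMult B M L = Module.finrank F (weightSpace F e M) := by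
  classical
  have : IsNoetherian B M := isNoetherian_of_tower F inferInstance
  have : IsArtinian B M := isArtinian_of_tower F inferInstance
  have hs : ∃ s : CompositionSeries (Submodule B M), s.head = ⊥ ∧ s.last = ⊤ :=
    exists_compositionSeries_of_isNoetherian_isArtinian B M
  rw [compMult, dif_pos hs]
  set s := hs.choose
  obtain ⟨hb, ht⟩ := hs.choose_spec
  -- The dimension of the weight space is the sum of its dimensions on the composition factors, each
  -- of which is `1` or `0`.
  have key := last_eq_zero_add_sum s.length
    (fun j => Module.finrank F ↥(weightSpace F e M ⊓ (s j).restrictScalars F))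
    (fun j => Module.finrank F
      (weightSpace F e (s j.succ ⧸ (s j.castSucc).submoduleOf (s j.succ))))
    (fun j => finrank_weightSpace_inf F he (s.step j).le)
  have e0 : s 0 = ⊥ := hb
  have e1 : s (Fin.last s.length) = ⊤ := ht
  dsimp only at key
  rw [show (s (Fin.last s.length)).restrictScalars F = ⊤ by rw [e1]; rfl,
    show (s 0).restrictScalars F = ⊥ by rw [e0]; rfl,
    inf_bot_eq, inf_top_eq, finrank_bot, zero_add] at key
  rw [key, Nat.card_eq_fintype_card, Fintype.card_subtype, Finset.card_filter]
  refine Finset.sum_congr rfl fun j _ => ?_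
  have : IsSimpleModule B (s j.succ ⧸ (s j.castSucc).submoduleOf (s j.succ)) :=
    (covBy_iff_quot_is_simple (s.step j).le).1 (s.step j)
  split_ifs with hj
  · exact (h1 _ hj).symm
  · exact (h0 _ hj).symm

end WeightSpace

/-! ### Standard modules from idempotents -/

section WeightData

variable (F : Type u) [Field F] (B : Type v) [Ring B] [Algebra F B]
variable {Λ : Type w} [PartialOrder Λ] (D : Λ → Type x) [∀ l, AddCommGroup (D l)]
  [∀ l, Module F (D l)] [∀ l, Module B (D l)] [∀ l, IsScalarTower F B (D l)]

/-- Idempotents `e l` and vectors `u l` spanning the highest weight spaces `e l D l` of modules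
`D l`. -/
structure WeightData (e : Λ → B) (u : ∀ l, D l) : Prop where
  finite_index : Finite Λ
  finiteDimensional (l : Λ) : FiniteDimensional F (D l)
  idem (l : Λ) : e l * e l = e l
  weight (l : Λ) : e l • u l = u l
  ne_zero (l : Λ) : u l ≠ 0
  line (l : Λ) (y : D l) : ∃ c : F, e l • y = c • u l
  generates (l : Λ) (y : D l) : ∃ b : B, b • u l = y
  le_of_ne_zero (l m : Λ) (y : D l) : e m • y ≠ 0 → m ≤ l
  one_mem : (1 : B) ∈ Submodule.span F {z | ∃ l a b, z = a * e l * b}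
  residue (l : Λ) (b : B) : ∃ c : F, e l * b * e l - c • e l ∈ Ring.jacobson B

variable {F B D} {e : Λ → B} {u : ∀ l, D l}

theorem smul_eq_zero_of_mem_jacobson {b : B} (hb : b ∈ Ring.jacobson B) {S : Type*}
    [AddCommGroup S] [Module B S] [IsSimpleModule B S] (y : S) : b • y = 0 := by
  have h1 : b • y ∈ Module.jacobson B S :=
    Ring.jacobson_smul_top_le B S (Submodule.smul_mem_smul hb Submodule.mem_top)
  rwa [IsSimpleModule.jacobson_eq_bot, Submodule.mem_bot] at h1

/-- An endomorphism sends the generator `z` into the weight line of `z`, hence to a multiple of `z`.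
This serves both the standard modules and their heads. -/
theorem exists_unique_scalar {V : Type*} [AddCommGroup V] [Module F V] [Module B V]
    [IsScalarTower F B V] {p : B} {z : V} (hz : z ≠ 0) (hp : p • z = z)
    (line : ∀ y : V, ∃ c : F, p • y = c • z) (gen : ∀ y : V, ∃ b : B, b • z = y)
    (f : V →ₗ[B] V) : ∃! c : F, ∀ y, f y = c • y := by
  obtain ⟨c, hc⟩ := line (f z)
  rw [← map_smul, hp] at hc
  refine ⟨c, fun y => ?_, fun c' hc' => ?_⟩
  · obtain ⟨b, rfl⟩ := gen y
    rw [map_smul, hc, smul_comm]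
  · have h1 := (hc' z).symm.trans hc
    exact smul_left_injective F hz h1

namespace WeightData

variable (h : WeightData F B D e u)

include h

/-- Since `1` lies in the two-sided ideal generated by the `e l`, every module is generated by its
weight spaces. -/
theorem mem_of_forall_smul_mem {M : Type*} [AddCommGroup M] [Module F M] [Module B M]
    [IsScalarTower F B M] (N : Submodule B M) (hN : ∀ l (y : M), e l • y ∈ N) (y : M) : y ∈ N := by
  have key : ∀ t ∈ Submodule.span F {z | ∃ l a b, z = a * e l * b}, t • y ∈ N := by
    intro t ht
    induction ht using Submodule.span_induction with
    | mem t ht =>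
      obtain ⟨l, a, b, rfl⟩ := ht
      rw [mul_smul, mul_smul]
      exact N.smul_mem a (hN l _)
    | zero => rw [zero_smul]; exact N.zero_mem
    | add s t _ _ hs ht => rw [add_smul]; exact N.add_mem hs ht
    | smul c t _ ht => rw [smul_assoc]; exact (N.restrictScalars F).smul_mem c ht
  simpa using key 1 h.one_mem

/-- A non-zero vector of weight `l` is a non-zero multiple of the generator `u l`. -/
theorem eq_top_of_smul_ne_zero {l : Λ} (N : Submodule B (D l)) {y : D l} (hy : y ∈ N)
    (hne : e l • y ≠ 0) : N = ⊤ := by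
  obtain ⟨c, hc⟩ := h.line l y
  have hc0 : c ≠ 0 := by rintro rfl; exact hne (by rw [hc, zero_smul])
  refine eq_top_iff.2 fun z _ => ?_
  obtain ⟨a, rfl⟩ := h.generates l z
  have h1 : c • u l ∈ N := by rw [← hc]; exact N.smul_mem _ hy
  have h2 := (N.restrictScalars F).smul_mem c⁻¹ h1
  rw [smul_smul, inv_mul_cancel₀ hc0, one_smul] at h2
  exact N.smul_mem a h2

/-- The vectors `y` with `e l • b • y = 0` for all `b` form the largest submodule annihilated by `e
l`. It contains every proper submodule, so it is the unique maximal submodule and equals the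
radical. -/
theorem isCoatom_jacobson_and_mem_iff (l : Λ) : IsCoatom (Module.jacobson B (D l)) ∧
    ∀ y, y ∈ Module.jacobson B (D l) ↔ ∀ b : B, e l • b • y = 0 := by
  let R : Submodule B (D l) :=
    { carrier := {y | ∀ b : B, e l • b • y = 0}
      add_mem' := fun ha hb b => by rw [smul_add, smul_add, ha, hb, add_zero]
      zero_mem' := fun b => by simp
      smul_mem' := fun a y hy b => by rw [smul_smul b a]; exact hy _ }
  have hR : ∀ N : Submodule B (D l), N ≠ ⊤ → N ≤ R := fun N hN y hy b =>
    by_contra fun h0 => hN (h.eq_top_of_smul_ne_zero N (N.smul_mem b hy) h0)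
  have hne : R ≠ ⊤ := by
    intro h0
    have h1 : u l ∈ R := h0 ▸ Submodule.mem_top
    have h2 := h1 1
    rw [one_smul, h.weight] at h2
    exact h.ne_zero l h2
  have hco : IsCoatom R := ⟨hne, fun N hN => by_contra fun h0 => (hR N h0).not_gt hN⟩
  have : Module.jacobson B (D l) = R := by
    refine le_antisymm (sInf_le hco) (le_sInf fun N hN => ?_)
    rcases hN.le_iff.1 (le_sup_left : N ≤ N ⊔ R) with h1 | h1
    · exact absurd (eq_top_iff.2 (h1 ▸ sup_le (hR N hN.1) le_rfl)) hne
    · rw [← h1]; exact le_sup_right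
  rw [this]
  exact ⟨hco, fun y => Iff.rfl⟩

theorem mem_jacobson_iff (l : Λ) (y : D l) :
    y ∈ Module.jacobson B (D l) ↔ ∀ b : B, e l • b • y = 0 :=
  (h.isCoatom_jacobson_and_mem_iff l).2 y

theorem isCoatom_jacobson (l : Λ) : IsCoatom (Module.jacobson B (D l)) :=
  (h.isCoatom_jacobson_and_mem_iff l).1

theorem isSimpleModule_head (l : Λ) : IsSimpleModule B (Head B (D l)) :=
  isSimpleModule_iff_isCoatom.2 (h.isCoatom_jacobson l)

omit h in
variable (B u) in
/-- The image of `u l` in the head. -/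
def headVec (l : Λ) : Head B (D l) := Submodule.Quotient.mk (u l)

theorem weight_headVec (l : Λ) : e l • headVec B u l = headVec B u l := by
  rw [headVec, ← Submodule.Quotient.mk_smul, h.weight]

theorem headVec_ne_zero (l : Λ) : headVec B u l ≠ 0 := by
  intro h0
  have h1 := (h.mem_jacobson_iff l (u l)).1 ((Submodule.Quotient.mk_eq_zero _).1 h0) 1
  rw [one_smul, h.weight] at h1
  exact h.ne_zero l h1

theorem head_line (l : Λ) (y : Head B (D l)) : ∃ c : F, e l • y = c • headVec B u l := by
  obtain ⟨y, rfl⟩ := Submodule.mkQ_surjective _ y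
  obtain ⟨c, hc⟩ := h.line l y
  exact ⟨c, by rw [← map_smul, hc]; rfl⟩

theorem head_generates (l : Λ) (y : Head B (D l)) : ∃ b : B, b • headVec B u l = y := by
  obtain ⟨y, rfl⟩ := Submodule.mkQ_surjective _ y
  obtain ⟨b, rfl⟩ := h.generates l y
  exact ⟨b, rfl⟩

/-- Whatever kills the head vector kills `v = e l • y`. Otherwise let `b` be a counterexample and
choose `a` with `a b v = v`. Modulo the radical `e l * (a * b) * e l` is `c • e l`; its action on
the head vector gives `c = 0`, and its action on `v` then gives `v = 0`. So the head maps to `S`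
with the head vector going to `v`, and a non-zero map of simple modules is bijective. -/
theorem nonempty_equiv_head {S : Type*} [AddCommGroup S] [Module F S] [Module B S]
    [IsScalarTower F B S] [IsSimpleModule B S] {l : Λ} {y : S} (hy : e l • y ≠ 0) :
    Nonempty (S ≃ₗ[B] Head B (D l)) := by
  have := h.isSimpleModule_head l
  set v := e l • y with hv
  have ev : e l • v = v := by rw [hv, smul_smul, h.idem]
  let f := LinearMap.toSpanSingleton B (Head B (D l)) (headVec B u l)
  let g := LinearMap.toSpanSingleton B S v
  have hf : Function.Surjective f := fun z => h.head_generates l z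
  have hfg : LinearMap.ker f ≤ LinearMap.ker g := by
    intro b hb
    by_contra hb'
    have hb1 : b • headVec B u l = 0 := LinearMap.mem_ker.1 hb
    have hb2 : b • v ≠ 0 := fun h0 => hb' (LinearMap.mem_ker.2 h0)
    obtain ⟨a, ha⟩ := (isSimpleModule_iff_toSpanSingleton_surjective.1 ‹IsSimpleModule B S›).2 _
      hb2 v
    rw [LinearMap.toSpanSingleton_apply] at ha
    obtain ⟨c, hc⟩ := h.residue l (a * b)
    have h1 := smul_eq_zero_of_mem_jacobson hc v
    have h2 := smul_eq_zero_of_mem_jacobson hc (headVec B u l)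
    rw [sub_smul, mul_smul, mul_smul, mul_smul, ev, ha, ev, smul_assoc, ev, sub_eq_zero] at h1
    rw [sub_smul, mul_smul, mul_smul, mul_smul, h.weight_headVec, hb1, smul_assoc,
      h.weight_headVec, smul_zero, smul_zero, zero_sub, neg_eq_zero] at h2
    rcases smul_eq_zero.1 h2 with rfl | h3
    · rw [zero_smul] at h1; exact hy h1
    · exact h.headVec_ne_zero l h3
  let φ : Head B (D l) →ₗ[B] S :=
    (LinearMap.ker f).liftQ g hfg ∘ₗ (f.quotKerEquivOfSurjective hf).symm.toLinearMap
  have hφ : φ (headVec B u l) = v := by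
    have h1 : (f.quotKerEquivOfSurjective hf).symm (headVec B u l) =
        Submodule.Quotient.mk (1 : B) := by
      rw [LinearEquiv.symm_apply_eq]
      change _ = f 1
      simp [f]
    change (LinearMap.ker f).liftQ g hfg ((f.quotKerEquivOfSurjective hf).symm (headVec B u l)) = v
    rw [h1]
    change g 1 = v
    simp [g]
  rcases LinearMap.bijective_or_eq_zero φ with hb | h0
  · exact ⟨(LinearEquiv.ofBijective φ hb).symm⟩
  · rw [h0] at hφ
    exact absurd hφ.symm hy

theorem exists_equiv_head (S : Type*) [AddCommGroup S] [Module F S] [Module B S]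
    [IsScalarTower F B S] [IsSimpleModule B S] : ∃ l, Nonempty (S ≃ₗ[B] Head B (D l)) := by
  have := IsSimpleModule.nontrivial B S
  by_contra! h0
  obtain ⟨y, hy⟩ := exists_ne (0 : S)
  refine hy ((Submodule.mem_bot B).1 (h.mem_of_forall_smul_mem ⊥ (fun l z => ?_) y))
  rw [Submodule.mem_bot]
  by_contra hz
  exact (h0 l).false (h.nonempty_equiv_head hz).some

theorem le_of_smul_head_ne_zero {l m : Λ} {y : Head B (D l)} (hy : e m • y ≠ 0) : m ≤ l := by
  obtain ⟨z, rfl⟩ := Submodule.mkQ_surjective _ y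
  refine h.le_of_ne_zero l m z fun h0 => hy ?_
  rw [← map_smul, h0, map_zero]

theorem le_of_equiv {l m : Λ} (f : Head B (D l) ≃ₗ[B] Head B (D m)) : l ≤ m := by
  refine h.le_of_smul_head_ne_zero (y := f (headVec B u l)) ?_
  rw [← map_smul, h.weight_headVec]
  exact fun h0 => h.headVec_ne_zero l (f.map_eq_zero_iff.1 h0)

/-- An isomorphism makes each weight occur in the other head, so the indices bound each other. -/
theorem eq_of_equiv {l m : Λ} (f : Nonempty (Head B (D l) ≃ₗ[B] Head B (D m))) : l = m :=
  le_antisymm (h.le_of_equiv f.some) (h.le_of_equiv f.some.symm)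

theorem eq_of_smul_head_ne_zero {l m : Λ} {y : Head B (D l)} (hy : e m • y ≠ 0) : l = m :=
  have := h.isSimpleModule_head l
  h.eq_of_equiv (h.nonempty_equiv_head hy)

theorem compMult_head {M : Type*} [AddCommGroup M] [Module F M] [Module B M]
    [IsScalarTower F B M] [FiniteDimensional F M] (l : Λ) :
    compMult B M (Head B (D l)) = Module.finrank F (weightSpace F (e l) M) := by
  refine compMult_eq_finrank F (h.idem l) _ ?_ ?_
  · rintro S _ _ _ _ _ ⟨f⟩
    have hz : f.symm (headVec B u l) ∈ weightSpace F (e l) S := by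
      rw [mem_weightSpace, ← map_smul, h.weight_headVec]
    refine finrank_eq_one (⟨f.symm (headVec B u l), hz⟩ : weightSpace F (e l) S) ?_ ?_
    · intro h0
      exact h.headVec_ne_zero l (f.symm.map_eq_zero_iff.1 (congrArg Subtype.val h0))
    · rintro ⟨y, hy⟩
      obtain ⟨c, hc⟩ := h.head_line l (f y)
      refine ⟨c, Subtype.ext (f.injective ?_)⟩
      rw [mem_weightSpace] at hy
      rw [← map_smul, hy] at hc
      change f (c • f.symm (headVec B u l)) = f y
      rw [hc, ← algebraMap_smul B c, map_smul, f.apply_symm_apply, algebraMap_smul]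
  · intro S _ _ _ _ _ hS
    rw [show weightSpace F (e l) S = ⊥ from ?_, finrank_bot]
    rw [Submodule.eq_bot_iff]
    intro y hy
    by_contra h0
    rw [mem_weightSpace] at hy
    exact hS (h.nonempty_equiv_head (hy.symm ▸ h0))

theorem standardAxioms : StandardAxioms F B D where
  finite_index := h.finite_index
  finiteDimensional := h.finiteDimensional
  simple_head := h.isSimpleModule_head
  head_injective _ _ := h.eq_of_equiv
  head_complete S _ _ _ := by
    let _ : Module F S := Module.compHom S (algebraMap F B)
    have : IsScalarTower F B S := ⟨fun c b y => by
      change (c • b) • y = algebraMap F B c • b • y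
      rw [Algebra.smul_def, mul_smul]⟩
    exact h.exists_equiv_head S
  end_standard l := exists_unique_scalar (h.ne_zero l) (h.weight l) (h.line l) (h.generates l)
  end_head l := exists_unique_scalar (h.headVec_ne_zero l) (h.weight_headVec l) (h.head_line l)
    (h.head_generates l)
  lt_of_compMult l m hlm := by
    have := h.finiteDimensional l
    have : FiniteDimensional F (Module.jacobson B (D l)) :=
      inferInstanceAs (FiniteDimensional F ((Module.jacobson B (D l)).restrictScalars F))
    rw [h.compMult_head] at hlm
    have hne : weightSpace F (e m) (Module.jacobson B (D l)) ≠ ⊥ := fun h0 => hlm (by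
      rw [h0, finrank_bot])
    obtain ⟨⟨y, hy⟩, hy1, hy2⟩ := Submodule.exists_mem_ne_zero_of_ne_bot hne
    rw [mem_weightSpace] at hy1
    have hy3 : e m • y = y := congrArg Subtype.val hy1
    have hy0 : y ≠ 0 := fun h0 => hy2 (Subtype.ext h0)
    refine lt_of_le_of_ne (h.le_of_ne_zero l m y (hy3.symm ▸ hy0)) ?_
    -- Weight `l` does not occur in the radical of `D l`.
    rintro rfl
    have h1 := (h.mem_jacobson_iff m y).1 hy 1
    rw [one_smul, hy3] at h1
    exact hy0 h1

end WeightData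

end WeightData

end BGG

namespace BGG

/-! ### Tight modules and resolutions -/

section SingularWeights

variable {F : Type u} [Field F] {B : Type v} [Ring B] [Algebra F B]
variable {Λ : Type w} [PartialOrder Λ] {D : Λ → Type x} [∀ l, AddCommGroup (D l)]
  [∀ l, Module F (D l)] [∀ l, Module B (D l)] [∀ l, IsScalarTower F B (D l)]
  {e : Λ → B} {u : ∀ l, D l}

variable (e u) in
/-- Every weight vector of `M` is the image of the highest weight vector of a standard module. -/
def WeightsSingular (M : Type*) [AddCommGroup M] [Module B M] : Prop :=
  ∀ (l : Λ) (y : M), e l • y = y → ∃ f : D l →ₗ[B] M, f (u l) = y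

theorem WeightsSingular.of_surjective {M N : Type*} [AddCommGroup M] [Module B M] [AddCommGroup N]
    [Module B N] (hM : WeightsSingular e u M) (g : M →ₗ[B] N) (hg : Function.Surjective g)
    (hidem : ∀ l, e l * e l = e l) : WeightsSingular e u N := by
  intro l y hy
  obtain ⟨z, rfl⟩ := hg y
  obtain ⟨f, hf⟩ := hM l (e l • z) (by rw [smul_smul, hidem])
  exact ⟨g ∘ₗ f, by rw [LinearMap.comp_apply, hf, map_smul, hy]⟩

theorem WeightsSingular.pi {ι : Type*} {M : ι → Type*} [∀ i, AddCommGroup (M i)]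
    [∀ i, Module B (M i)] (hM : ∀ i, WeightsSingular e u (M i)) :
    WeightsSingular e u (∀ i, M i) := by
  intro l y hy
  choose f hf using fun i => hM i l (y i) (congrFun hy i)
  exact ⟨LinearMap.pi f, funext hf⟩

namespace WeightData

variable (h : WeightData F B D e u)

include h

/-- A homomorphism from `D l` to `N` that sends `u l` into the submodule has its whole range there,
because `u l` generates `D l`. -/
theorem singular_of_injective {M N : Type*} [AddCommGroup M] [Module B M] [AddCommGroup N]
    [Module B N] (hN : WeightsSingular e u N) (g : M →ₗ[B] N) (hg : Function.Injective g) :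
    WeightsSingular e u M := by
  intro l y hy
  obtain ⟨f, hf⟩ := hN l (g y) (by rw [← map_smul, hy])
  have hr : ∀ z, f z ∈ LinearMap.range g := fun z => by
    obtain ⟨b, rfl⟩ := h.generates l z
    exact ⟨b • y, by rw [map_smul, map_smul, hf]⟩
  refine ⟨(LinearEquiv.ofInjective g hg).symm.toLinearMap ∘ₗ f.codRestrict _ hr, ?_⟩
  change (LinearEquiv.ofInjective g hg).symm _ = y
  rw [LinearEquiv.symm_apply_eq]
  exact Subtype.ext hf

variable {M : Type*} [AddCommGroup M] [Module F M] [Module B M] [IsScalarTower F B M]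

/-- Evaluation of homomorphisms at the highest weight vector. -/
theorem hom_ext {l : Λ} {f g : D l →ₗ[B] M} (hfg : f (u l) = g (u l)) : f = g := by
  ext y
  obtain ⟨b, rfl⟩ := h.generates l y
  rw [map_smul, map_smul, hfg]

/-- Evaluation at `u l` embeds the homomorphisms from `D l` to `M` in the weight space, whose
dimension is the multiplicity. Equality of dimensions is surjectivity of this embedding. -/
theorem hasTightMult_iff [FiniteDimensional F M] :
    HasTightMult F B D M ↔ WeightsSingular e u M := by
  let ev : ∀ l, (D l →ₗ[B] M) →ₗ[F] weightSpace F (e l) M := fun l =>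
    { toFun := fun f => ⟨f (u l), by rw [mem_weightSpace, ← map_smul, h.weight]⟩
      map_add' := fun f g => rfl
      map_smul' := fun c f => rfl }
  have inj : ∀ l, Function.Injective (ev l) := fun l f g hfg =>
    h.hom_ext (congrArg Subtype.val hfg)
  have : ∀ l, FiniteDimensional F (D l →ₗ[B] M) := fun l => Module.Finite.of_injective _ (inj l)
  refine forall_congr' fun l => ?_
  rw [h.compMult_head]
  constructor
  · intro heq y hy
    obtain ⟨f, hf⟩ := (LinearMap.injective_iff_surjective_of_finrank_eq_finrank heq).1 (inj l)
      ⟨y, hy⟩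
    exact ⟨f, congrArg Subtype.val hf⟩
  · intro hs
    refine (LinearEquiv.ofBijective (ev l) ⟨inj l, ?_⟩).finrank_eq
    rintro ⟨y, hy⟩
    obtain ⟨f, hf⟩ := hs y hy
    exact ⟨f, Subtype.ext hf⟩

theorem generatedBySingular (hM : WeightsSingular e u M) : GeneratedBySingular B D M := by
  refine eq_top_iff.2 fun y _ => h.mem_of_forall_smul_mem _ (fun l z => ?_) y
  obtain ⟨f, hf⟩ := hM l (e l • z) (by rw [smul_smul, h.idem])
  exact (le_iSup₂_of_le l f le_rfl : LinearMap.range f ≤ _) ⟨u l, hf⟩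

/-- One summand `D l` is taken for each element of a basis of each weight space `e l M`; the weight
spaces generate `M`. -/
theorem exists_surjective [FiniteDimensional F M] (hM : WeightsSingular e u M) :
    ∃ (k : ℕ) (idx : Fin k → Λ) (f : (∀ j, D (idx j)) →ₗ[B] M), Function.Surjective f := by
  classical
  have := h.finite_index
  have := Fintype.ofFinite Λ
  let ι := Σ l : Λ, Fin (Module.finrank F (weightSpace F (e l) M))
  let b := fun l : Λ => Module.finBasis F (weightSpace F (e l) M)
  choose f hf using fun i : ι => hM i.1 (b i.1 i.2) (b i.1 i.2).2
  let ε := Fintype.equivFin ι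
  refine ⟨Fintype.card ι, fun j => (ε.symm j).1,
    ∑ j, f (ε.symm j) ∘ₗ LinearMap.proj j, fun y => ?_⟩
  rw [← LinearMap.mem_range]
  set φ := ∑ j, f (ε.symm j) ∘ₗ LinearMap.proj (R := B) (φ := fun j => D (ε.symm j).1) j
  refine h.mem_of_forall_smul_mem _ (fun l z => ?_) y
  have hb : ∀ i : ι, ((b i.1 i.2 : weightSpace F (e i.1) M) : M) ∈ LinearMap.range φ := fun i => by
    obtain ⟨j, rfl⟩ := ε.symm.surjective i
    refine ⟨Pi.single j (u _), ?_⟩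
    rw [← hf]
    simp only [φ, LinearMap.sum_apply, LinearMap.comp_apply, LinearMap.proj_apply]
    rw [Finset.sum_eq_single j, Pi.single_eq_same]
    · intro k _ hk
      rw [Pi.single_eq_of_ne hk, map_zero]
    · simp
  have hspan : ∀ z : weightSpace F (e l) M, (z : M) ∈ LinearMap.range φ := fun z => by
    rw [← (b l).sum_repr z]
    rw [Submodule.coe_sum]
    exact Submodule.sum_mem _ fun i _ =>
      ((LinearMap.range φ).restrictScalars F).smul_mem _ (hb ⟨l, i⟩)
  exact hspan ⟨e l • z, smul_mem_weightSpace F (h.idem l) z⟩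

/-- Each kernel is a submodule of a finite sum of standard modules, so its weight vectors are again
singular and it can be covered by standard modules in turn. -/
theorem hasBGGResolution [FiniteDimensional F M]
    (hD : ∀ l, WeightsSingular e u (D l)) (hM : WeightsSingular e u M) :
    HasBGGResolution B D M := by
  have hfin := h.finiteDimensional
  obtain ⟨k₀, idx₀, ε, hε⟩ := h.exists_surjective hM
  have step : ∀ (P : Σ k : ℕ, Σ idx : Fin k → Λ, Submodule B (∀ j, D (idx j))),
      ∃ (k : ℕ) (idx : Fin k → Λ) (d : (∀ j, D (idx j)) →ₗ[B] (∀ j, D (P.2.1 j))),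
        LinearMap.range d = P.2.2 := by
    rintro ⟨k, idx, K⟩
    have hK : WeightsSingular e u K :=
      h.singular_of_injective (WeightsSingular.pi fun j => hD (idx j)) K.subtype
        K.injective_subtype
    have : FiniteDimensional F K := inferInstanceAs (FiniteDimensional F (K.restrictScalars F))
    obtain ⟨k', idx', f, hf⟩ := h.exists_surjective hK
    refine ⟨k', idx', K.subtype ∘ₗ f, ?_⟩
    rw [LinearMap.range_comp, LinearMap.range_eq_top.2 hf, Submodule.map_top,
      Submodule.range_subtype]
  choose k idx d hd using step
  -- The state of the recursion is a finite sum of standard modules together with the submodule to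
  -- be covered next.
  let P : ℕ → Σ k : ℕ, Σ idx : Fin k → Λ, Submodule B (∀ j, D (idx j)) := fun m =>
    Nat.rec ⟨k₀, idx₀, LinearMap.ker ε⟩ (fun _ Q => ⟨k Q, idx Q, LinearMap.ker (d Q)⟩) m
  refine ⟨fun m => (P m).1, fun m => (P m).2.1, fun m => d (P m), ε, hε, ?_, fun m => ?_⟩
  · rw [LinearMap.exact_iff, hd]; rfl
  · rw [LinearMap.exact_iff, hd]

theorem simplesHaveBGG (hD : ∀ l, WeightsSingular e u (D l)) : SimplesHaveBGG B D := by
  intro S _ _ _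
  let _ : Module F S := Module.compHom S (algebraMap F B)
  have : IsScalarTower F B S := ⟨fun c b y => by
    change (c • b) • y = algebraMap F B c • b • y
    rw [Algebra.smul_def, mul_smul]⟩
  obtain ⟨l, ⟨f⟩⟩ := h.exists_equiv_head S
  have := h.finiteDimensional l
  let g : D l →ₗ[B] S := f.symm.toLinearMap ∘ₗ (Module.jacobson B (D l)).mkQ
  have hg : Function.Surjective g := f.symm.surjective.comp (Submodule.mkQ_surjective _)
  have : FiniteDimensional F S := Module.Finite.of_surjective (g.restrictScalars F) hg
  exact h.hasBGGResolution hD ((hD l).of_surjective g hg h.idem)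

theorem radicalsGenerated (hD : ∀ l, WeightsSingular e u (D l)) : RadicalsGenerated B D :=
  fun l => h.generatedBySingular (h.singular_of_injective (hD l) _ (Submodule.subtype_injective _))

theorem tightMultiplicities (hD : ∀ l, WeightsSingular e u (D l)) :
    TightMultiplicities F B D := fun l =>
  have := h.finiteDimensional l
  h.hasTightMult_iff.2 (hD l)

theorem weightsSingular_of_tight (ht : TightMultiplicities F B D) (l : Λ) :
    WeightsSingular e u (D l) :=
  have := h.finiteDimensional l
  h.hasTightMult_iff.1 (ht l)

/-- Well-founded induction on `l`. A weight vector of weight `l` is a multiple of `u l`. One of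
another weight `m` lies in the radical, so it is a sum of vectors `e m • f t` with `f : D k → Rad (D
l)`. Here `k < l` whenever `f ≠ 0`, so by induction `e m • t` is the image of `u m` in `D k`, and
one composes with `f`. -/
theorem weightsSingular_of_radicalsGenerated (hr : RadicalsGenerated B D) (l : Λ) :
    WeightsSingular e u (D l) := by
  have := h.finite_index
  have wf : WellFounded ((· < ·) : Λ → Λ → Prop) := Finite.wellFounded_of_trans_of_irrefl _
  induction l using wf.induction with
  | h l ih =>
  intro m y hy
  by_cases hml : m = l
  · subst hml
    obtain ⟨c, hc⟩ := h.line m y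
    exact ⟨c • LinearMap.id, by rw [LinearMap.smul_apply, LinearMap.id_apply, ← hc, hy]⟩
  have hyR : y ∈ Module.jacobson B (D l) := by
    rw [← Submodule.Quotient.mk_eq_zero]
    by_contra h0
    refine hml (h.eq_of_smul_head_ne_zero (l := l) (m := m) (y := Submodule.Quotient.mk y) ?_).symm
    rwa [← Submodule.Quotient.mk_smul, hy]
  have key : ∀ z ∈ (⨆ (l' : Λ) (f : D l' →ₗ[B] Module.jacobson B (D l)), LinearMap.range f),
      ∃ g : D m →ₗ[B] D l, g (u m) = e m • (z : D l) := by
    intro z hz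
    induction hz using Submodule.iSup_induction' with
    | zero => exact ⟨0, by simp⟩
    | add z z' _ _ hz hz' =>
      obtain ⟨g, hg⟩ := hz
      obtain ⟨g', hg'⟩ := hz'
      exact ⟨g + g', by rw [LinearMap.add_apply, hg, hg', Submodule.coe_add, smul_add]⟩
    | mem k z hz =>
      induction hz using Submodule.iSup_induction' with
      | zero => exact ⟨0, by simp⟩
      | add z z' _ _ hz hz' =>
        obtain ⟨g, hg⟩ := hz
        obtain ⟨g', hg'⟩ := hz'
        exact ⟨g + g', by rw [LinearMap.add_apply, hg, hg', Submodule.coe_add, smul_add]⟩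
      | mem f z hz =>
        by_cases hf : f = 0
        · subst hf
          obtain ⟨t, rfl⟩ := hz
          exact ⟨0, by simp⟩
        -- The image `f (u k)` is a non-zero vector of weight `k` in the radical of `D l`.
        have hk : k < l := by
          have hu : (f (u k) : D l) ≠ 0 := fun h0 => hf (h.hom_ext (by
            rw [LinearMap.zero_apply]; exact Subtype.ext h0))
          have hw : e k • (f (u k) : D l) = f (u k) := by
            rw [← Submodule.coe_smul, ← map_smul, h.weight]
          refine lt_of_le_of_ne (h.le_of_ne_zero l k _ (hw.symm ▸ hu)) ?_
          rintro rfl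
          have h1 := (h.mem_jacobson_iff k (f (u k))).1 (f (u k)).2 1
          rw [one_smul, hw] at h1
          exact hu h1
        obtain ⟨t, rfl⟩ := hz
        obtain ⟨g, hg⟩ := ih k hk m (e m • t) (by rw [smul_smul, h.idem])
        refine ⟨(Module.jacobson B (D l)).subtype ∘ₗ f ∘ₗ g, ?_⟩
        simp [hg]
  obtain ⟨g, hg⟩ := key ⟨y, hyR⟩ (by
    rw [show (⨆ (l' : Λ) (f : D l' →ₗ[B] Module.jacobson B (D l)), LinearMap.range f) = ⊤ from hr l]
    exact Submodule.mem_top)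
  exact ⟨g, hg.trans hy⟩

omit h in
theorem GeneratedBySingular.of_surjective {M N : Type*} [AddCommGroup M] [Module B M]
    [AddCommGroup N] [Module B N] (hM : GeneratedBySingular B D M) (g : M →ₗ[B] N)
    (hg : Function.Surjective g) : GeneratedBySingular B D N := by
  rw [GeneratedBySingular, eq_top_iff, ← LinearMap.range_eq_top.2 hg, ← Submodule.map_top, ← hM,
    Submodule.map_iSup]
  refine iSup_le fun l => ?_
  rw [Submodule.map_iSup]
  refine iSup_le fun f => ?_
  rw [← LinearMap.range_comp]
  exact le_iSup₂_of_le l (g ∘ₗ f) le_rfl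

omit h in
theorem generatedBySingular_pi {k : ℕ} (idx : Fin k → Λ) :
    GeneratedBySingular B D (∀ j, D (idx j)) := by
  classical
  refine eq_top_iff.2 fun y _ => ?_
  rw [← Finset.univ_sum_single y]
  refine Submodule.sum_mem _ fun j _ => ?_
  exact (le_iSup₂_of_le (idx j) (LinearMap.single B (fun j => D (idx j)) j) le_rfl :
    LinearMap.range _ ≤ _) ⟨y j, rfl⟩

/-- In a resolution of the head of `D l`, a summand `D k` maps to the head by zero unless `k = l`,
and then by a multiple of the canonical projection. So the augmentation lifts to a map `φ` into `D
l`. It is onto, because its range is not inside the radical; hence it carries the kernel of the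
augmentation, covered by the next term of the resolution, onto the radical. -/
theorem radicalsGenerated_of_simplesHaveBGG (hb : SimplesHaveBGG B D) : RadicalsGenerated B D := by
  classical
  intro l
  have := h.isSimpleModule_head l
  -- `SimplesHaveBGG` concerns simple modules in the universe of `B`, so the head is replaced by an
  -- isomorphic quotient of `B`.
  obtain ⟨m, hm, ⟨i⟩⟩ := isSimpleModule_iff_quot_maximal.1 this
  have : IsSimpleModule B (B ⧸ m) := IsSimpleModule.congr i.symm
  obtain ⟨k, idx, d, ε, hε, h0, -⟩ := hb (B ⧸ m)
  let ε' : (∀ j, D (idx 0 j)) →ₗ[B] Head B (D l) := i.symm.toLinearMap ∘ₗ ε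
  have hε' : Function.Surjective ε' := i.symm.surjective.comp hε
  have hker : LinearMap.ker ε' = LinearMap.range (d 0) := by
    rw [LinearEquiv.ker_comp, ← LinearMap.exact_iff.1 h0]
  have comp : ∀ j, ∃ f : D (idx 0 j) →ₗ[B] D l,
      ∀ y, Submodule.Quotient.mk (f y) = ε' (Pi.single j y) := by
    intro j
    let s : D (idx 0 j) →ₗ[B] Head B (D l) :=
      ε' ∘ₗ LinearMap.single B (fun j => D (idx 0 j)) j
    suffices hs : ∃ f : D (idx 0 j) →ₗ[B] D l, (Module.jacobson B (D l)).mkQ ∘ₗ f = s by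
      obtain ⟨f, hf⟩ := hs
      exact ⟨f, fun y => LinearMap.congr_fun hf y⟩
    by_cases hj : s (u (idx 0 j)) = 0
    · exact ⟨0, h.hom_ext (by rw [hj]; simp)⟩
    have hjl : l = idx 0 j := h.eq_of_smul_head_ne_zero (l := l) (m := idx 0 j)
      (y := s (u (idx 0 j))) (by rwa [← map_smul, h.weight])
    -- With the value of `s` forgotten, the index `idx 0 j` in its type can be replaced by `l`.
    clear_value s
    revert s
    rw [← hjl]
    intro s _
    obtain ⟨c, hc⟩ := h.head_line l (s (u l))
    rw [← map_smul, h.weight] at hc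
    exact ⟨c • LinearMap.id, h.hom_ext (by rw [hc]; rfl)⟩
  choose f hf using comp
  let φ : (∀ j, D (idx 0 j)) →ₗ[B] D l := ∑ j, f j ∘ₗ LinearMap.proj j
  have hφ : ∀ y, Submodule.Quotient.mk (φ y) = ε' y := by
    intro y
    conv_rhs => rw [← Finset.univ_sum_single y, map_sum]
    simp only [← hf, φ, LinearMap.sum_apply, LinearMap.comp_apply, LinearMap.proj_apply]
    exact map_sum (Module.jacobson B (D l)).mkQ _ _
  have hsurj : Function.Surjective φ := by
    rw [← LinearMap.range_eq_top]
    by_contra hne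
    have hle : LinearMap.range φ ≤ Module.jacobson B (D l) := by
      intro y hy
      rw [h.mem_jacobson_iff]
      intro b
      by_contra h1
      exact hne (h.eq_top_of_smul_ne_zero _ (Submodule.smul_mem _ b hy) h1)
    obtain ⟨y, hy⟩ := hε' (headVec B u l)
    refine h.headVec_ne_zero l ?_
    rw [← hy, ← hφ, Submodule.Quotient.mk_eq_zero]
    exact hle ⟨y, rfl⟩
  have hmem : ∀ y, φ (d 0 y) ∈ Module.jacobson B (D l) := fun y => by
    rw [← Submodule.Quotient.mk_eq_zero, hφ, ← LinearMap.mem_ker, hker]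
    exact ⟨y, rfl⟩
  refine GeneratedBySingular.of_surjective (generatedBySingular_pi (idx 1))
    ((φ ∘ₗ d 0).codRestrict _ hmem) fun z => ?_
  obtain ⟨y, hy⟩ := hsurj z
  have hy' : y ∈ LinearMap.range (d 0) := by
    rw [← hker, LinearMap.mem_ker, ← hφ, hy, Submodule.Quotient.mk_eq_zero]
    exact z.2
  obtain ⟨t, rfl⟩ := hy'
  exact ⟨t, Subtype.ext hy⟩

theorem weightsSingular (hc : TightMultiplicities F B D ∨ SimplesHaveBGG B D ∨
    RadicalsGenerated B D) (l : Λ) : WeightsSingular e u (D l) := by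
  rcases hc with hc | hc | hc
  · exact h.weightsSingular_of_tight hc l
  · exact h.weightsSingular_of_radicalsGenerated (h.radicalsGenerated_of_simplesHaveBGG hc) l
  · exact h.weightsSingular_of_radicalsGenerated hc l

end WeightData

end SingularWeights

end BGG

namespace BGG

/-! ### Idempotents from the axioms -/

theorem mem_jacobson_of_forall_simple {B : Type v} [Ring B] {b : B}
    (hb : ∀ (S : Type v) [AddCommGroup S] [Module B S] [IsSimpleModule B S] (y : S), b • y = 0) :
    b ∈ Ring.jacobson B := by
  rw [Ring.jacobson_eq_sInf_isMaximal, Submodule.mem_sInf]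
  intro m hm
  have : IsSimpleModule B (B ⧸ m) := isSimpleModule_iff_isCoatom.2 hm.1
  have h1 := hb (B ⧸ m) (Submodule.Quotient.mk 1)
  rwa [← Submodule.Quotient.mk_smul, Submodule.Quotient.mk_eq_zero, smul_eq_mul, mul_one] at h1

section Axioms

variable {F : Type u} [Field F] {A : Type v} [Ring A] [Algebra F A]
variable {Λ : Type w} [PartialOrder Λ] {Δ : Λ → Type x} [∀ l, AddCommGroup (Δ l)]
  [∀ l, Module F (Δ l)] [∀ l, Module A (Δ l)] [∀ l, IsScalarTower F A (Δ l)]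

namespace StandardAxioms

variable (h : StandardAxioms F A Δ)

include h

/-- `head_complete` covers one universe only; a simple module in any universe is first identified
with a quotient of `A`. -/
theorem smul_eq_zero_of_simple {a : A} (ha : ∀ l (y : Head A (Δ l)), a • y = 0)
    (S : Type*) [AddCommGroup S] [Module A S] [IsSimpleModule A S] (y : S) : a • y = 0 := by
  obtain ⟨m, hm, ⟨i⟩⟩ := isSimpleModule_iff_quot_maximal.1 ‹IsSimpleModule A S›
  have : IsSimpleModule A (A ⧸ m) := IsSimpleModule.congr i.symm
  obtain ⟨l, ⟨f⟩⟩ := h.head_complete (A ⧸ m)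
  have h1 := ha l (f (i y))
  rw [← map_smul, ← map_smul] at h1
  exact i.map_eq_zero_iff.1 (f.map_eq_zero_iff.1 h1)

theorem mem_jacobson {a : A} (ha : ∀ l (y : Head A (Δ l)), a • y = 0) : a ∈ Ring.jacobson A :=
  mem_jacobson_of_forall_simple fun S _ _ _ => h.smul_eq_zero_of_simple ha S

/-- By Schur's lemma there are no non-zero maps between different heads, and the endomorphisms of
each head are scalars. So the commutant of the sum of the heads is diagonal, as needed for the
density theorem. -/
theorem exists_scalars (ψ : (∀ l, Head A (Δ l)) →ₗ[A] (∀ l, Head A (Δ l))) :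
    ∃ c : Λ → F, ∀ y l, ψ y l = c l • y l := by
  classical
  have := h.finite_index
  have := Fintype.ofFinite Λ
  have hs := h.simple_head
  let p : ∀ l, (∀ l, Head A (Δ l)) →ₗ[A] Head A (Δ l) := fun l => LinearMap.proj l
  choose c hc using fun l =>
    (h.end_head l (p l ∘ₗ ψ ∘ₗ LinearMap.single A (fun l => Head A (Δ l)) l)).exists
  refine ⟨c, fun y l => ?_⟩
  have h0 : ∀ k (z : Head A (Δ k)), k ≠ l → ψ (Pi.single k z) l = 0 := by
    intro k z hk
    rcases LinearMap.bijective_or_eq_zero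
      (p l ∘ₗ ψ ∘ₗ LinearMap.single A (fun l => Head A (Δ l)) k) with hb | hz
    · exact absurd (h.head_injective k l ⟨LinearEquiv.ofBijective _ hb⟩) hk
    · exact LinearMap.congr_fun hz z
  conv_lhs => rw [← Finset.univ_sum_single y, map_sum, Finset.sum_apply]
  rw [Finset.sum_eq_single l (fun k _ hk => h0 k _ hk) (by simp)]
  exact hc l (y l)

/-- By density some element of `A` acts on the sum of all heads as a projection onto a line of `L
l`. The kernel of this action lies in the radical, which is nilpotent, so the element can be
replaced by an idempotent with the same action. -/
theorem exists_rank_one [FiniteDimensional F A] (l : Λ) :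
    ∃ (p : A) (v : Head A (Δ l)) (φ : Head A (Δ l) →ₗ[F] F), p * p = p ∧ φ v = 1 ∧
      (∀ y : Head A (Δ l), p • y = φ y • v) ∧ ∀ k, k ≠ l → ∀ y : Head A (Δ k), p • y = 0 := by
  classical
  have := h.finite_index
  have := Fintype.ofFinite Λ
  have hs := h.simple_head
  have hfin := h.finiteDimensional
  have := IsSimpleModule.nontrivial A (Head A (Δ l))
  obtain ⟨v, hv⟩ := exists_ne (0 : Head A (Δ l))
  obtain ⟨φ, hφ⟩ := Module.Projective.exists_dual_eq_one F hv
  let M := ∀ l, Head A (Δ l)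
  let f : M →ₗ[F] M := LinearMap.single F (fun l => Head A (Δ l)) l ∘ₗ φ.smulRight v ∘ₗ
    LinearMap.proj l
  have hf : ∀ y, f y = Pi.single l (φ (y l) • v) := fun y => rfl
  -- The projection commutes with all `A`-endomorphisms of `M`, since these act by a scalar on each
  -- component.
  let g : Module.End (Module.End A M) M :=
    { toFun := f
      map_add' := f.map_add
      map_smul' := fun ψ y => by
        obtain ⟨c, hc⟩ := h.exists_scalars ψ
        change f (ψ y) = ψ (f y)
        refine funext fun k => ?_
        rw [hc, hf, hf, hc, map_smul, smul_assoc]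
        rcases eq_or_ne k l with rfl | hk
        · simp
        · simp [hk] }
  -- Agreement with `f` on a finite `F`-spanning set is agreement everywhere.
  obtain ⟨s, hs⟩ := (Module.Finite.fg_top : (⊤ : Submodule F M).FG)
  obtain ⟨a, ha⟩ := jacobson_density g s
  have haf : (Algebra.lsmul F F M : A →ₐ[F] Module.End F M) a = f := by
    refine LinearMap.ext_on hs fun y hy => ?_
    exact (ha y hy).symm
  have hff : f * f = f := by
    refine LinearMap.ext fun y => ?_
    rw [Module.End.mul_apply, hf, hf y, Pi.single_eq_same, map_smul, hφ, smul_eq_mul, mul_one]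
  have hart : IsArtinianRing A := isArtinian_of_tower F inferInstance
  obtain ⟨p, hp, hpf⟩ := exists_isIdempotentElem_eq_of_ker_isNilpotent
    (Algebra.lsmul F F M : A →ₐ[F] Module.End F M).toRingHom (by
      intro b hb
      have hb' : b ∈ Ring.jacobson A := h.mem_jacobson fun k y => by
        have h1 := congrFun (LinearMap.congr_fun ((RingHom.mem_ker).1 hb) (Pi.single k y : M)) k
        change b • (Pi.single k y : M) k = 0 at h1
        rwa [Pi.single_eq_same] at h1
      rw [← Ideal.jacobson_bot] at hb'
      obtain ⟨n, hn⟩ := IsArtinianRing.isNilpotent_jacobson_bot (R := A)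
      refine ⟨n, ?_⟩
      have h2 := Ideal.pow_mem_pow hb' n
      rw [hn] at h2
      exact h2) f ⟨a, haf⟩ hff
  have hpy : ∀ y : M, p • y = f y := fun y => LinearMap.congr_fun hpf y
  refine ⟨p, v, φ, hp, hφ, fun y => ?_, fun k hk y => ?_⟩
  · have h1 := congrFun (hpy (Pi.single l y)) l
    rw [hf, Pi.smul_apply, Pi.single_eq_same, Pi.single_eq_same] at h1
    exact h1
  · have h1 := congrFun (hpy (Pi.single k y)) k
    rw [hf, Pi.smul_apply, Pi.single_eq_same, Pi.single_eq_of_ne hk] at h1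
    exact h1

/-- The `e l` are the rank one idempotents, and `u l` is `e l` applied to a lift of the vector
spanning its image in the head. What holds in the heads lifts to the standard modules, because
weight `l` does not occur in `Rad (Δ l)`. -/
theorem exists_weightData [FiniteDimensional F A] :
    ∃ (e : Λ → A) (u : ∀ l, Δ l), WeightData F A Δ e u := by
  choose e v φ idem hφ hline hzero using h.exists_rank_one
  have hs := h.simple_head
  have hfin := h.finiteDimensional
  have hv0 : ∀ l, v l ≠ 0 := fun l h0 => by
    have h1 := hφ l
    rw [h0, map_zero] at h1
    exact zero_ne_one h1
  have hev : ∀ l, e l • v l = v l := fun l => by rw [hline, hφ, one_smul]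
  -- If `e m` is non-zero on the radical, then `L m` is one of its composition factors.
  have hrad : ∀ l m (y : Δ l), y ∈ Module.jacobson A (Δ l) → e m • y ≠ 0 → m < l := by
    intro l m y hy hne
    refine h.lt_of_compMult l m ?_
    have : FiniteDimensional F (Module.jacobson A (Δ l)) :=
      inferInstanceAs (FiniteDimensional F ((Module.jacobson A (Δ l)).restrictScalars F))
    rw [compMult_eq_finrank F (idem m)]
    · intro h0
      rw [Submodule.finrank_eq_zero] at h0
      have h1 : e m • (⟨y, hy⟩ : Module.jacobson A (Δ l)) ∈ weightSpace F (e m) _ :=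
        smul_mem_weightSpace F (idem m) _
      rw [h0, Submodule.mem_bot] at h1
      exact hne (congrArg Subtype.val h1)
    · rintro S _ _ _ _ _ ⟨f⟩
      have hz : f.symm (v m) ∈ weightSpace F (e m) S := by
        rw [mem_weightSpace, ← map_smul, hev]
      refine finrank_eq_one (⟨f.symm (v m), hz⟩ : weightSpace F (e m) S) ?_ ?_
      · intro h0
        exact hv0 m (f.symm.map_eq_zero_iff.1 (congrArg Subtype.val h0))
      · rintro ⟨y, hy⟩
        refine ⟨φ m (f y), Subtype.ext (f.injective ?_)⟩
        rw [mem_weightSpace] at hy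
        have hc := hline m (f y)
        rw [← map_smul, hy] at hc
        change f (φ m (f y) • f.symm (v m)) = f y
        rw [← algebraMap_smul A, map_smul, f.apply_symm_apply, algebraMap_smul, ← hc]
    · intro S _ _ _ _ _ hS
      rw [show weightSpace F (e m) S = ⊥ from ?_, finrank_bot]
      rw [Submodule.eq_bot_iff]
      intro y hy
      rw [mem_weightSpace] at hy
      obtain ⟨M, hM, ⟨i⟩⟩ := isSimpleModule_iff_quot_maximal.1 ‹IsSimpleModule A S›
      have : IsSimpleModule A (A ⧸ M) := IsSimpleModule.congr i.symm
      obtain ⟨k, ⟨f⟩⟩ := h.head_complete (A ⧸ M)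
      have hk : k ≠ m := by rintro rfl; exact hS ⟨i.trans f⟩
      have h1 := hzero m k hk (f (i y))
      rw [← map_smul, ← map_smul, hy] at h1
      exact i.map_eq_zero_iff.1 (f.map_eq_zero_iff.1 h1)
  choose u' hu' using fun l => Submodule.mkQ_surjective _ (v l)
  have hmk : ∀ l, (Submodule.Quotient.mk (e l • u' l) : Head A (Δ l)) = v l := fun l => by
    rw [Submodule.Quotient.mk_smul]
    exact (congrArg (e l • ·) (hu' l)).trans (hev l)
  refine ⟨e, fun l => e l • u' l, h.finite_index, hfin, idem, ?_, ?_, ?_, ?_, ?_, ?_, ?_⟩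
  · intro l; rw [smul_smul, idem]
  · intro l h0
    have h1 := hmk l
    rw [h0] at h1
    exact hv0 l h1.symm
  · intro l y
    refine ⟨φ l (Submodule.Quotient.mk y), ?_⟩
    -- This element is `e l • y - φ y • u l`, which vanishes in the head. It has weight `l`, so
    -- unless it is zero `hrad` gives `l < l`.
    have h1 : y - φ l (Submodule.Quotient.mk y) • e l • u' l - (y - e l • y)
        ∈ Module.jacobson A (Δ l) := by
      rw [← Submodule.Quotient.mk_eq_zero, Submodule.Quotient.mk_sub, Submodule.Quotient.mk_sub,
        Submodule.Quotient.mk_sub, Submodule.Quotient.mk_smul (r := e l) (x := y), hline,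
        show (Submodule.Quotient.mk (φ l (Submodule.Quotient.mk y) • e l • u' l) :
          Head A (Δ l)) = φ l (Submodule.Quotient.mk y) • v l by
            rw [← hmk l]; rfl]
      abel
    by_contra hne
    refine (hrad l l _ h1 ?_).false
    intro h2
    rw [smul_sub, smul_sub, smul_sub, smul_smul, idem, sub_self, sub_zero, smul_comm, smul_smul,
      idem, sub_eq_zero] at h2
    exact hne h2
  · intro l y
    have htop : Submodule.span A {e l • u' l} = ⊤ := by
      by_contra hne
      have : IsNoetherian A (Δ l) := isNoetherian_of_tower F inferInstance
      obtain ⟨N, hN, hle⟩ := (eq_top_or_exists_le_coatom (Submodule.span A {e l • u' l})).resolve_left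
        hne
      have h1 : Module.jacobson A (Δ l) ≤ N := sInf_le hN
      have hco : IsCoatom (Module.jacobson A (Δ l)) := isSimpleModule_iff_isCoatom.1 (hs l)
      have h2 : Module.jacobson A (Δ l) = N := by
        rcases hco.le_iff.1 h1 with h3 | h3
        · exact absurd h3 hN.1
        · exact h3.symm
      have h3 : e l • u' l ∈ Module.jacobson A (Δ l) := by
        rw [h2]; exact hle (Submodule.mem_span_singleton_self _)
      rw [← Submodule.Quotient.mk_eq_zero, hmk] at h3
      exact hv0 l h3
    exact Submodule.mem_span_singleton.1 (htop ▸ Submodule.mem_top : y ∈ _)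
  · intro l m y hne
    rcases eq_or_ne l m with rfl | hlm
    · exact le_rfl
    refine (hrad l m (e m • y) ?_ (by rwa [smul_smul, idem])).le
    rw [← Submodule.Quotient.mk_eq_zero, Submodule.Quotient.mk_smul, hzero m l hlm]
  -- A proper ideal of this kind would lie in a maximal left ideal `m`. The quotient `A ⧸ m` is some
  -- `L l`, with `v l` the class of some `a`. But `e l * a` lies in the ideal, so `e l` would kill
  -- `v l`.
  · let I : Submodule F A := Submodule.span F {z | ∃ l a b, z = a * e l * b}
    have hI : ∀ a, ∀ z ∈ I, a * z ∈ I := by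
      intro a z hz
      induction hz using Submodule.span_induction with
      | mem z hz =>
        obtain ⟨l, b, c, rfl⟩ := hz
        exact Submodule.subset_span ⟨l, a * b, c, by simp only [mul_assoc]⟩
      | zero => rw [mul_zero]; exact I.zero_mem
      | add y z _ _ hy hz => rw [mul_add]; exact I.add_mem hy hz
      | smul c z _ hz => rw [mul_smul_comm]; exact I.smul_mem c hz
    let J : Ideal A := { I.toAddSubmonoid with smul_mem' := fun a z hz => hI a z hz }
    by_contra hne
    have hJ : J ≠ ⊤ := fun h0 => hne ((Ideal.eq_top_iff_one J).1 h0)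
    obtain ⟨m, hm, hle⟩ := Ideal.exists_le_maximal J hJ
    have : IsSimpleModule A (A ⧸ m) := isSimpleModule_iff_isCoatom.2 hm.1
    obtain ⟨l, ⟨f⟩⟩ := h.head_complete (A ⧸ m)
    obtain ⟨a, ha⟩ := Submodule.mkQ_surjective _ (f.symm (v l))
    have h1 : e l * a ∈ m := hle (Submodule.subset_span ⟨l, 1, a, by rw [one_mul]⟩)
    have h2 : e l • f.symm (v l) = 0 := by
      rw [← ha, ← map_smul]
      exact (Submodule.Quotient.mk_eq_zero m).2 h1
    rw [← map_smul, hev] at h2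
    exact hv0 l (f.symm.map_eq_zero_iff.1 h2)
  · intro l b
    -- The scalar is a diagonal matrix coefficient of `b` on `L l`; the two sides act equally on
    -- every simple module.
    refine ⟨φ l (b • v l), h.mem_jacobson fun k y => ?_⟩
    rcases eq_or_ne k l with rfl | hk
    · rw [sub_smul, mul_smul, mul_smul, hline k y, smul_comm b, hline, map_smul,
        smul_assoc (φ k (b • v k)) (e k) y, hline, smul_assoc, smul_comm, sub_self]
    · rw [sub_smul, mul_smul, mul_smul, smul_assoc, hzero l k hk y]
      simp

end StandardAxioms

end Axioms

end BGG

namespace BGG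

/-! ### Normalized Young symmetrizers -/

section Idempotents

open Equiv MonoidAlgebra

variable {F : Type*} [Field F] {X : Type*} [Fintype X] [DecidableEq X]

variable (F) in
/-- The primitive idempotent proportional to a Young symmetrizer. -/
def youngIdem (r c : X → ℕ) : MonoidAlgebra F (Perm X) :=
  ((youngSym F r c * youngSym F r c).coeff 1)⁻¹ • youngSym F r c

variable (hX : ((Fintype.card X).factorial : F) ≠ 0) {μ : YoungDiagram} {r c : X → ℕ}
  (h : IsTableau μ r c)

include hX h

/-- The normalizing constant in `youngIdem` is the inverse of the scalar `t` with `c * c = t • c`,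
because `c` has coefficient `1` at the identity. -/
theorem exists_youngSym_eq_smul :
    ∃ t : F, t ≠ 0 ∧ youngSym F r c = t • youngIdem F r c ∧
      youngIdem F r c * youngSym F r c = youngSym F r c := by
  obtain ⟨t, ht0, ht⟩ := exists_youngSym_mul_self hX h
  have h1 : (youngSym F r c * youngSym F r c).coeff 1 = t := by
    rw [ht, coeff_smul, Finsupp.smul_apply, youngSym_coeff_one h, smul_eq_mul, mul_one]
  refine ⟨t, ht0, ?_, ?_⟩
  · rw [youngIdem, h1, smul_smul, mul_inv_cancel₀ ht0, one_smul]
  · rw [youngIdem, h1, smul_mul_assoc, ht, smul_smul, inv_mul_cancel₀ ht0, one_smul]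

theorem youngIdem_mul_self : youngIdem F r c * youngIdem F r c = youngIdem F r c := by
  obtain ⟨t, -, -, h1⟩ := exists_youngSym_eq_smul hX h
  nth_rw 2 [youngIdem]
  rw [mul_smul_comm, h1, youngIdem]

theorem youngIdem_mul_mul_youngSym (y : MonoidAlgebra F (Perm X)) :
    ∃ t : F, youngIdem F r c * y * youngSym F r c = t • youngSym F r c := by
  obtain ⟨t, ht⟩ := youngSym_mul_mul_youngSym hX h y
  exact ⟨_, by rw [youngIdem, smul_mul_assoc, smul_mul_assoc, ht, smul_smul]⟩

theorem youngIdem_mul_mul_youngIdem (y : MonoidAlgebra F (Perm X)) :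
    ∃ t : F, youngIdem F r c * y * youngIdem F r c = t • youngIdem F r c := by
  obtain ⟨t, ht⟩ := youngIdem_mul_mul_youngSym hX h y
  exact ⟨t, by
    rw [show youngIdem F r c * y * youngIdem F r c = ((youngSym F r c * youngSym F r c).coeff 1)⁻¹ •
      (youngIdem F r c * y * youngSym F r c) by rw [← mul_smul_comm]; rfl, ht, smul_comm]; rfl⟩

end Idempotents

/-! ### Group algebras of products -/

section PiAlg

open MonoidAlgebra

variable (F : Type*) [Field F] {I : Type*} [Fintype I] (G : I → Type*) [∀ i, Group (G i)]
  [∀ i, Fintype (G i)] [DecidableEq I]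

/-- The outer tensor product `⨂ i, F[G i] → F[∏ i, G i]` as a multilinear map. -/
def piAlg : MultilinearMap F (fun i => MonoidAlgebra F (G i)) (MonoidAlgebra F (∀ i, G i)) :=
  ∑ g : ∀ i, G i, ((MultilinearMap.mkPiAlgebra F I F).compLinearMap fun i =>
    Finsupp.lapply (g i) ∘ₗ (MonoidAlgebra.coeffLinearEquiv F).toLinearMap).smulRight (single g 1)

theorem piAlg_apply (a : ∀ i, MonoidAlgebra F (G i)) :
    piAlg F G a = ∑ g : ∀ i, G i, (∏ i, (a i).coeff (g i)) • single g 1 := by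
  simp only [piAlg, sum_apply]
  rfl

variable {F G}

theorem multilinear_ext_single {E : Type*} [AddCommMonoid E] [Module F E]
    {f g : MultilinearMap F (fun i => MonoidAlgebra F (G i)) E}
    (h : ∀ a : ∀ i, G i, f (fun i => single (a i) 1) = g (fun i => single (a i) 1)) : f = g := by
  let b : ∀ i, Module.Basis (G i) F (MonoidAlgebra F (G i)) := fun i =>
    Module.Basis.ofRepr (MonoidAlgebra.coeffLinearEquiv F)
  exact Module.Basis.ext_multilinear b fun a => h a

theorem piAlg_single (g : ∀ i, G i) :
    piAlg F G (fun i => single (g i) 1) = single g 1 := by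
  classical
  rw [piAlg_apply, Finset.sum_eq_single g]
  · simp
  · intro k _ hk
    obtain ⟨i, hi⟩ := Function.ne_iff.1 hk
    rw [Finset.prod_eq_zero (Finset.mem_univ i), zero_smul]
    rw [coeff_single, Finsupp.single_apply, if_neg (Ne.symm hi)]
  · simp

/-- By multilinearity, group elements suffice on the left; for these, group elements suffice on the
right. -/
theorem piAlg_mul (a b : ∀ i, MonoidAlgebra F (G i)) :
    piAlg F G (fun i => a i * b i) = piAlg F G a * piAlg F G b := by
  have h1 : ∀ g : ∀ i, G i, ∀ b : ∀ i, MonoidAlgebra F (G i),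
      piAlg F G (fun i => single (g i) 1 * b i) = single g 1 * piAlg F G b := by
    intro g
    have := multilinear_ext_single (F := F) (G := G)
      (f := (piAlg F G).compLinearMap fun i => LinearMap.mulLeft F (single (g i) (1 : F)))
      (g := (LinearMap.mulLeft F (single g (1 : F))).compMultilinearMap (piAlg F G)) (fun k => by
        simp only [MultilinearMap.compLinearMap_apply, LinearMap.mulLeft_apply, single_mul_single,
          LinearMap.compMultilinearMap_apply, mul_one]
        rw [piAlg_single, piAlg_single, single_mul_single, mul_one]
        rfl)
    exact fun b => congrArg (fun f => f b) this
  have h2 := multilinear_ext_single (F := F) (G := G)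
    (f := (piAlg F G).compLinearMap fun i => LinearMap.mulRight F (b i))
    (g := (LinearMap.mulRight F (piAlg F G b)).compMultilinearMap (piAlg F G)) (fun k => by
      simp only [MultilinearMap.compLinearMap_apply, LinearMap.mulRight_apply,
        LinearMap.compMultilinearMap_apply]
      rw [h1, piAlg_single])
  exact congrArg (fun f => f a) h2

theorem piAlg_one : piAlg F G (fun _ => 1) = 1 := piAlg_single 1

end PiAlg

section Finset

/-- If each entry is a sum of elements of given sets, then a multilinear map takes its values in the
span of the values on these sets. -/
theorem multilinear_mem_span {F : Type*} [Field F] {I : Type*} [Finite I] {V : I → Type*}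
    [∀ i, AddCommGroup (V i)] [∀ i, Module F (V i)] {E : Type*} [AddCommGroup E] [Module F E]
    (f : MultilinearMap F V E) (S : ∀ i, Set (V i)) (N : Submodule F E)
    (hN : ∀ a : ∀ i, V i, (∀ i, a i ∈ S i) → f a ∈ N) (a : ∀ i, V i)
    (ha : ∀ i, a i ∈ Submodule.span F (S i)) : f a ∈ N := by
  classical
  have := Fintype.ofFinite I
  choose n c s hs using fun i => Submodule.mem_span_set'.1 (ha i)
  obtain rfl : a = fun i => ∑ j, c i j • (s i j : V i) := funext fun i => (hs i).symm
  rw [MultilinearMap.map_sum]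
  refine N.sum_mem fun k _ => ?_
  rw [MultilinearMap.map_smul_univ f (fun i => c i (k i)) (fun i => (s i (k i) : V i))]
  exact N.smul_mem _ (hN _ fun i => (s i (k i)).2)

end Finset

end BGG

namespace BGG

open Equiv PiTensorProduct

/-! ### Elements of wreath products -/

section Wreath

variable (F : Type u) [Field F] (A : Type v) [Ring A] [Algebra F A] {n : ℕ}

theorem single_eq_mul (σ : Perm (Fin n)) (t : TensorPow F A (Fin n)) :
    (SkewMonoidAlgebra.single σ t : WreathAlg F A n) = tensorIncl F A n t * permIncl F A n σ := by
  change _ = SkewMonoidAlgebra.single 1 t * SkewMonoidAlgebra.single σ 1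
  rw [SkewMonoidAlgebra.single_mul_single, one_mul, one_smul, mul_one]

theorem permIncl_mul_tprod (σ : Perm (Fin n)) (a : Fin n → A) :
    permIncl F A n σ * tensorIncl F A n (tprod F a) =
      tensorIncl F A n (tprod F fun k => a (σ.symm k)) * permIncl F A n σ := by
  rw [permIncl_mul_tensorIncl, perm_smul_def, tensorReindex_tprod]

theorem tprod_mul_permIncl (σ : Perm (Fin n)) (a : Fin n → A) :
    tensorIncl F A n (tprod F a) * permIncl F A n σ =
      permIncl F A n σ * tensorIncl F A n (tprod F fun k => a (σ k)) := by
  rw [permIncl_mul_tprod]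
  simp

theorem tprod_mul_tprod' (a b : Fin n → A) :
    tensorIncl F A n (tprod F a) * tensorIncl F A n (tprod F b) =
      tensorIncl F A n (tprod F fun k => a k * b k) := by
  rw [← map_mul, PiTensorProduct.tprod_mul_tprod]
  rfl

theorem tensorIncl_tprod_one : tensorIncl F A n (tprod F fun _ => 1) = 1 :=
  map_one (tensorIncl F A n)

variable {F A}

theorem tensorPow_mem {X E : Type*} [AddCommGroup E] [Module F E] (f : TensorPow F A X →ₗ[F] E)
    (N : Submodule F E) (h : ∀ a : X → A, f (tprod F a) ∈ N) (t : TensorPow F A X) : f t ∈ N := by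
  have ht : t ∈ Submodule.span F (Set.range (tprod F (s := fun _ : X => A))) := by
    rw [span_tprod_eq_top]; exact Submodule.mem_top
  induction ht using Submodule.span_induction with
  | mem t ht => obtain ⟨a, rfl⟩ := ht; exact h a
  | zero => rw [map_zero]; exact N.zero_mem
  | add s t _ _ hs ht => rw [map_add]; exact N.add_mem hs ht
  | smul c t _ ht => rw [map_smul]; exact N.smul_mem c ht

theorem wreath_mem (N : Submodule F (WreathAlg F A n))
    (h : ∀ (a : Fin n → A) (σ : Perm (Fin n)),
      tensorIncl F A n (tprod F a) * permIncl F A n σ ∈ N) (b : WreathAlg F A n) : b ∈ N := by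
  induction b using SkewMonoidAlgebra.induction_on' with
  | single σ t =>
    rw [single_eq_mul]
    exact tensorPow_mem (LinearMap.mulRight F (permIncl F A n σ) ∘ₗ
      (tensorIncl F A n).toLinearMap) N (fun a => h a σ) t
  | add a b ha hb => exact N.add_mem ha hb

section Young

variable {I : Type w} {Y : I → Type*}

/-- The embedding of a Young subgroup into the symmetric group. -/
def youngHom (e : (Σ i, Y i) ≃ Fin n) : (∀ i, Perm (Y i)) →* Perm (Fin n) :=
  e.permCongrHom.toMonoidHom.comp (Equiv.Perm.sigmaCongrRightHom Y)

theorem youngHom_apply (e : (Σ i, Y i) ≃ Fin n) (h : ∀ i, Perm (Y i)) (k : Fin n) :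
    youngHom e h k = e ⟨(e.symm k).1, h _ (e.symm k).2⟩ := rfl

theorem youngHom_apply_apply (e : (Σ i, Y i) ≃ Fin n) (h : ∀ i, Perm (Y i)) (z : Σ i, Y i) :
    youngHom e h (e z) = e ⟨z.1, h z.1 z.2⟩ := by
  rw [youngHom_apply, Equiv.symm_apply_apply]

theorem youngHom_symm_apply (e : (Σ i, Y i) ≃ Fin n) (h : ∀ i, Perm (Y i)) (k : Fin n) :
    (youngHom e h).symm k = e ⟨(e.symm k).1, (h _).symm (e.symm k).2⟩ := rfl

theorem youngHom_injective (e : (Σ i, Y i) ≃ Fin n) : Function.Injective (youngHom e) :=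
  e.permCongrHom.injective.comp Perm.sigmaCongrRightHom_injective

theorem youngIncl_single (e : (Σ i, Y i) ≃ Fin n) (h : ∀ i, Perm (Y i))
    (t : TensorPow F A (Σ i, Y i)) :
    youngIncl F A Y e (SkewMonoidAlgebra.single h t) =
      tensorIncl F A n (tensorReindex F A e t) * permIncl F A n (youngHom e h) :=
  SkewMonoidAlgebra.liftNC_single _ _ _ _

theorem youngIncl_single_one (e : (Σ i, Y i) ≃ Fin n) (t : TensorPow F A (Σ i, Y i)) :
    youngIncl F A Y e (SkewMonoidAlgebra.single 1 t) =
      tensorIncl F A n (tensorReindex F A e t) := by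
  rw [youngIncl_single, map_one, map_one, mul_one]

theorem youngIncl_single_perm (e : (Σ i, Y i) ≃ Fin n) (h : ∀ i, Perm (Y i)) :
    youngIncl F A Y e (SkewMonoidAlgebra.single h 1) = permIncl F A n (youngHom e h) := by
  rw [youngIncl_single, map_one, map_one, one_mul]

variable (F A) in
/-- The embedding of the group algebra of a Young subgroup into the wreath product. -/
def youngAlg (e : (Σ i, Y i) ≃ Fin n) :
    MonoidAlgebra F (∀ i, Perm (Y i)) →ₐ[F] WreathAlg F A n :=
  MonoidAlgebra.lift F (WreathAlg F A n) (∀ i, Perm (Y i)) ((permIncl F A n).comp (youngHom e))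

theorem youngAlg_single (e : (Σ i, Y i) ≃ Fin n) (h : ∀ i, Perm (Y i)) :
    youngAlg F A e (MonoidAlgebra.single h 1) = permIncl F A n (youngHom e h) := by
  rw [youngAlg, MonoidAlgebra.lift_single, one_smul]
  rfl

/-- The colour of a number with respect to a numbering of a disjoint union. -/
def colour (e : (Σ i, Y i) ≃ Fin n) (k : Fin n) : I := (e.symm k).1

theorem colour_youngHom_symm (e : (Σ i, Y i) ≃ Fin n) (h : ∀ i, Perm (Y i)) (k : Fin n) :
    colour e ((youngHom e h).symm k) = colour e k := by
  rw [youngHom_symm_apply, colour, Equiv.symm_apply_apply]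
  rfl

theorem groupAlg_mem {G E : Type*} [AddCommGroup E] [Module F E]
    (f : MonoidAlgebra F G →ₗ[F] E) (N : Submodule F E)
    (h : ∀ g : G, f (MonoidAlgebra.single g 1) ∈ N) (y : MonoidAlgebra F G) : f y ∈ N := by
  induction y using MonoidAlgebra.induction_linear with
  | zero => rw [map_zero]; exact N.zero_mem
  | add a b ha hb => rw [map_add]; exact N.add_mem ha hb
  | single g c =>
    rw [show (MonoidAlgebra.single g c : MonoidAlgebra F G) = c • MonoidAlgebra.single g 1 by
      simp [MonoidAlgebra.smul_single], map_smul]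
    exact N.smul_mem c (h g)

variable (e : I → A)

/-- The Young subgroup preserves colours, so it fixes a tensor whose factors depend only on the
colour. -/
theorem colour_commute (ε : (Σ i, Y i) ≃ Fin n) (y : MonoidAlgebra F (∀ i, Perm (Y i))) :
    tensorIncl F A n (tprod F fun k => e (colour ε k)) * youngAlg F A ε y =
      youngAlg F A ε y * tensorIncl F A n (tprod F fun k => e (colour ε k)) := by
  set E := tensorIncl F A n (tprod F fun k => e (colour ε k))
  have := groupAlg_mem (LinearMap.mulLeft F E ∘ₗ (youngAlg F A ε).toLinearMap -
    LinearMap.mulRight F E ∘ₗ (youngAlg F A ε).toLinearMap) ⊥ (fun g => by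
      rw [Submodule.mem_bot, LinearMap.sub_apply, sub_eq_zero]
      change E * youngAlg F A ε _ = youngAlg F A ε _ * E
      rw [youngAlg_single, permIncl_mul_tprod]
      simp only [colour_youngHom_symm]
      rfl) y
  rw [Submodule.mem_bot, LinearMap.sub_apply, sub_eq_zero] at this
  exact this

end Young

end Wreath

/-! ### Induced modules -/

section Induction

variable {F : Type*} [Field F] {B₀ : Type*} {B : Type*} [Ring B₀] [Ring B] [Algebra F B₀]
  [Algebra F B] (φ : B₀ →ₐ[F] B) (N : Type*) [AddCommGroup N] [Module F N] [Module B₀ N]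

/-- The class of `b ⊗ m` in the induced module. -/
def indMk : B →ₗ[F] N →ₗ[F] Ind φ N :=
  (TensorProduct.mk F B N).compr₂ ((indRel φ N).mkQ.restrictScalars F)

variable {N}

theorem indMk_mul (b : B) (a : B₀) (m : N) : indMk φ N (b * φ a) m = indMk φ N b (a • m) := by
  change Submodule.Quotient.mk _ = Submodule.Quotient.mk _
  rw [Submodule.Quotient.eq]
  exact Submodule.subset_span ⟨b, a, m, rfl⟩

theorem smul_indMk (b b' : B) (m : N) : b' • indMk φ N b m = indMk φ N (b' * b) m := rfl

theorem ind_mem (P : Submodule F (Ind φ N)) (h : ∀ b m, indMk φ N b m ∈ P) (y : Ind φ N) :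
    y ∈ P := by
  obtain ⟨t, rfl⟩ := Submodule.mkQ_surjective _ y
  induction t using TensorProduct.induction_on with
  | zero => rw [map_zero]; exact P.zero_mem
  | add s t hs ht => rw [map_add]; exact P.add_mem hs ht
  | tmul b m => exact h b m

/-- This is the part of Frobenius reciprocity that produces homomorphisms out of an induced module.
-/
theorem exists_indLift {V : Type*} [AddCommGroup V] [Module F V] [Module B V]
    [IsScalarTower F B V] (f : N →ₗ[F] V) (hf : ∀ (a : B₀) m, f (a • m) = φ a • f m) :
    ∃ g : Ind φ N →ₗ[B] V, ∀ b m, g (indMk φ N b m) = b • f m := by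
  let g : B ⊗[F] N →ₗ[B] V := TensorProduct.AlgebraTensorModule.lift
    ((LinearMap.toSpanSingleton B (N →ₗ[F] V) f))
  have hg : ∀ b m, g (b ⊗ₜ m) = b • f m := fun b m => rfl
  refine ⟨(indRel φ N).liftQ g (Submodule.span_le.2 ?_), fun b m => hg b m⟩
  rintro _ ⟨b, a, m, rfl⟩
  rw [SetLike.mem_coe, LinearMap.mem_ker, map_sub, hg, hg, hf, mul_smul, sub_self]

/-- A linear projection of `B` to `B₀` commuting with the right action of `B₀` induces a linear
map of the induced module to the original one. -/
theorem exists_indRetract [IsScalarTower F B₀ N] (π : B →ₗ[F] B₀)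
    (hπ : ∀ b a, π (b * φ a) = π b * a) :
    ∃ g : Ind φ N →ₗ[F] N, ∀ b m, g (indMk φ N b m) = π b • m := by
  let g : B ⊗[F] N →ₗ[F] N := TensorProduct.lift
    ((Algebra.lsmul F F N).toLinearMap ∘ₗ π : B →ₗ[F] N →ₗ[F] N)
  have hg : ∀ b m, g (b ⊗ₜ m) = π b • m := fun b m => rfl
  -- The relations are a `B`-span, while `g` is only `F`-linear; the induction needs the vanishing
  -- on all multiples.
  have key : ∀ t ∈ indRel φ N, ∀ b : B, g (b • t) = 0 := by
    intro t ht
    induction ht using Submodule.span_induction with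
    | mem t ht =>
      obtain ⟨b, a, m, rfl⟩ := ht
      intro b'
      rw [smul_sub, TensorProduct.smul_tmul', TensorProduct.smul_tmul', map_sub, hg, hg,
        smul_eq_mul, smul_eq_mul, ← mul_assoc, hπ, mul_smul, sub_self]
    | zero => simp
    | add s t _ _ hs ht => intro b; rw [smul_add, map_add, hs, ht, add_zero]
    | smul c t _ ht => intro b; rw [smul_smul]; exact ht _
  refine ⟨((indRel φ N).restrictScalars F).liftQ g fun t ht => ?_, fun b m => hg b m⟩
  have := key t ht 1
  rwa [one_smul] at this

end Induction

end BGG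

namespace BGG

open Equiv PiTensorProduct

/-! ### Calculations in standard modules of wreath products -/

section Standard

variable (F : Type u) [Field F] (A : Type v) [Ring A] [Algebra F A]
variable {I : Type w} [Fintype I] (M : I → Type x) [∀ i, AddCommGroup (M i)]
  [∀ i, Module F (M i)] [∀ i, Module A (M i)] [∀ i, IsScalarTower F A (M i)] {n : ℕ}

/-- The action of the group algebra of the Young subgroup on a tensor product of Specht modules. -/
def spechtAct (l : IPartition I n) : MonoidAlgebra F (∀ i, Perm (l.shape i).cells) →ₐ[F]
    Module.End F (⨂[F] i, specht F (l.shape i)) :=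
  MonoidAlgebra.lift F _ _
    { toFun := fun h => PiTensorProduct.map fun i => spechtRep F (l.shape i) (h i)
      map_one' := by simp only [Pi.one_apply, map_one, PiTensorProduct.map_one]
      map_mul' := fun g h => by simp only [Pi.mul_apply, map_mul, PiTensorProduct.map_mul] }

variable {F}

theorem spechtAct_single (l : IPartition I n) (h : ∀ i, Perm (l.shape i).cells) :
    spechtAct F l (MonoidAlgebra.single h 1) =
      PiTensorProduct.map fun i => spechtRep F (l.shape i) (h i) := by
  rw [spechtAct, MonoidAlgebra.lift_single, one_smul]
  rfl

theorem spechtAct_piAlg [DecidableEq I] (l : IPartition I n)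
    (a : ∀ i, MonoidAlgebra F (Perm (l.shape i).cells)) :
    spechtAct F l (piAlg F _ a) =
      PiTensorProduct.map fun i => (Algebra.lsmul F F (specht F (l.shape i)) :
        MonoidAlgebra F (Perm (l.shape i).cells) →ₐ[F] _) (a i) := by
  have := multilinear_ext_single (F := F) (G := fun i => Perm (l.shape i).cells)
    (f := (spechtAct F l).toLinearMap.compMultilinearMap (piAlg F _))
    (g := (PiTensorProduct.mapMultilinear F (fun i => specht F (l.shape i))
      (fun i => specht F (l.shape i))).compLinearMap fun i =>
        (Algebra.lsmul F F (specht F (l.shape i)) :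
          MonoidAlgebra F (Perm (l.shape i).cells) →ₐ[F] _).toLinearMap) (fun h => by
      rw [LinearMap.compMultilinearMap_apply, piAlg_single]
      exact spechtAct_single l h)
  exact congrArg (fun f => f a) this

theorem spechtAct_piAlg_tprod [DecidableEq I] (l : IPartition I n)
    (a : ∀ i, MonoidAlgebra F (Perm (l.shape i).cells)) (y : ∀ i, specht F (l.shape i)) :
    spechtAct F l (piAlg F _ a) (tprod F y) = tprod F fun i => a i • y i := by
  rw [spechtAct_piAlg, PiTensorProduct.map_tprod]
  rfl

variable (F)

/-- A pure tensor in the outer tensor product. -/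
def outerMk (l : IPartition I n) : (⨂[F] z : (Σ i, (l.shape i).cells), M z.1) →ₗ[F]
    (⨂[F] i, specht F (l.shape i)) →ₗ[F] OuterTensor F M l :=
  TensorProduct.mk F _ _

variable {F M}

theorem outer_mem (l : IPartition I n) (N : Submodule F (OuterTensor F M l))
    (h : ∀ m y, outerMk F M l (tprod F m) y ∈ N) (t : OuterTensor F M l) : t ∈ N := by
  induction t using TensorProduct.induction_on with
  | zero => exact N.zero_mem
  | add s t hs ht => exact N.add_mem hs ht
  | tmul s y =>
    have hs : s ∈ Submodule.span F
        (Set.range (tprod F (s := fun z : (Σ i, (l.shape i).cells) => M z.1))) := by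
      rw [span_tprod_eq_top]; exact Submodule.mem_top
    change outerMk F M l s y ∈ N
    induction hs using Submodule.span_induction with
    | mem s hs => obtain ⟨m, rfl⟩ := hs; exact h m y
    | zero => rw [map_zero]; exact N.zero_mem
    | add s t _ _ hs ht => rw [map_add]; exact N.add_mem hs ht
    | smul c s _ hs => rw [map_smul]; exact N.smul_mem c hs

variable {A}

theorem outer_smul_def (l : IPartition I n) (a : ParabolicAlg F A l) (t : OuterTensor F M l) :
    a • t = outerAct F A M l a t := rfl

instance (l : IPartition I n) : IsScalarTower F (ParabolicAlg F A l) (OuterTensor F M l) :=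
  ⟨fun c a t => by rw [outer_smul_def, map_smul]; rfl⟩

theorem tprod_smul_outerMk (l : IPartition I n) (a : (Σ i, (l.shape i).cells) → A)
    (m : ∀ z : (Σ i, (l.shape i).cells), M z.1) (y : ⨂[F] i, specht F (l.shape i)) :
    (SkewMonoidAlgebra.single 1 (tprod F a) : ParabolicAlg F A l) • outerMk F M l (tprod F m) y =
      outerMk F M l (tprod F fun z => a z • m z) y := by
  rw [outer_smul_def, outerAct]
  refine (LinearMap.congr_fun (SkewMonoidAlgebra.liftNC_single _ _ _ _) _).trans ?_
  rw [map_one]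
  change TensorProduct.map _ LinearMap.id (_ ⊗ₜ _) = _ ⊗ₜ _
  rw [TensorProduct.map_tmul]
  exact congrArg (fun s => s ⊗ₜ[F] y) (tensorAct_tprod F A _ a m)

theorem perm_smul_outerMk (l : IPartition I n) (h : ∀ i, Perm (l.shape i).cells)
    (s : ⨂[F] z : (Σ i, (l.shape i).cells), M z.1) (y : ⨂[F] i, specht F (l.shape i)) :
    (SkewMonoidAlgebra.single h 1 : ParabolicAlg F A l) • outerMk F M l s y =
      outerMk F M l (youngPermuteMap F _ M h s) (spechtAct F l (MonoidAlgebra.single h 1) y) := by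
  rw [outer_smul_def, outerAct, spechtAct_single]
  refine (LinearMap.congr_fun (SkewMonoidAlgebra.liftNC_single _ _ _ _) _).trans ?_
  rw [AddMonoidHom.coe_coe, map_one, one_mul]
  rfl

variable (F A M)

/-- The vector `σ ⊗ (x ⊗ y)` of a standard module of the wreath product. -/
def stdMk (l : IPartition I n) (σ : Perm (Fin n)) :
    (⨂[F] z : (Σ i, (l.shape i).cells), M z.1) →ₗ[F]
    (⨂[F] i, specht F (l.shape i)) →ₗ[F] WreathModule F A M l :=
  (outerMk F M l).compr₂ (indMk (youngIncl F A (fun i => (l.shape i).cells) l.numbering)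
    (OuterTensor F M l) (permIncl F A n σ))

variable {F A M}

theorem stdMk_apply (l : IPartition I n) (σ : Perm (Fin n))
    (s : ⨂[F] z : (Σ i, (l.shape i).cells), M z.1) (y : ⨂[F] i, specht F (l.shape i)) :
    stdMk F A M l σ s y = indMk (youngIncl F A (fun i => (l.shape i).cells) l.numbering)
      (OuterTensor F M l) (permIncl F A n σ) (outerMk F M l s y) := rfl

theorem perm_smul_stdMk (l : IPartition I n) (τ σ : Perm (Fin n))
    (s : ⨂[F] z : (Σ i, (l.shape i).cells), M z.1) (y : ⨂[F] i, specht F (l.shape i)) :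
    permIncl F A n τ • stdMk F A M l σ s y = stdMk F A M l (τ * σ) s y := by
  rw [stdMk_apply, stdMk_apply, smul_indMk, ← map_mul (permIncl F A n)]

theorem permIncl_mul_youngIncl_tprod (l : IPartition I n) (σ : Perm (Fin n)) (a : Fin n → A) :
    tensorIncl F A n (tprod F a) * permIncl F A n σ = permIncl F A n σ *
      youngIncl F A (fun i => (l.shape i).cells) l.numbering
        (SkewMonoidAlgebra.single 1 (tprod F fun z => a (σ (l.numbering z)))) := by
  rw [youngIncl_single_one, tensorReindex_tprod, tprod_mul_permIncl]
  simp

theorem tprod_smul_stdMk (l : IPartition I n) (a : Fin n → A) (σ : Perm (Fin n))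
    (m : ∀ z : (Σ i, (l.shape i).cells), M z.1) (y : ⨂[F] i, specht F (l.shape i)) :
    tensorIncl F A n (tprod F a) • stdMk F A M l σ (tprod F m) y =
      stdMk F A M l σ (tprod F fun z => a (σ (l.numbering z)) • m z) y := by
  rw [stdMk_apply, stdMk_apply, smul_indMk, permIncl_mul_youngIncl_tprod l, indMk_mul, tprod_smul_outerMk]

theorem stdMk_mul_youngHom (l : IPartition I n) (σ : Perm (Fin n))
    (h : ∀ i, Perm (l.shape i).cells)
    (s : ⨂[F] z : (Σ i, (l.shape i).cells), M z.1) (y : ⨂[F] i, specht F (l.shape i)) :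
    stdMk F A M l (σ * youngHom l.numbering h) s y =
      stdMk F A M l σ (youngPermuteMap F _ M h s)
        (spechtAct F l (MonoidAlgebra.single h 1) y) := by
  rw [stdMk_apply, stdMk_apply, map_mul, ← youngIncl_single_perm, indMk_mul, perm_smul_outerMk]

theorem std_mem (l : IPartition I n) (N : Submodule F (WreathModule F A M l))
    (h : ∀ σ m y, stdMk F A M l σ (tprod F m) y ∈ N) (t : WreathModule F A M l) : t ∈ N := by
  have h1 : ∀ σ t, indMk (youngIncl F A (fun i => (l.shape i).cells) l.numbering)
      (OuterTensor F M l) (permIncl F A n σ) t ∈ N := fun σ t =>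
    outer_mem l (N.comap (indMk (youngIncl F A (fun i => (l.shape i).cells) l.numbering)
      (OuterTensor F M l) (permIncl F A n σ))) (h σ) t
  refine ind_mem _ N (fun b t => ?_) t
  refine wreath_mem (N.comap ((indMk (youngIncl F A (fun i => (l.shape i).cells) l.numbering)
      (OuterTensor F M l)).flip t)) (fun a σ => ?_) b
  rw [Submodule.mem_comap, LinearMap.flip_apply, permIncl_mul_youngIncl_tprod l, indMk_mul]
  exact h1 σ _

variable (u : ∀ i, M i)

/-- The tensor product of the highest weight vectors. -/
def topTensor (F : Type u) [Field F] [∀ i, Module F (M i)] (l : IPartition I n) :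
    ⨂[F] z : (Σ i, (l.shape i).cells), M z.1 :=
  tprod F fun z => u z.1

theorem youngPermuteMap_topTensor (l : IPartition I n) (h : ∀ i, Perm (l.shape i).cells) :
    youngPermuteMap F (fun i => (l.shape i).cells) M h (topTensor u F l) = topTensor u F l :=
  youngPermuteMap_tprod F _ M h _

/-- When `σ` matches the cells of `l` and `m` colour by colour, a Young permutation for `m` moves
past `σ` as its conjugate under `β`. It then acts on the Specht factor alone, because the top tensor
is invariant. -/
theorem youngAlg_smul_stdMk [DecidableEq I] {l m : IPartition I n} (σ : Perm (Fin n))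
    (β : ∀ i, (l.shape i).cells ≃ (m.shape i).cells)
    (hβ : ∀ z : (Σ i, (l.shape i).cells), σ (l.numbering z) = m.numbering ⟨z.1, β z.1 z.2⟩)
    (a : ∀ i, MonoidAlgebra F (Perm (m.shape i).cells)) (y : ⨂[F] i, specht F (l.shape i)) :
    youngAlg F A m.numbering (piAlg F _ a) • stdMk F A M l σ (topTensor u F l) y =
      stdMk F A M l σ (topTensor u F l)
        (spechtAct F l (piAlg F _ fun i => permAlgMap (β i).symm (a i)) y) := by
  have := multilinear_ext_single (F := F) (G := fun i => Perm (m.shape i).cells)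
    (f := ((LinearMap.toSpanSingleton (WreathAlg F A n) _
      (stdMk F A M l σ (topTensor u F l) y)).restrictScalars F ∘ₗ
        (youngAlg F A m.numbering).toLinearMap).compMultilinearMap (piAlg F _))
    (g := ((stdMk F A M l σ (topTensor u F l)) ∘ₗ
      (LinearMap.applyₗ y) ∘ₗ (spechtAct F l).toLinearMap).compMultilinearMap
        ((piAlg F _).compLinearMap fun i => (permAlgMap (β i).symm).toLinearMap)) (fun h => by
      simp only [LinearMap.compMultilinearMap_apply, MultilinearMap.compLinearMap_apply,
        AlgHom.toLinearMap_apply, permAlgMap_single, piAlg_single]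
      change youngAlg F A m.numbering (MonoidAlgebra.single h 1) •
          stdMk F A M l σ (topTensor u F l) y =
        stdMk F A M l σ (topTensor u F l) (spechtAct F l
          (MonoidAlgebra.single (fun i => (β i).symm.permCongr (h i)) 1) y)
      rw [youngAlg_single, perm_smul_stdMk]
      conv_rhs => rw [← youngPermuteMap_topTensor u l fun i => (β i).symm.permCongr (h i)]
      rw [← stdMk_mul_youngHom]
      refine congrArg (fun τ => stdMk F A M l τ _ _) (Equiv.ext fun k => ?_)
      obtain ⟨z, rfl⟩ := l.numbering.surjective k
      rw [Perm.mul_apply, Perm.mul_apply, hβ, youngHom_apply_apply, youngHom_apply_apply, hβ]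
      simp [Equiv.permCongr_apply])
  exact congrArg (fun f => f a) this

end Standard

end BGG

namespace BGG

open Equiv PiTensorProduct

/-! ### Highest weights of the standard modules of wreath products -/

theorem exists_sigma_congr {I : Type*} {Y Y' : I → Type*} (β : (Σ i, Y i) ≃ Σ i, Y' i)
    (hβ : ∀ z, (β z).1 = z.1) : ∃ b : ∀ i, Y i ≃ Y' i, ∀ z, β z = ⟨z.1, b z.1 z.2⟩ := by
  have h1 : ∀ z : Σ i, Y i, ∃ w : Y' z.1, β z = ⟨z.1, w⟩ := fun z => by
    have := hβ z
    generalize β z = w at this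
    obtain ⟨i, w⟩ := w
    obtain rfl : i = z.1 := this
    exact ⟨w, rfl⟩
  have h2 : ∀ w : Σ i, Y' i, ∃ z : Y w.1, β.symm w = ⟨w.1, z⟩ := fun w => by
    have := hβ (β.symm w)
    rw [Equiv.apply_symm_apply] at this
    generalize β.symm w = z at this
    obtain ⟨i, z⟩ := z
    obtain rfl : w.1 = i := this
    exact ⟨z, rfl⟩
  choose f hf using h1
  choose g hg using h2
  refine ⟨fun i => ⟨fun y => f ⟨i, y⟩, fun y => g ⟨i, y⟩, fun y => ?_, fun y => ?_⟩, hf⟩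
  · exact (sigma_mk_injective ((β.symm_apply_apply _).symm.trans
      ((congrArg β.symm (hf ⟨i, y⟩)).trans (hg ⟨i, f ⟨i, y⟩⟩)))).symm
  · exact (sigma_mk_injective ((β.apply_symm_apply _).symm.trans
      ((congrArg β (hg ⟨i, y⟩)).trans (hf ⟨i, g ⟨i, y⟩⟩)))).symm

namespace IPartition

variable {I : Type w} [Fintype I] {n : ℕ}

theorem ext_shape {l m : IPartition I n} (h : ∀ i, l.shape i = m.shape i) : l = m := by
  obtain ⟨s, hs⟩ := l
  obtain ⟨t, ht⟩ := m
  obtain rfl : s = t := funext h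
  rfl

theorem card_le (l : IPartition I n) (i : I) : Fintype.card (l.shape i).cells ≤ n := by
  rw [Fintype.card_coe]
  exact (Finset.single_le_sum (f := fun i => (l.shape i).card) (fun _ _ => Nat.zero_le _)
    (Finset.mem_univ i)).trans_eq l.sum_card

theorem factorial_ne_zero {F : Type*} [Field F] (hn : (n.factorial : F) ≠ 0)
    (l : IPartition I n) (i : I) :
    ((Fintype.card (l.shape i).cells).factorial : F) ≠ 0 := by
  obtain ⟨k, hk⟩ := Nat.factorial_dvd_factorial (l.card_le i)
  intro h
  rw [hk, Nat.cast_mul, h, zero_mul] at hn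
  exact hn rfl

open Classical in
theorem upperSize_eq [PartialOrder I] (l : IPartition I n) (i : I) :
    l.upperSize i = (Finset.univ.filter fun z : (Σ i, (l.shape i).cells) => i ≤ z.1).card := by
  rw [show (Finset.univ.filter fun z : (Σ i, (l.shape i).cells) => i ≤ z.1) =
    (Finset.univ.filter fun j => i ≤ j).sigma fun j => Finset.univ by ext; simp,
    Finset.card_sigma, upperSize]
  simp

variable [PartialOrder I]

/-- If colours only go down along a bijection, the cells of colour at least `i` can only become
fewer. If no count drops, the cells of colour at least that of `z` are the same before and after, so
the colour of `z` is kept. -/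
theorem colour_cases {l m : IPartition I n}
    (β : (Σ i, (l.shape i).cells) ≃ Σ i, (m.shape i).cells) (hβ : ∀ z, (β z).1 ≤ z.1) :
    ((∀ i, m.upperSize i ≤ l.upperSize i) ∧ ∃ i, m.upperSize i < l.upperSize i) ∨
      ∀ z, (β z).1 = z.1 := by
  classical
  have h1 : ∀ i, m.upperSize i =
      (Finset.univ.filter fun z : (Σ i, (l.shape i).cells) => i ≤ (β z).1).card := fun i => by
    rw [upperSize_eq]
    exact (Finset.card_equiv β fun z => by simp).symm
  have h2 : ∀ i, (Finset.univ.filter fun z : (Σ i, (l.shape i).cells) => i ≤ (β z).1) ⊆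
      Finset.univ.filter fun z : (Σ i, (l.shape i).cells) => i ≤ z.1 := fun i z hz => by
    simp only [Finset.mem_filter, Finset.mem_univ, true_and] at hz ⊢
    exact hz.trans (hβ z)
  have h3 : ∀ i, m.upperSize i ≤ l.upperSize i := fun i => by
    rw [h1, upperSize_eq]
    exact Finset.card_le_card (h2 i)
  by_cases h : ∃ i, m.upperSize i < l.upperSize i
  · exact Or.inl ⟨h3, h⟩
  · push Not at h
    refine Or.inr fun z => (hβ z).antisymm ?_
    have h4 := Finset.eq_of_subset_of_card_le (h2 z.1) (by rw [← h1, ← upperSize_eq]; exact h _)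
    have : z ∈ Finset.univ.filter fun w : (Σ i, (l.shape i).cells) => z.1 ≤ w.1 := by simp
    rw [← h4] at this
    simpa using this

/-- All cells lie in an `n` by `n` square. -/
instance : Finite (IPartition I n) := by
  have h1 : ∀ (l : IPartition I n) i, (l.shape i).cells ⊆ Finset.range n ×ˢ Finset.range n := by
    intro l i c hc
    have hc' := (YoungDiagram.mem_cells _).1 hc
    have h2 := l.card_le i
    rw [Fintype.card_coe] at h2
    have hr : (l.shape i).rowLen c.1 ≤ n := by
      rw [YoungDiagram.rowLen_eq_card]
      exact (Finset.card_le_card (Finset.filter_subset _ _)).trans h2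
    have hk : (l.shape i).colLen c.2 ≤ n := by
      rw [YoungDiagram.colLen_eq_card]
      exact (Finset.card_le_card (Finset.filter_subset _ _)).trans h2
    rw [Finset.mem_product, Finset.mem_range, Finset.mem_range]
    exact ⟨(YoungDiagram.mem_iff_lt_colLen.1 hc').trans_le hk,
      (YoungDiagram.mem_iff_lt_rowLen.1 hc').trans_le hr⟩
  refine Finite.of_injective (β := I → (Finset.range n ×ˢ Finset.range n).powerset)
    (fun l i => ⟨(l.shape i).cells, Finset.mem_powerset.2 (h1 l i)⟩) fun l m hlm =>
      ext_shape fun i => YoungDiagram.ext (congrArg Subtype.val (congrFun hlm i))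

end IPartition

/-! ### Specht modules and their idempotents. -/

section Specht

variable (F : Type u) [Field F]

/-- The idempotent attached to a Young diagram. -/
def diagIdem (μ : YoungDiagram) : MonoidAlgebra F (Perm μ.cells) :=
  youngIdem F (fun c => c.1.1) (fun c => c.1.2)

/-- The generator of a Specht module. -/
def spechtGen (μ : YoungDiagram) : specht F μ :=
  ⟨youngSym F (fun c => c.1.1) (fun c => c.1.2), Ideal.subset_span rfl⟩

variable {F}

theorem exists_smul_spechtGen {μ : YoungDiagram} (y : specht F μ) :
    ∃ b : MonoidAlgebra F (Perm μ.cells), b • spechtGen F μ = y := by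
  obtain ⟨y, hy⟩ := y
  obtain ⟨b, rfl⟩ := Ideal.mem_span_singleton'.1 hy
  exact ⟨b, rfl⟩

variable {μ : YoungDiagram} (hμ : ((Fintype.card μ.cells).factorial : F) ≠ 0)

include hμ

theorem diagIdem_mul_self : diagIdem F μ * diagIdem F μ = diagIdem F μ :=
  youngIdem_mul_self hμ (isTableau_cells μ)

theorem diagIdem_mul_mul (y : MonoidAlgebra F (Perm μ.cells)) :
    ∃ t : F, diagIdem F μ * y * diagIdem F μ = t • diagIdem F μ :=
  youngIdem_mul_mul_youngIdem hμ (isTableau_cells μ) y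

theorem diagIdem_smul_spechtGen : diagIdem F μ • spechtGen F μ = spechtGen F μ := by
  obtain ⟨-, -, -, h⟩ := exists_youngSym_eq_smul hμ (isTableau_cells μ)
  exact Subtype.ext h

theorem spechtGen_eq_smul : ∃ t : F, t ≠ 0 ∧ (spechtGen F μ : MonoidAlgebra F (Perm μ.cells)) =
    t • diagIdem F μ := by
  obtain ⟨t, ht, h, -⟩ := exists_youngSym_eq_smul hμ (isTableau_cells μ)
  exact ⟨t, ht, h⟩

theorem spechtGen_ne_zero : spechtGen F μ ≠ 0 := by
  intro h
  have h1 := youngSym_coeff_one (F := F) (isTableau_cells μ)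
  rw [show youngSym F _ _ = 0 from congrArg Subtype.val h] at h1
  simp at h1

theorem diagIdem_smul (y : specht F μ) : ∃ t : F, diagIdem F μ • y = t • spechtGen F μ := by
  obtain ⟨b, rfl⟩ := exists_smul_spechtGen y
  obtain ⟨t, ht⟩ := youngIdem_mul_mul_youngSym hμ (isTableau_cells μ) b
  exact ⟨t, Subtype.ext ((mul_assoc _ _ _).symm.trans ht)⟩

/-- Relabelled, the idempotent is still a multiple of a Young symmetrizer of shape `ν`, hence
orthogonal to the left ideal of a symmetrizer of shape `μ`. -/
theorem permAlgMap_diagIdem_smul {ν : YoungDiagram} (g : ν.cells ≃ μ.cells) (hne : ν ≠ μ)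
    (y : specht F μ) : permAlgMap g (diagIdem F ν) • y = 0 := by
  obtain ⟨b, rfl⟩ := exists_smul_spechtGen y
  refine Subtype.ext ((mul_assoc _ _ _).symm.trans ?_)
  rw [diagIdem, youngIdem, map_smul, permAlgMap_youngSym, smul_mul_assoc, smul_mul_assoc,
    spechtGen, youngSym_mul_youngSym_of_ne hμ ((isTableau_cells ν).comp_equiv g.symm)
      (isTableau_cells μ) hne, smul_zero]
  rfl

end Specht

end BGG

namespace BGG

open Equiv PiTensorProduct

theorem tprod_mem {F : Type*} [Field F] {X : Type*} {V : X → Type*} [∀ i, AddCommMonoid (V i)]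
    [∀ i, Module F (V i)] {E : Type*} [AddCommMonoid E] [Module F E] (f : (⨂[F] i, V i) →ₗ[F] E)
    (N : Submodule F E) (h : ∀ y : ∀ i, V i, f (tprod F y) ∈ N) (t : ⨂[F] i, V i) : f t ∈ N := by
  have ht : t ∈ Submodule.span F (Set.range (tprod F (s := V))) := by
    rw [span_tprod_eq_top]; exact Submodule.mem_top
  induction ht using Submodule.span_induction with
  | mem t ht => obtain ⟨a, rfl⟩ := ht; exact h a
  | zero => rw [map_zero]; exact N.zero_mem
  | add s t _ _ hs ht => rw [map_add]; exact N.add_mem hs ht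
  | smul c t _ ht => rw [map_smul]; exact N.smul_mem c ht

theorem map_tprod_eq_zero {F : Type*} [Field F] {X : Type*} {V : X → Type*}
    [∀ i, AddCommMonoid (V i)] [∀ i, Module F (V i)] {E : Type*} [AddCommMonoid E] [Module F E]
    (f : (⨂[F] i, V i) →ₗ[F] E) {y : ∀ i, V i} (i : X) (h : y i = 0) : f (tprod F y) = 0 := by
  rw [MultilinearMap.map_coord_zero _ i h, map_zero]

/-! ### Weights of the standard modules of the wreath product. -/

section Weights

variable (F : Type u) [Field F] {A : Type v} [Ring A] [Algebra F A] {I : Type w} {n : ℕ}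

/-- The idempotent of the tensor power attached to a colouring of the tensor factors. -/
def weightIdem (e : I → A) (s : Fin n → I) : WreathAlg F A n :=
  tensorIncl F A n (tprod F fun k => e (s k))

variable {F} in
theorem weightIdem_mul_self {e : I → A} (he : ∀ i, e i * e i = e i) (s : Fin n → I) :
    weightIdem F e s * weightIdem F e s = weightIdem F e s := by
  simp only [weightIdem, tprod_mul_tprod', he]

variable [Fintype I] [DecidableEq I]

/-- The product of the idempotents of the components of a multipartition. -/
def shapeIdem (l : IPartition I n) : MonoidAlgebra F (∀ i, Perm (l.shape i).cells) :=
  piAlg F _ fun i => diagIdem F (l.shape i)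

/-- The idempotent of the wreath product attached to a multipartition. -/
def wreathIdem (e : I → A) (l : IPartition I n) : WreathAlg F A n :=
  weightIdem F e (colour l.numbering) * youngAlg F A l.numbering (shapeIdem F l)

/-- The tensor product of the generators of Specht modules. -/
def spechtTop (l : IPartition I n) : ⨂[F] i, specht F (l.shape i) :=
  tprod F fun i => spechtGen F (l.shape i)

variable {M : I → Type x} [∀ i, AddCommGroup (M i)]
  [∀ i, Module F (M i)] [∀ i, Module A (M i)] [∀ i, IsScalarTower F A (M i)]

variable (A) in
/-- The highest weight vector of a standard module of the wreath product. -/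
def topVec (u : ∀ i, M i) (l : IPartition I n) : WreathModule F A M l :=
  stdMk F A M l 1 (topTensor u F l) (spechtTop F l)

variable {F}

theorem wreathIdem_eq (e : I → A) (l : IPartition I n) : wreathIdem F e l =
    youngAlg F A l.numbering (shapeIdem F l) * weightIdem F e (colour l.numbering) :=
  colour_commute e _ _

theorem shapeIdem_mul_self (hn : (n.factorial : F) ≠ 0) (l : IPartition I n) :
    shapeIdem F l * shapeIdem F l = shapeIdem F l := by
  rw [shapeIdem, ← piAlg_mul]
  simp only [diagIdem_mul_self (l.factorial_ne_zero hn _)]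

theorem wreathIdem_mul_self (hn : (n.factorial : F) ≠ 0) {e : I → A} (he : ∀ i, e i * e i = e i)
    (l : IPartition I n) : wreathIdem F e l * wreathIdem F e l = wreathIdem F e l := by
  nth_rw 1 [wreathIdem_eq]
  rw [wreathIdem, mul_assoc, ← mul_assoc (weightIdem F e _) (weightIdem F e _),
    weightIdem_mul_self he]
  change _ * wreathIdem F e l = wreathIdem F e l
  rw [wreathIdem_eq, ← mul_assoc, ← map_mul, shapeIdem_mul_self hn]

theorem weightIdem_smul_stdMk (e : I → A) (s : Fin n → I) (l : IPartition I n) (σ : Perm (Fin n))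
    (m : ∀ z : (Σ i, (l.shape i).cells), M z.1) (y : ⨂[F] i, specht F (l.shape i)) :
    weightIdem F e s • stdMk F A M l σ (tprod F m) y =
      stdMk F A M l σ (tprod F fun z => e (s (σ (l.numbering z))) • m z) y :=
  tprod_smul_stdMk l _ σ m y

theorem permAlgMap_refl {X : Type*} [Fintype X] [DecidableEq X] (y : MonoidAlgebra F (Perm X)) :
    permAlgMap (Equiv.refl X).symm y = y := by
  induction y using MonoidAlgebra.induction_linear with
  | zero => exact map_zero _
  | add a b ha hb => rw [map_add, ha, hb]
  | single g c => exact permAlgMap_single _ g c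

theorem std_smul_mem (l : IPartition I n) (b : WreathAlg F A n)
    (N : Submodule F (WreathModule F A M l))
    (h : ∀ σ m y, b • stdMk F A M l σ (tprod F m) y ∈ N) (t : WreathModule F A M l) : b • t ∈ N :=
  std_mem l (N.comap ((Algebra.lsmul F F (WreathModule F A M l) : WreathAlg F A n →ₐ[F] _) b)) h t

theorem shapeIdem_smul_top (u : ∀ i, M i) (l : IPartition I n)
    (y : ⨂[F] i, specht F (l.shape i)) :
    youngAlg F A l.numbering (shapeIdem F l) • stdMk F A M l 1 (topTensor u F l) y =
      stdMk F A M l 1 (topTensor u F l) (spechtAct F l (shapeIdem F l) y) := by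
  rw [shapeIdem, youngAlg_smul_stdMk (A := A) u 1 (fun i => Equiv.refl _) (fun z => rfl)]
  simp only [permAlgMap_refl]

theorem spechtAct_shapeIdem (hn : (n.factorial : F) ≠ 0) (l : IPartition I n)
    (y : ⨂[F] i, specht F (l.shape i)) :
    spechtAct F l (shapeIdem F l) y ∈ Submodule.span F {spechtTop F l} := by
  refine tprod_mem (V := fun i => specht F (l.shape i))
    (spechtAct F l (shapeIdem F l)) _ (fun y => ?_) y
  change spechtAct F l (shapeIdem F l) (tprod F y) ∈ _
  rw [shapeIdem, spechtAct_piAlg_tprod]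
  choose t ht using fun i => diagIdem_smul (l.factorial_ne_zero hn i) (y i)
  simp only [ht, MultilinearMap.map_smul_univ]
  exact Submodule.smul_mem _ _ (Submodule.mem_span_singleton_self _)

theorem spechtAct_spechtTop (hn : (n.factorial : F) ≠ 0) (l : IPartition I n) :
    spechtAct F l (shapeIdem F l) (spechtTop F l) = spechtTop F l := by
  rw [shapeIdem, spechtTop, spechtAct_piAlg_tprod]
  simp only [diagIdem_smul_spechtGen (l.factorial_ne_zero hn _)]

variable [PartialOrder I] {e : I → A} {u : ∀ i, M i} 

theorem wreathIdem_smul_topVec (hn : (n.factorial : F) ≠ 0) (hu : ∀ i, e i • u i = u i)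
    (l : IPartition I n) : wreathIdem F e l • topVec F A u l = topVec F A u l := by
  rw [wreathIdem_eq, mul_smul, topVec, topTensor, weightIdem_smul_stdMk]
  simp only [Perm.one_apply, colour, Equiv.symm_apply_apply, hu]
  change _ • stdMk F A M l 1 (topTensor u F l) _ = stdMk F A M l 1 (topTensor u F l) _
  rw [shapeIdem_smul_top, spechtAct_spechtTop hn]

/-- The factor of the tensor at a cell `z` is multiplied by `e j`, where `j` is the colour in `m` of
the cell matched with `z` by `σ`. If no factor vanishes, then `j ≤ z.1` for all `z`. By
`colour_cases` either `m < l` or all colours agree; in the latter case each factor is projected to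
the line of its `u i`. -/
theorem weightIdem_smul_stdMk_cases (h : WeightData F A M e u) (l m : IPartition I n)
    (σ : Perm (Fin n)) (p : ∀ z : (Σ i, (l.shape i).cells), M z.1)
    (y : ⨂[F] i, specht F (l.shape i)) :
    weightIdem F e (colour m.numbering) • stdMk F A M l σ (tprod F p) y = 0 ∨ m < l ∨
      (∃ β : ∀ i, (l.shape i).cells ≃ (m.shape i).cells,
        ∀ z : (Σ i, (l.shape i).cells), σ (l.numbering z) = m.numbering ⟨z.1, β z.1 z.2⟩) ∧
      ∃ c : F, weightIdem F e (colour m.numbering) • stdMk F A M l σ (tprod F p) y =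
        c • stdMk F A M l σ (topTensor u F l) y := by
  rw [weightIdem_smul_stdMk]
  let β : (Σ i, (l.shape i).cells) ≃ Σ i, (m.shape i).cells :=
    (l.numbering.trans σ).trans m.numbering.symm
  by_cases h0 : ∃ z, e (β z).1 • p z = 0
  · obtain ⟨z, hz⟩ := h0
    left
    rw [MultilinearMap.map_coord_zero _ z hz, map_zero, LinearMap.zero_apply]
  push Not at h0
  right
  rcases IPartition.colour_cases β fun z => h.le_of_ne_zero _ _ _ (h0 z) with h1 | h1
  · left
    obtain ⟨i, hi⟩ := h1.2
    refine lt_of_le_of_ne (Or.inr h1) ?_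
    rintro rfl
    exact hi.ne rfl
  · right
    obtain ⟨b, hb⟩ := exists_sigma_congr β h1
    refine ⟨⟨b, fun z => ?_⟩, ?_⟩
    · rw [← hb]; exact (m.numbering.apply_symm_apply _).symm
    · choose c hc using fun z : (Σ i, (l.shape i).cells) => h.line z.1 (p z)
      refine ⟨∏ z, c z, ?_⟩
      rw [topTensor, ← LinearMap.smul_apply, ← map_smul, ← MultilinearMap.map_smul_univ]
      congr 3
      funext z
      rw [← hc]
      exact congrArg (fun i => e i • p z) (h1 z)

theorem wreathIdem_smul_eq_zero (hn : (n.factorial : F) ≠ 0) (h : WeightData F A M e u)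
    {l m : IPartition I n} (hlm : ¬ m ≤ l) (t : WreathModule F A M l) :
    wreathIdem F e m • t = 0 := by
  refine (Submodule.mem_bot F).1 (std_smul_mem l _ _ (fun σ p y => ?_) t)
  rw [Submodule.mem_bot, wreathIdem_eq, mul_smul]
  rcases weightIdem_smul_stdMk_cases h l m σ p y with h0 | h0 | ⟨⟨β, hβ⟩, c, hc⟩
  · rw [h0, smul_zero]
  · exact absurd h0.le hlm
  · rw [hc, smul_comm, shapeIdem, youngAlg_smul_stdMk u σ β hβ]
    -- The colours agree but `m ≠ l`, so some component has a different shape, and its Young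
    -- idempotent kills the Specht module.
    obtain ⟨i, hi⟩ : ∃ i, m.shape i ≠ l.shape i := by
      by_contra! h1
      exact hlm (IPartition.ext_shape h1).le
    have : stdMk F A M l σ (topTensor u F l) (spechtAct F l (piAlg F _ fun i =>
        permAlgMap (β i).symm (diagIdem F (m.shape i))) y) ∈
        (⊥ : Submodule F (WreathModule F A M l)) := by
      refine tprod_mem (V := fun i => specht F (l.shape i))
        (stdMk F A M l σ (topTensor u F l) ∘ₗ spechtAct F l (piAlg F _ fun i =>
          permAlgMap (β i).symm (diagIdem F (m.shape i)))) _ (fun y => ?_) y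
      rw [Submodule.mem_bot, LinearMap.comp_apply, spechtAct_piAlg_tprod]
      refine map_tprod_eq_zero (V := fun i => specht F (l.shape i)) _ i ?_
      exact permAlgMap_diagIdem_smul (l.factorial_ne_zero hn i) _ hi _
    rw [(Submodule.mem_bot F).1 this, smul_zero]

theorem stdMk_mem_span_topVec (l : IPartition I n) (y : ⨂[F] i, specht F (l.shape i))
    (hn : (n.factorial : F) ≠ 0) : youngAlg F A l.numbering (shapeIdem F l) •
      stdMk F A M l 1 (topTensor u F l) y ∈ Submodule.span F {topVec F A u l} := by
  rw [shapeIdem_smul_top]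
  obtain ⟨c, hc⟩ := Submodule.mem_span_singleton.1 (spechtAct_shapeIdem hn l y)
  rw [← hc, map_smul]
  exact Submodule.smul_mem _ _ (Submodule.mem_span_singleton_self _)

theorem wreathIdem_smul_mem (hn : (n.factorial : F) ≠ 0) (h : WeightData F A M e u)
    (l : IPartition I n) (t : WreathModule F A M l) :
    wreathIdem F e l • t ∈ Submodule.span F {topVec F A u l} := by
  refine std_smul_mem l _ _ (fun σ p y => ?_) t
  rw [wreathIdem_eq, mul_smul]
  rcases weightIdem_smul_stdMk_cases h l l σ p y with h0 | h0 | ⟨⟨β, hβ⟩, c, hc⟩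
  · rw [h0, smul_zero]
    exact Submodule.zero_mem _
  · exact absurd h0 (lt_irrefl l)
  -- A permutation preserving the colours of `l` lies in the Young subgroup and can be moved across
  -- the tensor sign.
  · have hσ : σ = 1 * youngHom l.numbering β := by
      rw [one_mul]
      refine Equiv.ext fun k => ?_
      obtain ⟨z, rfl⟩ := l.numbering.surjective k
      rw [hβ, youngHom_apply_apply]
    rw [hc, smul_comm, hσ, stdMk_mul_youngHom, youngPermuteMap_topTensor]
    exact Submodule.smul_mem _ _ (stdMk_mem_span_topVec l _ hn)

theorem stdMk_topTensor_tprod_spechtGen (l : IPartition I n)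
    (b : ∀ i, MonoidAlgebra F (Perm (l.shape i).cells)) :
    stdMk F A M l 1 (topTensor u F l) (tprod F fun i => b i • spechtGen F (l.shape i)) =
      youngAlg F A l.numbering (piAlg F _ b) • topVec F A u l := by
  rw [topVec, youngAlg_smul_stdMk (A := A) u 1 (fun i => Equiv.refl _) (fun z => rfl)]
  simp only [permAlgMap_refl]
  rw [spechtTop, spechtAct_piAlg_tprod]

theorem stdMk_tprod_eq_smul (l : IPartition I n) (σ : Perm (Fin n))
    (a : (Σ i, (l.shape i).cells) → A) (y : ⨂[F] i, specht F (l.shape i)) :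
    stdMk F A M l σ (tprod F fun z => a z • u z.1) y =
      tensorIncl F A n (tprod F fun k => a (l.numbering.symm (σ.symm k))) •
        permIncl F A n σ • stdMk F A M l 1 (topTensor u F l) y := by
  rw [perm_smul_stdMk, mul_one, topTensor, tprod_smul_stdMk]
  simp only [Equiv.symm_apply_apply]

theorem stdMk_mem_span (l : IPartition I n) (y : ⨂[F] i, specht F (l.shape i)) :
    stdMk F A M l 1 (topTensor u F l) y ∈
      (Submodule.span (WreathAlg F A n) {topVec F A u l}).restrictScalars F := by
  refine tprod_mem (V := fun i => specht F (l.shape i)) (stdMk F A M l 1 (topTensor u F l))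
    ((Submodule.span (WreathAlg F A n) {topVec F A u l}).restrictScalars F) (fun y => ?_) y
  choose b hb using fun i => exists_smul_spechtGen (y i)
  rw [← funext hb, stdMk_topTensor_tprod_spechtGen]
  exact Submodule.mem_span_singleton.2 ⟨_, rfl⟩

/-- Each tensor factor is generated by its `u i`, each Specht module by its generator, and the
induced module by its part at the identity. -/
theorem exists_smul_topVec (h : WeightData F A M e u)
    (l : IPartition I n) (t : WreathModule F A M l) :
    ∃ b : WreathAlg F A n, b • topVec F A u l = t := by
  refine Submodule.mem_span_singleton.1 (std_mem l
    ((Submodule.span (WreathAlg F A n) {topVec F A u l}).restrictScalars F) (fun σ p y => ?_) t)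
  choose a ha using fun z : (Σ i, (l.shape i).cells) => h.generates z.1 (p z)
  rw [← funext ha, stdMk_tprod_eq_smul]
  exact (Submodule.span (WreathAlg F A n) {topVec F A u l}).smul_mem _
    ((Submodule.span (WreathAlg F A n) {topVec F A u l}).smul_mem _ (stdMk_mem_span l y))

end Weights

end BGG

namespace BGG

open Equiv PiTensorProduct

/-! ### The highest weight vectors are non-zero. -/

section Nonvanishing

variable {F : Type u} [Field F]

theorem exists_dual_tprod {X : Type*} [Finite X] {V : X → Type*} [∀ i, AddCommGroup (V i)]
    [∀ i, Module F (V i)] (y : ∀ i, V i) (hy : ∀ i, y i ≠ 0) :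
    ∃ f : (⨂[F] i, V i) →ₗ[F] F, f (tprod F y) = 1 := by
  have := Fintype.ofFinite X
  choose f hf using fun i => Module.Projective.exists_dual_eq_one F (hy i)
  refine ⟨PiTensorProduct.lift ((MultilinearMap.mkPiAlgebra F X F).compLinearMap f), ?_⟩
  rw [PiTensorProduct.lift.tprod, MultilinearMap.compLinearMap_apply,
    MultilinearMap.mkPiAlgebra_apply]
  simp only [hf, Finset.prod_const_one]

variable {A : Type v} [Ring A] [Algebra F A] {I : Type w} {n : ℕ} {Y : I → Type*}

/-- The embedding of `A^{⊗ X} ⋊ ∏ i, S_{Y i}` into the wreath product has a linear left inverse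
which commutes with the right multiplications. -/
theorem exists_youngRetract [Fintype (∀ i, Perm (Y i))] (e : (Σ i, Y i) ≃ Fin n) :
    ∃ π : WreathAlg F A n →ₗ[F] YoungAlg F A Y,
      (∀ b a, π (b * youngIncl F A Y e a) = π b * a) ∧ π 1 = 1 := by
  classical
  -- The retraction forgets all coefficients outside the Young subgroup.
  let π : WreathAlg F A n →ₗ[F] YoungAlg F A Y :=
    { toFun := fun b => ∑ h : ∀ i, Perm (Y i),
        SkewMonoidAlgebra.single h (tensorReindex F A e.symm (b.coeff (youngHom e h)))
      map_add' := fun a b => by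
        simp only [SkewMonoidAlgebra.coeff_add, Finsupp.add_apply, map_add,
          SkewMonoidAlgebra.single_add, Finset.sum_add_distrib]
      map_smul' := fun c a => by
        simp only [SkewMonoidAlgebra.coeff_smul, Finsupp.smul_apply, map_smul, Finset.smul_sum,
          SkewMonoidAlgebra.smul_single, RingHom.id_apply] }
  have h1 : ∀ h t, π (SkewMonoidAlgebra.single (youngHom e h) t) =
      SkewMonoidAlgebra.single h (tensorReindex F A e.symm t) := fun h t => by
    change ∑ k : ∀ i, Perm (Y i), _ = _
    rw [Finset.sum_eq_single h]
    · simp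
    · intro k _ hk
      rw [SkewMonoidAlgebra.coeff_single_apply, if_neg fun hh => hk (youngHom_injective e hh).symm,
        map_zero, SkewMonoidAlgebra.single_zero]
    · simp
  have h2 : ∀ σ t, σ ∉ Set.range (youngHom e) → π (SkewMonoidAlgebra.single σ t) = 0 :=
    fun σ t hσ => Finset.sum_eq_zero fun k _ => by
      rw [SkewMonoidAlgebra.coeff_single_apply, if_neg fun hh => hσ ⟨k, hh.symm⟩,
        map_zero, SkewMonoidAlgebra.single_zero]
  have h3 : ∀ (h : ∀ i, Perm (Y i)) (t : TensorPow F A (Fin n)),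
      tensorReindex F A e.symm (youngHom e h • t) = h • tensorReindex F A e.symm t := fun h t =>
    tensorPow_ext F A
      (f := ((tensorReindex F A e.symm).comp (tensorReindex F A (youngHom e h))).toLinearMap)
      (g := ((tensorReindex F A (Perm.sigmaCongrRight h)).comp
        (tensorReindex F A e.symm)).toLinearMap) (fun a => by
          simp only [AlgHom.toLinearMap_apply, AlgHom.comp_apply, tensorReindex_tprod,
            Equiv.symm_symm]
          refine congrArg _ (funext fun z => congrArg a ?_)
          rw [youngHom_symm_apply, Equiv.symm_apply_apply]
          rfl) t
  have h4 : ∀ t : TensorPow F A (Σ i, Y i),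
      tensorReindex F A e.symm (tensorReindex F A e t) = t := fun t =>
    tensorPow_ext F A (f := ((tensorReindex F A e.symm).comp (tensorReindex F A e)).toLinearMap)
      (g := LinearMap.id) (fun a => by simp) t
  refine ⟨π, fun b a => ?_, ?_⟩
  · induction b using SkewMonoidAlgebra.induction_on' with
    | add b b' hb hb' => rw [add_mul, map_add, map_add, hb, hb', add_mul]
    | single σ t =>
    induction a using SkewMonoidAlgebra.induction_on' with
    | add b b' hb hb' => rw [map_add, mul_add, map_add, hb, hb', mul_add]
    | single k s =>
      rw [youngIncl_single, ← single_eq_mul, SkewMonoidAlgebra.single_mul_single]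
      by_cases hσ : σ ∈ Set.range (youngHom e)
      · obtain ⟨h, rfl⟩ := hσ
        rw [← map_mul, h1, h1, SkewMonoidAlgebra.single_mul_single, map_mul, h3, h4]
      · rw [h2 _ _ hσ, h2, zero_mul]
        rintro ⟨h, hh⟩
        exact hσ ⟨h * k⁻¹, by rw [map_mul, hh, map_inv, mul_inv_cancel_right]⟩
  · rw [SkewMonoidAlgebra.one_def, ← map_one (youngHom e), h1, map_one]
    rfl

instance wreathAlg_finite [FiniteDimensional F A] : FiniteDimensional F (WreathAlg F A n) :=
  Module.Finite.equiv (SkewMonoidAlgebra.coeffLinearEquiv (S := F) (G := Perm (Fin n))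
    (k := TensorPow F A (Fin n))).symm

variable [Fintype I] {M : I → Type x} [∀ i, AddCommGroup (M i)]
  [∀ i, Module F (M i)] [∀ i, Module A (M i)] [∀ i, IsScalarTower F A (M i)]

/-- The retraction of the algebra induces one of the induced module onto the outer tensor product.
There a product of dual functionals takes the value `1` on the tensor of the generators. -/
theorem topVec_ne_zero (hn : (n.factorial : F) ≠ 0) {u : ∀ i, M i} (hu : ∀ i, u i ≠ 0)
    (l : IPartition I n) : topVec F A u l ≠ 0 := by
  classical
  obtain ⟨π, hπ, h1⟩ := exists_youngRetract (F := F) (A := A) l.numbering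
  obtain ⟨g, hg⟩ := exists_indRetract (youngIncl F A (fun i => (l.shape i).cells) l.numbering)
    (N := OuterTensor F M l) π hπ
  obtain ⟨f, hf⟩ := exists_dual_tprod (F := F)
    (fun z : (Σ i, (l.shape i).cells) => u z.1) fun z => hu z.1
  obtain ⟨f', hf'⟩ := exists_dual_tprod (F := F) (V := fun i => specht F (l.shape i))
    (fun i => spechtGen F (l.shape i))
    fun i => spechtGen_ne_zero (l.factorial_ne_zero hn i)
  have h2 : g (topVec F A u l) = outerMk F M l (topTensor u F l) (spechtTop F l) := by
    rw [topVec, stdMk_apply, hg, map_one, h1, one_smul]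
  have h3 : TensorProduct.lift ((LinearMap.mul F F).compl₁₂ f f') (g (topVec F A u l)) = 1 := by
    rw [h2]
    change f (tprod F fun z => u z.1) * f' (tprod F _) = 1
    rw [hf, hf', mul_one]
  intro h0
  rw [h0, map_zero] at h3
  exact zero_ne_one ((map_zero _).symm.trans h3)

end Nonvanishing

end BGG

namespace BGG

open Equiv PiTensorProduct

theorem IsTableau.exists_equiv {X : Type*} {μ : YoungDiagram} {r c : X → ℕ}
    (h : IsTableau μ r c) :
    ∃ g : μ.cells ≃ X, r = (fun p => p.1.1) ∘ g.symm ∧ c = (fun p => p.1.2) ∘ g.symm :=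
  ⟨(Equiv.ofBijective (fun x => ⟨(r x, c x), (YoungDiagram.mem_cells _).2 (h.mem x)⟩)
    ⟨fun x y hxy => h.inj (congrArg Subtype.val hxy), fun p => by
      obtain ⟨x, hx⟩ := h.surj p.1 ((YoungDiagram.mem_cells _).1 p.2)
      exact ⟨x, Subtype.ext hx⟩⟩).symm, rfl, rfl⟩

/-! ### The idempotents of the multipartitions generate the wreath product. -/

section Conjugation

variable {F : Type u} [Field F] {A : Type v} [Ring A] [Algebra F A] {I : Type w} {n : ℕ}

/-- The Young subgroups of two numberings of matching families of sets are conjugate by the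
permutation comparing the numberings. -/
theorem permIncl_mul_youngAlg [Fintype I] [DecidableEq I] {Y Y' : I → Type*}
    [∀ i, Fintype (Y i)] [∀ i, Fintype (Y' i)] [∀ i, DecidableEq (Y i)] [∀ i, DecidableEq (Y' i)]
    (ε : (Σ i, Y i) ≃ Fin n)
    (ε' : (Σ i, Y' i) ≃ Fin n) (g : ∀ i, Y i ≃ Y' i)
    (x : ∀ i, MonoidAlgebra F (Perm (Y i))) :
    permIncl F A n ((ε.symm.trans (Equiv.sigmaCongrRight g)).trans ε') *
        youngAlg F A ε (piAlg F _ x) =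
      youngAlg F A ε' (piAlg F _ fun i => permAlgMap (g i) (x i)) *
        permIncl F A n ((ε.symm.trans (Equiv.sigmaCongrRight g)).trans ε') := by
  set s := permIncl F A n ((ε.symm.trans (Equiv.sigmaCongrRight g)).trans ε') with hs
  have := multilinear_ext_single (F := F) (G := fun i => Perm (Y i))
    (f := (LinearMap.mulLeft F s ∘ₗ (youngAlg F A ε).toLinearMap).compMultilinearMap (piAlg F _))
    (g := (LinearMap.mulRight F s ∘ₗ (youngAlg F A ε').toLinearMap).compMultilinearMap
      ((piAlg F _).compLinearMap fun i => (permAlgMap (g i)).toLinearMap)) (fun h => by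
    simp only [LinearMap.compMultilinearMap_apply, MultilinearMap.compLinearMap_apply,
      AlgHom.toLinearMap_apply, permAlgMap_single, piAlg_single, LinearMap.comp_apply,
      LinearMap.mulLeft_apply, LinearMap.mulRight_apply]
    rw [youngAlg_single, youngAlg_single, hs, ← map_mul, ← map_mul]
    refine congrArg _ (Equiv.ext fun k => ?_)
    obtain ⟨z, rfl⟩ := ε.surjective k
    simp only [Perm.mul_apply, youngHom_apply_apply, Equiv.trans_apply, Equiv.symm_apply_apply,
      Equiv.sigmaCongrRight_apply]
    simp)
  exact congrArg (fun f => f x) this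

theorem permIncl_mul_weightIdem {Y Y' : I → Type*} (e : I → A) (ε : (Σ i, Y i) ≃ Fin n)
    (ε' : (Σ i, Y' i) ≃ Fin n) (g : ∀ i, Y i ≃ Y' i) :
    permIncl F A n ((ε.symm.trans (Equiv.sigmaCongrRight g)).trans ε') *
        weightIdem F e (colour ε) =
      weightIdem F e (colour ε') *
        permIncl F A n ((ε.symm.trans (Equiv.sigmaCongrRight g)).trans ε') := by
  rw [weightIdem, permIncl_mul_tprod, weightIdem]
  simp only [colour]
  congr 3
  funext k
  simp
  rfl

variable [Fintype I] [DecidableEq I]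

/-- In the group algebra of the symmetric group of each fibre of `s`, the unit is a combination of
products `a * c * b` with Young symmetrizers `c`. A choice of one shape for each fibre is an
`I`-partition `l`, and the tensor idempotent times the chosen symmetrizers is, up to a scalar,
conjugate to `wreathIdem F e l`. The outer factors `a` commute with the tensor idempotent. -/
theorem weightIdem_mem_span (hn : (n.factorial : F) ≠ 0) (e : I → A) (s : Fin n → I)
    (N : Submodule F (WreathAlg F A n)) (hN : ∀ a l b, a * wreathIdem F e l * b ∈ N) :
    weightIdem F e s ∈ N := by
  classical
  let Y : I → Type := fun i => {k // s k = i}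
  -- With this numbering, `colour ε` is `s` by definition.
  let ε : (Σ i, Y i) ≃ Fin n := Equiv.sigmaFiberEquiv s
  have hY : ∀ i, ((Fintype.card (Y i)).factorial : F) ≠ 0 := fun i => by
    have h1 : Fintype.card (Y i) ≤ n := by
      simpa using Fintype.card_subtype_le (fun k => s k = i)
    obtain ⟨k, hk⟩ := Nat.factorial_dvd_factorial h1
    intro h
    rw [hk, Nat.cast_mul, h, zero_mul] at hn
    exact hn rfl
  have key := multilinear_mem_span (F := F) (V := fun i => MonoidAlgebra F (Perm (Y i)))
    ((LinearMap.mulLeft F (weightIdem F e s) ∘ₗ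
      (youngAlg F A ε).toLinearMap).compMultilinearMap (piAlg F _)) _ N (fun x hx => ?_)
    (fun _ => 1) (fun i => one_mem_span_youngSym (hY i))
  · change weightIdem F e s * youngAlg F A ε (piAlg F _ fun _ => 1) ∈ N at key
    rwa [piAlg_one, map_one, mul_one] at key
  choose μ r c a b hT hx using hx
  change weightIdem F e s * youngAlg F A ε (piAlg F _ x) ∈ N
  choose g hr hc using fun i => (hT i).exists_equiv
  have hcard : ∑ i, (μ i).card = n := by
    have h1 : ∀ i, (μ i).card = Fintype.card (Y i) := fun i => by
      rw [← Fintype.card_congr (g i), Fintype.card_coe]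
    simp only [h1]
    rw [← Fintype.card_sigma, Fintype.card_congr ε, Fintype.card_fin]
  let l : IPartition I n := ⟨μ, hcard⟩
  choose t ht0 ht using fun i => spechtGen_eq_smul (F := F) (l.factorial_ne_zero hn i)
  have hx' : ∀ i, x i = t i • (a i * permAlgMap (g i) (diagIdem F (μ i)) * b i) := fun i => by
    rw [hx, hr, hc, ← permAlgMap_youngSym, ← smul_mul_assoc, ← mul_smul_comm, ← map_smul, ← ht]
    rfl
  rw [funext hx', MultilinearMap.map_smul_univ, map_smul, mul_smul_comm, piAlg_mul, piAlg_mul,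
    map_mul, map_mul]
  refine N.smul_mem _ ?_
  have hs : weightIdem F e s = weightIdem F e (colour ε) := rfl
  have h1 := permIncl_mul_youngAlg (F := F) (A := A) l.numbering ε g fun i => diagIdem F (μ i)
  have h2 := permIncl_mul_weightIdem (F := F) e l.numbering ε g
  set σ := (l.numbering.symm.trans (Equiv.sigmaCongrRight g)).trans ε
  have h3 : permIncl F A n σ * permIncl F A n σ⁻¹ = 1 := by
    rw [← map_mul, mul_inv_cancel, map_one]
  have h4 := colour_commute e ε (piAlg F _ a)
  change weightIdem F e (colour ε) * _ = _ * weightIdem F e (colour ε) at h4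
  have h5 : weightIdem F e s * (youngAlg F A ε (piAlg F _ a) *
      youngAlg F A ε (piAlg F _ fun i => permAlgMap (g i) (diagIdem F (μ i))) *
        youngAlg F A ε (piAlg F _ b)) =
      (youngAlg F A ε (piAlg F _ a) * permIncl F A n σ) * wreathIdem F e l *
        (permIncl F A n σ⁻¹ * youngAlg F A ε (piAlg F _ b)) := by
    rw [hs, wreathIdem, ← mul_assoc, ← mul_assoc, h4]
    simp only [mul_assoc]
    refine congrArg _ ?_
    rw [← mul_assoc (permIncl F A n σ), h2, mul_assoc]
    refine congrArg _ ?_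
    change _ = permIncl F A n σ * (youngAlg F A l.numbering (piAlg F _ fun i => diagIdem F (μ i)) * _)
    rw [← mul_assoc (permIncl F A n σ), h1, mul_assoc]
    refine congrArg _ ?_
    rw [← mul_assoc, h3, one_mul]
  rw [h5]
  exact hN _ _ _

/-- The unit is a pure tensor of units. Expanding every factor as a combination of products `a * e i
* b` leaves, between pure tensors, the idempotents `weightIdem` of arbitrary colourings. -/
theorem one_mem_span_wreathIdem (hn : (n.factorial : F) ≠ 0) (e : I → A)
    (he : (1 : A) ∈ Submodule.span F {z | ∃ l a b, z = a * e l * b}) :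
    (1 : WreathAlg F A n) ∈ Submodule.span F {z | ∃ l a b, z = a * wreathIdem F e l * b} := by
  set N := Submodule.span F {z : WreathAlg F A n | ∃ l a b, z = a * wreathIdem F e l * b}
  have hmul : ∀ c z d, z ∈ N → c * z * d ∈ N := fun c z d hz => by
    induction hz using Submodule.span_induction with
    | mem z hz =>
      obtain ⟨l, a, b, rfl⟩ := hz
      exact Submodule.subset_span ⟨l, c * a, b * d, by simp only [mul_assoc]⟩
    | zero => rw [mul_zero, zero_mul]; exact N.zero_mem
    | add y z _ _ hy hz => rw [mul_add, add_mul]; exact N.add_mem hy hz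
    | smul t z _ hz => rw [mul_smul_comm, smul_mul_assoc]; exact N.smul_mem t hz
  have key := multilinear_mem_span (F := F) (V := fun _ : Fin n => A)
    ((tensorIncl F A n).toLinearMap.compMultilinearMap (tprod F)) _ N (fun x hx => ?_)
    (fun _ => 1) (fun i => he)
  · change tensorIncl F A n (tprod F fun _ => 1) ∈ N at key
    rwa [tensorIncl_tprod_one] at key
  choose s a b hx using hx
  change tensorIncl F A n (tprod F x) ∈ N
  rw [funext hx, ← tprod_mul_tprod', ← tprod_mul_tprod']
  exact hmul _ _ _ (weightIdem_mem_span hn e s N fun a l b => Submodule.subset_span ⟨l, a, b, rfl⟩)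

end Conjugation

end BGG

namespace BGG

open Equiv PiTensorProduct

/-! ### Tensors in the radical, and the residue of the idempotents. -/

section Radical

variable {F : Type u} [Field F] {A : Type v} [Ring A] [Algebra F A] {n : ℕ}

theorem tensorIncl_tprod_eq_zero (a : Fin n → A) (k : Fin n) (h : a k = 0) :
    tensorIncl F A n (tprod F a) = 0 := by
  rw [MultilinearMap.map_coord_zero _ k h, map_zero]

/-- The annihilator in a module of the tensors with a factor in a two-sided ideal. -/
def tensorAnnihilator (J : Ideal A) [J.IsTwoSided] (S : Type*) [AddCommGroup S]
    [Module (WreathAlg F A n) S] : Submodule (WreathAlg F A n) S where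
  carrier := {y | ∀ (a : Fin n → A) k, a k ∈ J → tensorIncl F A n (tprod F a) • y = 0}
  add_mem' hy hz a k h := by rw [smul_add, hy a k h, hz a k h, add_zero]
  zero_mem' a k h := smul_zero _
  smul_mem' b y hy a k h := by
    let : Module F S := Module.compHom S (algebraMap F (WreathAlg F A n))
    have : IsScalarTower F (WreathAlg F A n) S := ⟨fun c b y => by
      rw [Algebra.smul_def, mul_smul]; rfl⟩
    rw [smul_smul]
    refine wreath_mem (LinearMap.ker (((LinearMap.toSpanSingleton (WreathAlg F A n) S y).restrictScalars
      F) ∘ₗ LinearMap.mulLeft F (tensorIncl F A n (tprod F a)))) (fun b σ => ?_) b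
    change (tensorIncl F A n (tprod F a) * (tensorIncl F A n (tprod F b) * permIncl F A n σ)) • y = 0
    rw [← mul_assoc, tprod_mul_tprod', tprod_mul_permIncl, mul_smul,
      hy _ (σ.symm k) (by simpa using J.mul_mem_right _ h), smul_zero]

/-- A pure tensor with a factor in a nilpotent ideal is in the radical of the wreath product. -/
theorem tprod_mem_jacobson_of_isNilpotent (J : Ideal A) [J.IsTwoSided] (hJ : IsNilpotent J)
    (a : Fin n → A) (k : Fin n) (ha : a k ∈ J) :
    tensorIncl F A n (tprod F a) ∈ Ring.jacobson (WreathAlg F A n) := by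
  refine mem_jacobson_of_forall_simple fun S _ _ _ y => ?_
  -- `P d` says that pure tensors of total degree `d` in the powers of `J` annihilate `S`. At the
  -- last `d` where this fails, some such tensor maps a vector to a non-zero vector killed by all
  -- tensors with a factor in `J`; by simplicity these tensors then kill all of `S`.
  let P : ℕ → Prop := fun d => ∀ (f : Fin n → ℕ) (a : Fin n → A), ∑ k, f k = d →
    (∀ k, a k ∈ J ^ f k) → ∀ y : S, tensorIncl F A n (tprod F a) • y = 0
  obtain ⟨m, hm⟩ := hJ
  -- Exponents all below `m` sum to at most `n * m`; the additional `1` excludes this also for `n =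
  -- 0`. So some factor lies in `J ^ m = 0`.
  have hP : P (n * m + 1) := fun f a hf h y => by
    obtain ⟨k, hk⟩ : ∃ k, m ≤ f k := by
      by_contra! hk
      have := Finset.sum_le_sum fun k (_ : k ∈ Finset.univ) => (hk k).le
      rw [hf] at this
      simp at this
    have h1 := Ideal.pow_le_pow_right hk (h k)
    rw [hm] at h1
    rw [tensorIncl_tprod_eq_zero a k h1, zero_smul]
  have : Nontrivial S := IsSimpleModule.nontrivial (WreathAlg F A n) S
  have hP0 : ¬ P 0 := fun h => by
    obtain ⟨y, hy⟩ := exists_ne (0 : S)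
    have := h (fun _ => 0) (fun _ => 1) (by simp) (fun k => by
      rw [Submodule.pow_zero, Ideal.one_eq_top]; exact Submodule.mem_top) y
    rw [tensorIncl_tprod_one, one_smul] at this
    exact hy this
  obtain ⟨d, hd, hd'⟩ : ∃ d, ¬ P d ∧ P (d + 1) := by
    by_contra! h
    exact Nat.rec (motive := fun d => ¬ P d) hP0 h _ hP
  simp only [P] at hd
  push Not at hd
  obtain ⟨f, b, hf, hb, z, hz⟩ := hd
  have hW : tensorIncl F A n (tprod F b) • z ∈
      tensorAnnihilator (F := F) (n := n) J S := by
    intro c j hc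
    rw [smul_smul, tprod_mul_tprod']
    -- Multiplying by a tensor with its factor `j` in `J` raises the degree at `j` by one and lowers
    -- none.
    refine hd' (Function.update f j (f j + 1)) _ ?_ (fun i => ?_) z
    · rw [Finset.sum_update_of_mem (Finset.mem_univ j), ← hf,
        ← Finset.add_sum_erase _ f (Finset.mem_univ j),
        Finset.sdiff_singleton_eq_erase]
      ring
    · rcases eq_or_ne i j with rfl | hij
      · rw [Function.update_self, Ideal.IsTwoSided.pow_succ]
        exact Ideal.mul_mem_mul hc (hb i)
      · rw [Function.update_of_ne hij]
        exact Ideal.mul_mem_left _ _ (hb i)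
  have htop : tensorAnnihilator (F := F) (n := n) J S = ⊤ :=
    (eq_bot_or_eq_top _).resolve_left fun h => hz (by rwa [h, Submodule.mem_bot] at hW)
  have hy : y ∈ tensorAnnihilator (F := F) (n := n) J S := by
    rw [htop]; exact Submodule.mem_top
  exact hy a k ha

theorem tprod_mem_jacobson [IsArtinianRing A] (a : Fin n → A) (k : Fin n)
    (ha : a k ∈ Ring.jacobson A) :
    tensorIncl F A n (tprod F a) ∈ Ring.jacobson (WreathAlg F A n) := by
  rw [← Ideal.jacobson_bot] at ha
  have : (Ideal.jacobson (⊥ : Ideal A)).IsTwoSided := by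
    rw [Ideal.jacobson_bot]; infer_instance
  exact tprod_mem_jacobson_of_isNilpotent _ IsArtinianRing.isNilpotent_jacobson_bot a k ha

/-- The factors are exchanged one at a time; each exchange changes the tensor by one with a factor
in the radical of `A`. -/
theorem tprod_sub_tprod_mem_jacobson [IsArtinianRing A] (a b : Fin n → A)
    (hab : ∀ k, a k - b k ∈ Ring.jacobson A) :
    tensorIncl F A n (tprod F a) - tensorIncl F A n (tprod F b) ∈
      Ring.jacobson (WreathAlg F A n) := by
  have key : ∀ s : Finset (Fin n), tensorIncl F A n (tprod F (s.piecewise a b)) -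
      tensorIncl F A n (tprod F b) ∈ Ring.jacobson (WreathAlg F A n) := by
    intro s
    induction s using Finset.induction_on with
    | empty => simp
    | insert k s hk ih =>
      have h1 : tensorIncl F A n (tprod F ((insert k s).piecewise a b)) =
          tensorIncl F A n (tprod F (Function.update (s.piecewise a b) k (a k - b k))) +
            tensorIncl F A n (tprod F (s.piecewise a b)) := by
        rw [Finset.piecewise_insert, ← map_add]
        have h2 : s.piecewise a b = Function.update (s.piecewise a b) k (b k) := by
          rw [← Finset.piecewise_eq_of_notMem s a b hk, Function.update_eq_self]
        nth_rw 3 [h2]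
        rw [← MultilinearMap.map_update_add, sub_add_cancel]
      rw [h1, add_sub_assoc]
      exact Ideal.add_mem _ (tprod_mem_jacobson _ k (by simpa using hab k)) ih
  simpa using key Finset.univ

variable {I : Type w} {M : I → Type x} [∀ i, AddCommGroup (M i)]
  [∀ i, Module F (M i)] [∀ i, Module A (M i)] [∀ i, IsScalarTower F A (M i)] [PartialOrder I]
  {e : I → A} {u : ∀ i, M i}

/-- On every simple module at least one of `e i` and `e j` vanishes, since only one weight occurs
there. -/
theorem WeightData.mul_mul_mem_jacobson (h : WeightData F A M e u) {i j : I} (hij : i ≠ j) (a : A) :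
    e i * a * e j ∈ Ring.jacobson A := by
  refine mem_jacobson_of_forall_simple fun S _ _ _ y => ?_
  let : Module F S := Module.compHom S (algebraMap F A)
  have : IsScalarTower F A S := ⟨fun c b y => by rw [Algebra.smul_def, mul_smul]; rfl⟩
  obtain ⟨l, ⟨g⟩⟩ := h.exists_equiv_head S
  by_contra h0
  have h1 : e i • g (a • e j • y) ≠ 0 := fun h1 => h0 (by
    rw [← map_smul, map_eq_zero_iff g g.injective] at h1
    rw [mul_smul, mul_smul, h1])
  have h2 : e j • g y ≠ 0 := fun h2 => h0 (by
    rw [← map_smul, map_eq_zero_iff g g.injective] at h2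
    rw [mul_smul, h2, smul_zero])
  exact hij ((h.eq_of_smul_head_ne_zero h1).symm.trans (h.eq_of_smul_head_ne_zero h2))

variable [Fintype I] [DecidableEq I]

theorem shapeIdem_mul_single_mul (hn : (n.factorial : F) ≠ 0) (l : IPartition I n)
    (h : ∀ i, Perm (l.shape i).cells) : ∃ t : F,
    shapeIdem F l * MonoidAlgebra.single h 1 * shapeIdem F l = t • shapeIdem F l := by
  choose t ht using fun i => diagIdem_mul_mul (l.factorial_ne_zero hn i)
    (MonoidAlgebra.single (h i) 1)
  refine ⟨∏ i, t i, ?_⟩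
  rw [← piAlg_single h, shapeIdem, ← piAlg_mul, ← piAlg_mul]
  simp only [ht, MultilinearMap.map_smul_univ]

/-- Take `b` to be a pure tensor of elements `a k` times `σ`. Between the idempotents its factors
become `e i * a k * e j`, where `i` and `j` are the colours of `k` and `σ⁻¹ k`. If these differ for
some `k`, the whole is in the radical. Otherwise `σ` is in the Young subgroup, every factor is a
multiple of `e i` modulo the radical, and the Young idempotents turn `σ` into a scalar. -/
theorem wreathIdem_residue [IsArtinianRing A] (hn : (n.factorial : F) ≠ 0)
    (h : WeightData F A M e u) (l : IPartition I n) (b : WreathAlg F A n) :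
    ∃ c : F, wreathIdem F e l * b * wreathIdem F e l - c • wreathIdem F e l ∈
      Ring.jacobson (WreathAlg F A n) := by
  let Q : Submodule F (WreathAlg F A n) :=
    ((Ring.jacobson (WreathAlg F A n)).restrictScalars F) ⊔ Submodule.span F {wreathIdem F e l}
  let N : Submodule F (WreathAlg F A n) := Q.comap
      (LinearMap.mulLeft F (wreathIdem F e l) ∘ₗ LinearMap.mulRight F (wreathIdem F e l))
  suffices b ∈ N by
    obtain ⟨r, hr, z, hz, hrz⟩ := Submodule.mem_sup.1 this
    obtain ⟨c, rfl⟩ := Submodule.mem_span_singleton.1 hz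
    refine ⟨c, ?_⟩
    have h1 : wreathIdem F e l * b * wreathIdem F e l - c • wreathIdem F e l = r := by
      rw [sub_eq_iff_eq_add, hrz]
      exact mul_assoc _ _ _
    rw [h1]
    exact hr
  refine wreath_mem N (fun a σ => ?_) b
  change wreathIdem F e l * (tensorIncl F A n (tprod F a) * permIncl F A n σ * wreathIdem F e l) ∈ Q
  have h1 : wreathIdem F e l * (tensorIncl F A n (tprod F a) * permIncl F A n σ * wreathIdem F e l) =
      youngAlg F A l.numbering (shapeIdem F l) * tensorIncl F A n (tprod F fun k =>
        e (colour l.numbering k) * a k * e (colour l.numbering (σ.symm k))) *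
      (permIncl F A n σ * youngAlg F A l.numbering (shapeIdem F l)) := by
    nth_rw 1 [wreathIdem_eq]
    rw [wreathIdem, ← mul_assoc (_ * permIncl F A n σ), mul_assoc _ (permIncl F A n σ), weightIdem,
      permIncl_mul_tprod]
    simp only [mul_assoc, ← tprod_mul_tprod']
  rw [h1]
  by_cases hσ : ∃ k, colour l.numbering k ≠ colour l.numbering (σ.symm k)
  · obtain ⟨k, hk⟩ := hσ
    refine Submodule.mem_sup_left (Ideal.mul_mem_right _ _ (Ideal.mul_mem_left _ _ ?_))
    exact tprod_mem_jacobson _ k (h.mul_mul_mem_jacobson hk _)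
  push Not at hσ
  simp only [← hσ]
  choose c hc using fun k => h.residue (colour l.numbering k) (a k)
  have h2 := tprod_sub_tprod_mem_jacobson (F := F) _ _ hc
  set x := tensorIncl F A n (tprod F fun k =>
    e (colour l.numbering k) * a k * e (colour l.numbering k)) with hx
  have h3 : tensorIncl F A n (tprod F fun k => c k • e (colour l.numbering k)) =
      (∏ k, c k) • weightIdem F e (colour l.numbering) := by
    rw [MultilinearMap.map_smul_univ, map_smul, weightIdem]
  rw [h3] at h2
  obtain ⟨g, rfl⟩ : ∃ g, σ = youngHom l.numbering g := by
    obtain ⟨g, hg⟩ := exists_sigma_congr ((l.numbering.trans σ).trans l.numbering.symm)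
      fun z => by
        have := hσ (σ (l.numbering z))
        rw [Equiv.symm_apply_apply] at this
        exact this.trans (congrArg Sigma.fst (l.numbering.symm_apply_apply z))
    refine ⟨g, Equiv.ext fun k => ?_⟩
    obtain ⟨z, rfl⟩ := l.numbering.surjective k
    rw [youngHom_apply_apply, ← hg]
    exact (l.numbering.apply_symm_apply _).symm
  obtain ⟨t, ht⟩ := shapeIdem_mul_single_mul hn l g
  have h4 : youngAlg F A l.numbering (shapeIdem F l) * x *
      (permIncl F A n (youngHom l.numbering g) * youngAlg F A l.numbering (shapeIdem F l)) =
      youngAlg F A l.numbering (shapeIdem F l) *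
        (x - (∏ k, c k) • weightIdem F e (colour l.numbering)) *
      (permIncl F A n (youngHom l.numbering g) * youngAlg F A l.numbering (shapeIdem F l)) +
      ((∏ k, c k) * t) • wreathIdem F e l := by
    rw [mul_sub, sub_mul, ← youngAlg_single, ← map_mul, mul_smul_comm, smul_mul_assoc,
      ← wreathIdem_eq, wreathIdem, mul_assoc (weightIdem F e _), ← map_mul, ← mul_assoc, ht,
      map_smul, mul_smul_comm, smul_smul, sub_add_cancel]
  rw [h4]
  refine Submodule.add_mem_sup (Ideal.mul_mem_right _ _ (Ideal.mul_mem_left _ _ h2)) ?_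
  exact Submodule.smul_mem _ _ (Submodule.mem_span_singleton_self _)

end Radical

end BGG

namespace BGG

open Equiv PiTensorProduct

/-! ### Homomorphisms from the standard modules of the wreath product. -/

section Equivariant

variable {F : Type*} [Field F] {B₀ : Type*} {B : Type*} [Ring B₀] [Ring B] [Algebra F B₀]
  [Algebra F B] (φ : B₀ →ₐ[F] B) {N V : Type*} [AddCommGroup N] [Module F N] [Module B₀ N]
  [IsScalarTower F B₀ N] [AddCommGroup V] [Module F V] [Module B V] [IsScalarTower F B V]
  (f : N →ₗ[F] V)

/-- The elements of the algebra whose action commutes with a linear map. -/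
def equivariantElements : Submodule F B₀ where
  carrier := {b | ∀ t, f (b • t) = φ b • f t}
  add_mem' {b c} hb hc t := by rw [add_smul, map_add, map_add, add_smul, hb, hc]
  zero_mem' t := by rw [zero_smul, map_zero, map_zero, zero_smul]
  smul_mem' c b hb t := by rw [smul_assoc, map_smul, hb, map_smul, smul_assoc]

/-- The vectors on which a linear map commutes with the action of an element of the algebra. -/
def equivariantVectors (b : B₀) : Submodule F N where
  carrier := {t | f (b • t) = φ b • f t}
  add_mem' {s t} (hs : _ = _) (ht : _ = _) := by
    change f (b • (s + t)) = φ b • f (s + t)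
    rw [smul_add, map_add, map_add, smul_add, hs, ht]
  zero_mem' := by
    change f (b • 0) = φ b • f 0
    rw [smul_zero, map_zero, smul_zero]
  smul_mem' c t (ht : _ = _) := by
    change f (b • c • t) = φ b • f (c • t)
    rw [smul_comm, map_smul, ht, map_smul, smul_comm]

variable {φ f}

theorem mul_mem_equivariantElements {b c : B₀} (hb : b ∈ equivariantElements φ f)
    (hc : c ∈ equivariantElements φ f) : b * c ∈ equivariantElements φ f := fun t => by
  rw [mul_smul, hb, hc, map_mul, mul_smul]

end Equivariant

section Lift

variable {F : Type u} [Field F] {A : Type v} [Ring A] [Algebra F A] {n : ℕ}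
variable {I : Type w} [Fintype I] {M : I → Type x} [∀ i, AddCommGroup (M i)]
  [∀ i, Module F (M i)] [∀ i, Module A (M i)] [∀ i, IsScalarTower F A (M i)]

theorem young_mem {Y : I → Type*} (N : Submodule F (YoungAlg F A Y))
    (h : ∀ (k : ∀ i, Perm (Y i)) (a : (Σ i, Y i) → A), SkewMonoidAlgebra.single k (tprod F a) ∈ N)
    (b : YoungAlg F A Y) : b ∈ N := by
  induction b using SkewMonoidAlgebra.induction_on' with
  | single k s =>
    let f : TensorPow F A (Σ i, Y i) →ₗ[F] YoungAlg F A Y :=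
      { toFun := fun t => SkewMonoidAlgebra.single k t
        map_add' := SkewMonoidAlgebra.single_add k
        map_smul' := fun c t => (SkewMonoidAlgebra.smul_single c k t).symm }
    exact tensorPow_mem f N (h k) s
  | add a b ha hb => exact N.add_mem ha hb

section Generators

variable {l : IPartition I n} {V : Type*} [AddCommGroup V] [Module F V]
  [Module (WreathAlg F A n) V] [IsScalarTower F (WreathAlg F A n) V]
  {f : OuterTensor F M l →ₗ[F] V}

theorem single_one_mem_equivariantElements {a : (Σ i, (l.shape i).cells) → A}
    (h1 : ∀ p y, f (outerMk F M l (tprod F fun z => a z • p z) y) =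
      tensorIncl F A n (tprod F fun k => a (l.numbering.symm k)) • f (outerMk F M l (tprod F p) y)) :
    (SkewMonoidAlgebra.single 1 (tprod F a) : ParabolicAlg F A l) ∈
      equivariantElements (youngIncl F A (fun i => (l.shape i).cells) l.numbering) f := by
  refine outer_mem l (equivariantVectors (youngIncl F A (fun i => (l.shape i).cells) l.numbering) f
    (SkewMonoidAlgebra.single 1 (tprod F a))) (fun p y => ?_)
  change f (SkewMonoidAlgebra.single 1 (tprod F a) • _) =
    youngIncl F A _ l.numbering (SkewMonoidAlgebra.single 1 (tprod F a)) • f _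
  rw [tprod_smul_outerMk, h1, youngIncl_single_one, tensorReindex_tprod]

theorem single_perm_mem_equivariantElements {h : ∀ i, Perm (l.shape i).cells}
    (h2 : ∀ p y, f (outerMk F M l (youngPermuteMap F _ M h (tprod F p))
        (spechtAct F l (MonoidAlgebra.single h 1) y)) =
      permIncl F A n (youngHom l.numbering h) • f (outerMk F M l (tprod F p) y)) :
    (SkewMonoidAlgebra.single h 1 : ParabolicAlg F A l) ∈
      equivariantElements (youngIncl F A (fun i => (l.shape i).cells) l.numbering) f := by
  refine outer_mem l (equivariantVectors (youngIncl F A (fun i => (l.shape i).cells) l.numbering) f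
    (SkewMonoidAlgebra.single h 1)) (fun p y => ?_)
  change f (SkewMonoidAlgebra.single h 1 • _) =
    youngIncl F A _ l.numbering (SkewMonoidAlgebra.single h 1) • f _
  rw [perm_smul_outerMk, h2, youngIncl_single_perm]

theorem mem_equivariantElements_of_generators
    (h1 : ∀ (a : (Σ i, (l.shape i).cells) → A) p y, f (outerMk F M l (tprod F fun z => a z • p z) y) =
      tensorIncl F A n (tprod F fun k => a (l.numbering.symm k)) • f (outerMk F M l (tprod F p) y))
    (h2 : ∀ h p y, f (outerMk F M l (youngPermuteMap F _ M h (tprod F p))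
        (spechtAct F l (MonoidAlgebra.single h 1) y)) =
      permIncl F A n (youngHom l.numbering h) • f (outerMk F M l (tprod F p) y))
    (b : ParabolicAlg F A l) :
    b ∈ equivariantElements (youngIncl F A (fun i => (l.shape i).cells) l.numbering) f := by
  refine young_mem _ (fun h a => ?_) b
  have : (SkewMonoidAlgebra.single h (tprod F a) : ParabolicAlg F A l) =
      SkewMonoidAlgebra.single 1 (tprod F a) * SkewMonoidAlgebra.single h 1 := by
    rw [SkewMonoidAlgebra.single_mul_single, one_mul, one_smul, mul_one]
  rw [this]
  exact mul_mem_equivariantElements (single_one_mem_equivariantElements (h1 a))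
    (single_perm_mem_equivariantElements (h2 h))

end Generators

variable [DecidableEq I]

/-- The embedding of the tensor product of Specht modules into the group algebra. -/
def spechtIncl (l : IPartition I n) : (⨂[F] i, specht F (l.shape i)) →ₗ[F]
    MonoidAlgebra F (∀ i, Perm (l.shape i).cells) :=
  PiTensorProduct.lift ((piAlg F _).compLinearMap fun i =>
    (specht F (l.shape i)).subtype.restrictScalars F)

theorem spechtIncl_tprod (l : IPartition I n) (y : ∀ i, specht F (l.shape i)) :
    spechtIncl l (tprod F y) = piAlg F _ fun i => (y i : MonoidAlgebra F (Perm (l.shape i).cells)) :=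
  PiTensorProduct.lift.tprod _

theorem spechtIncl_single_smul (l : IPartition I n) (h : ∀ i, Perm (l.shape i).cells)
    (y : ⨂[F] i, specht F (l.shape i)) :
    spechtIncl l (spechtAct F l (MonoidAlgebra.single h 1) y) =
      MonoidAlgebra.single h 1 * spechtIncl l y := by
  have := tprod_mem (V := fun i => specht F (l.shape i))
    (spechtIncl l ∘ₗ spechtAct F l (MonoidAlgebra.single h 1) -
      LinearMap.mulLeft F (MonoidAlgebra.single h 1) ∘ₗ spechtIncl l) ⊥ (fun y => by
    rw [Submodule.mem_bot, LinearMap.sub_apply, sub_eq_zero]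
    change spechtIncl l (spechtAct F l (MonoidAlgebra.single h 1) (tprod F y)) =
      MonoidAlgebra.single h 1 * spechtIncl l (tprod F y)
    rw [← piAlg_single, spechtAct_piAlg_tprod, spechtIncl_tprod, spechtIncl_tprod, ← piAlg_mul]
    rfl) y
  exact sub_eq_zero.1 this

theorem spechtIncl_spechtTop (hn : (n.factorial : F) ≠ 0) (l : IPartition I n) :
    ∃ t : F, t ≠ 0 ∧ spechtIncl l (spechtTop F l) = t • shapeIdem F l := by
  choose t ht0 ht using fun i => spechtGen_eq_smul (F := F) (l.factorial_ne_zero hn i)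
  refine ⟨∏ i, t i, Finset.prod_ne_zero_iff.2 fun i _ => ht0 i, ?_⟩
  rw [spechtTop, spechtIncl_tprod, funext ht, MultilinearMap.map_smul_univ, shapeIdem]

variable {V : Type*} [AddCommGroup V] [Module F V] [Module (WreathAlg F A n) V]
  [IsScalarTower F (WreathAlg F A n) V] {l : IPartition I n}

/-- The linear maps `x ↦ h g(h⁻¹ x)`, extended linearly in `h`. -/
def twist (A : Type v) [Ring A] [Algebra F A] [Module (WreathAlg F A n) V]
    [IsScalarTower F (WreathAlg F A n) V]
    (g : (⨂[F] z : (Σ i, (l.shape i).cells), M z.1) →ₗ[F] V) :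
    MonoidAlgebra F (∀ i, Perm (l.shape i).cells) →ₗ[F]
      (⨂[F] z : (Σ i, (l.shape i).cells), M z.1) →ₗ[F] V :=
  Finsupp.linearCombination F (fun h => (Algebra.lsmul F F V : WreathAlg F A n →ₐ[F] _)
    (permIncl F A n (youngHom l.numbering h)) ∘ₗ g ∘ₗ
      youngPermuteMap F (fun i => (l.shape i).cells) M h⁻¹) ∘ₗ
        (MonoidAlgebra.coeffLinearEquiv F).toLinearMap

variable (g : (⨂[F] z : (Σ i, (l.shape i).cells), M z.1) →ₗ[F] V)

theorem twist_single (h : ∀ i, Perm (l.shape i).cells)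
    (s : ⨂[F] z : (Σ i, (l.shape i).cells), M z.1) :
    twist A g (MonoidAlgebra.single h 1) s = permIncl F A n (youngHom l.numbering h) •
      g (youngPermuteMap F (fun i => (l.shape i).cells) M h⁻¹ s) := by
  have : twist A g (MonoidAlgebra.single h 1) = (Algebra.lsmul F F V : WreathAlg F A n →ₐ[F] _)
      (permIncl F A n (youngHom l.numbering h)) ∘ₗ g ∘ₗ
        youngPermuteMap F (fun i => (l.shape i).cells) M h⁻¹ :=
    (Finsupp.linearCombination_single _ _ _).trans (one_smul _ _)
  rw [this]
  rfl

/-- On group elements both sides are `k h • g (h⁻¹ x)`. So the twist is equivariant when the Young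
subgroup acts diagonally on `x` and on the group algebra. -/
theorem twist_single_mul (k : ∀ i, Perm (l.shape i).cells)
    (p : ∀ z : (Σ i, (l.shape i).cells), M z.1)
    (b : MonoidAlgebra F (∀ i, Perm (l.shape i).cells)) :
    twist A g (MonoidAlgebra.single k 1 * b) (youngPermuteMap F _ M k (tprod F p)) =
      permIncl F A n (youngHom l.numbering k) • twist A g b (tprod F p) := by
  have := groupAlg_mem ((LinearMap.applyₗ (youngPermuteMap F _ M k (tprod F p))) ∘ₗ twist A g ∘ₗ
      LinearMap.mulLeft F (MonoidAlgebra.single k 1) -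
    (Algebra.lsmul F F V : WreathAlg F A n →ₐ[F] _) (permIncl F A n (youngHom l.numbering k)) ∘ₗ
      (LinearMap.applyₗ (tprod F p)) ∘ₗ twist A g) ⊥ (fun h => by
    rw [Submodule.mem_bot, LinearMap.sub_apply, sub_eq_zero]
    change twist A g (MonoidAlgebra.single k 1 * MonoidAlgebra.single h 1)
      (youngPermuteMap F _ M k (tprod F p)) =
        permIncl F A n (youngHom l.numbering k) • twist A g (MonoidAlgebra.single h 1) (tprod F p)
    rw [MonoidAlgebra.single_mul_single, one_mul, twist_single, twist_single, smul_smul, map_mul,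
      map_mul, youngPermuteMap_tprod, youngPermuteMap_tprod, youngPermuteMap_tprod]
    congr 3
    funext z
    change p ⟨z.1, (k z.1).symm (k z.1 (h z.1 z.2))⟩ = p ⟨z.1, h z.1 z.2⟩
    rw [Equiv.symm_apply_apply]) b
  exact sub_eq_zero.1 this

/-- Applying `h⁻¹` permutes the factors of `a`, and moving the result back across `h` restores their
order. So the twist keeps the linearity over the tensor power. -/
theorem twist_tprod_smul
    (hg : ∀ (a : (Σ i, (l.shape i).cells) → A) p, g (tprod F fun z => a z • p z) =
      tensorIncl F A n (tprod F fun k => a (l.numbering.symm k)) • g (tprod F p))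
    (a : (Σ i, (l.shape i).cells) → A) (p : ∀ z : (Σ i, (l.shape i).cells), M z.1)
    (b : MonoidAlgebra F (∀ i, Perm (l.shape i).cells)) :
    twist A g b (tprod F fun z => a z • p z) =
      tensorIncl F A n (tprod F fun k => a (l.numbering.symm k)) • twist A g b (tprod F p) := by
  have := groupAlg_mem ((LinearMap.applyₗ (tprod F fun z => a z • p z)) ∘ₗ twist A g -
    (Algebra.lsmul F F V : WreathAlg F A n →ₐ[F] _)
      (tensorIncl F A n (tprod F fun k => a (l.numbering.symm k))) ∘ₗ
        (LinearMap.applyₗ (tprod F p)) ∘ₗ twist A g) ⊥ (fun h => by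
    rw [Submodule.mem_bot, LinearMap.sub_apply, sub_eq_zero]
    change twist A g (MonoidAlgebra.single h 1) (tprod F fun z => a z • p z) =
      tensorIncl F A n (tprod F fun k => a (l.numbering.symm k)) •
        twist A g (MonoidAlgebra.single h 1) (tprod F p)
    rw [twist_single, twist_single, youngPermuteMap_tprod, youngPermuteMap_tprod, smul_smul,
      hg (fun z => a ⟨z.1, (h⁻¹ z.1).symm z.2⟩), smul_smul, permIncl_mul_tprod]
    congr 4
    funext k
    rw [youngHom_symm_apply, Equiv.symm_apply_apply]
    change a ⟨_, h _ ((h _).symm (l.numbering.symm k).2)⟩ = _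
    rw [Equiv.apply_symm_apply]) b
  exact sub_eq_zero.1 this

theorem twist_topTensor (u : ∀ i, M i) (b : MonoidAlgebra F (∀ i, Perm (l.shape i).cells)) :
    twist A g b (topTensor u F l) = youngAlg F A l.numbering b • g (topTensor u F l) := by
  have := groupAlg_mem ((LinearMap.applyₗ (topTensor u F l)) ∘ₗ twist A g -
    (LinearMap.toSpanSingleton (WreathAlg F A n) V (g (topTensor u F l))).restrictScalars F ∘ₗ
      (youngAlg F A l.numbering).toLinearMap) ⊥ (fun h => by
    rw [Submodule.mem_bot, LinearMap.sub_apply, sub_eq_zero]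
    change twist A g (MonoidAlgebra.single h 1) (topTensor u F l) =
      youngAlg F A l.numbering (MonoidAlgebra.single h 1) • g (topTensor u F l)
    rw [twist_single, youngPermuteMap_topTensor, youngAlg_single]) b
  exact sub_eq_zero.1 this

/-- The map `g` need not respect the Young subgroup. With the Specht modules embedded in the group
algebra, `x ⊗ y ↦ twist A g y x` does, and it stays linear over the tensor power, so it extends to
the induced module. As the top tensor is invariant, twisting there is just the action of the group
algebra. -/
theorem exists_wreathLift
    (hg : ∀ (a : (Σ i, (l.shape i).cells) → A) p, g (tprod F fun z => a z • p z) =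
      tensorIncl F A n (tprod F fun k => a (l.numbering.symm k)) • g (tprod F p)) (u : ∀ i, M i) :
    ∃ f : WreathModule F A M l →ₗ[WreathAlg F A n] V, f (topVec F A u l) =
      youngAlg F A l.numbering (spechtIncl l (spechtTop F l)) • g (topTensor u F l) := by
  let f₀ : OuterTensor F M l →ₗ[F] V :=
    TensorProduct.lift ((twist A g ∘ₗ spechtIncl l).flip)
  have hf₀ : ∀ s y, f₀ (outerMk F M l s y) = twist A g (spechtIncl l y) s := fun s y => rfl
  obtain ⟨f, hf⟩ := exists_indLift (youngIncl F A (fun i => (l.shape i).cells) l.numbering) f₀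
    (mem_equivariantElements_of_generators (f := f₀) (fun a p y => by
      rw [hf₀, hf₀, twist_tprod_smul g hg]) (fun h p y => by
      rw [hf₀, hf₀, spechtIncl_single_smul, twist_single_mul]))
  refine ⟨f, ?_⟩
  rw [topVec, stdMk_apply, hf, map_one, one_smul, hf₀, twist_topTensor]

end Lift

end BGG

namespace BGG

open Equiv PiTensorProduct

/-! ### Weight data and singular weights of the wreath product. -/

section Wreath

variable {F : Type u} [Field F] {A : Type v} [Ring A] [Algebra F A] {n : ℕ}
variable {I : Type w} [Fintype I] [PartialOrder I] {M : I → Type x} [∀ i, AddCommGroup (M i)]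
  [∀ i, Module F (M i)] [∀ i, Module A (M i)] [∀ i, IsScalarTower F A (M i)]
  {e : I → A} {u : ∀ i, M i}

theorem WeightData.wreath [DecidableEq I] [FiniteDimensional F A] (h : WeightData F A M e u)
    (hn : (n.factorial : F) ≠ 0) :
    WeightData F (WreathAlg F A n) (WreathModule F A M (n := n)) (wreathIdem F e)
      (topVec F A u) where
  finite_index := inferInstance
  finiteDimensional l := Module.Finite.of_surjective
    ((LinearMap.toSpanSingleton (WreathAlg F A n) _ (topVec F A u l)).restrictScalars F)
    (exists_smul_topVec h l)
  idem := wreathIdem_mul_self hn h.idem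
  weight := wreathIdem_smul_topVec hn h.weight
  ne_zero := topVec_ne_zero hn h.ne_zero
  line l y := by
    obtain ⟨c, hc⟩ := Submodule.mem_span_singleton.1 (wreathIdem_smul_mem hn h l y)
    exact ⟨c, hc.symm⟩
  generates := exists_smul_topVec h
  le_of_ne_zero l m y hy := by
    by_contra hlm
    exact hy (wreathIdem_smul_eq_zero hn h hlm y)
  one_mem := one_mem_span_wreathIdem hn e h.one_mem
  residue l b := by
    have : IsArtinianRing A := isArtinian_of_tower F inferInstance
    exact wreathIdem_residue hn h l b

/-- The vectors `y` admitting such a `g` form a subspace, so `y` may be taken to be `σ ⊗ q ⊗ t` with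
`q` a pure tensor. For each cell `z` of `l` matched by `σ` with a cell of colour `j`, there is a
homomorphism from `M j` sending `u j` to `e j • q z`. Their tensor product, composed with the
permutation of the factors, is the required map. -/
theorem exists_tensorLift (h : WeightData F A M e u) (hs : ∀ i, WeightsSingular e u (M i))
    (l m : IPartition I n) (y : WreathModule F A M l) :
    ∃ g : (⨂[F] z : (Σ i, (m.shape i).cells), M z.1) →ₗ[F] WreathModule F A M l,
      (∀ (a : (Σ i, (m.shape i).cells) → A) p, g (tprod F fun z => a z • p z) =
        tensorIncl F A n (tprod F fun k => a (m.numbering.symm k)) • g (tprod F p)) ∧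
      g (topTensor u F m) = weightIdem F e (colour m.numbering) • y := by
  let N : Submodule F (WreathModule F A M l) :=
    { carrier := {y | ∃ g : (⨂[F] z : (Σ i, (m.shape i).cells), M z.1) →ₗ[F] WreathModule F A M l,
        (∀ (a : (Σ i, (m.shape i).cells) → A) p, g (tprod F fun z => a z • p z) =
          tensorIncl F A n (tprod F fun k => a (m.numbering.symm k)) • g (tprod F p)) ∧
        g (topTensor u F m) = weightIdem F e (colour m.numbering) • y}
      add_mem' := by
        rintro y y' ⟨g, hg, hgy⟩ ⟨g', hg', hgy'⟩
        refine ⟨g + g', fun a p => ?_, ?_⟩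
        · rw [LinearMap.add_apply, LinearMap.add_apply, hg, hg', smul_add]
        · rw [LinearMap.add_apply, hgy, hgy', smul_add]
      zero_mem' := ⟨0, fun a p => by rw [LinearMap.zero_apply, LinearMap.zero_apply, smul_zero], by
        rw [LinearMap.zero_apply, smul_zero]⟩
      smul_mem' := by
        rintro c y ⟨g, hg, hgy⟩
        refine ⟨c • g, fun a p => ?_, ?_⟩
        · rw [LinearMap.smul_apply, LinearMap.smul_apply, hg, smul_comm]
        · rw [LinearMap.smul_apply, hgy, smul_comm] }
  refine std_mem l N (fun σ q t => ?_) y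
  let β : (Σ i, (l.shape i).cells) ≃ Σ i, (m.shape i).cells :=
    (l.numbering.trans σ).trans m.numbering.symm
  have hβ : ∀ z, m.numbering.symm (σ (l.numbering z)) = β z := fun z => rfl
  choose f hf using fun z => hs z.1 (β z).1 (e (β z).1 • q z) (by rw [smul_smul, h.idem])
  let r : (⨂[F] z : (Σ i, (m.shape i).cells), M z.1) →ₗ[F]
      ⨂[F] z : (Σ i, (l.shape i).cells), M (β z).1 :=
    (PiTensorProduct.reindex F (fun z : (Σ i, (m.shape i).cells) => M z.1) β.symm).toLinearMap
  have hr : ∀ p : ∀ z : (Σ i, (m.shape i).cells), M z.1, r (tprod F p) = tprod F fun z => p (β z) :=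
    fun p => PiTensorProduct.reindex_tprod β.symm p
  let g : (⨂[F] z : (Σ i, (m.shape i).cells), M z.1) →ₗ[F] WreathModule F A M l :=
    (stdMk F A M l σ).flip t ∘ₗ
      PiTensorProduct.map (fun z => (f z).restrictScalars F) ∘ₗ r
  have hg : ∀ p : ∀ z : (Σ i, (m.shape i).cells), M z.1, g (tprod F p) =
      stdMk F A M l σ (tprod F fun z => f z (p (β z))) t := fun p => by
    change stdMk F A M l σ (PiTensorProduct.map _ (r (tprod F p))) t = _
    rw [hr, PiTensorProduct.map_tprod]
    rfl
  refine ⟨g, fun a p => ?_, ?_⟩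
  · rw [hg, hg, tprod_smul_stdMk]
    simp only [map_smul, hβ]
  · classical
    rw [topTensor, hg, weightIdem_smul_stdMk]
    simp only [hf]
    rfl

theorem WeightsSingular.wreath [DecidableEq I] (h : WeightData F A M e u)
    (hs : ∀ i, WeightsSingular e u (M i)) (hn : (n.factorial : F) ≠ 0) (l : IPartition I n) :
    WeightsSingular (B := WreathAlg F A n) (wreathIdem F e) (topVec F A u) (WreathModule F A M l) := by
  intro m y hy
  obtain ⟨t, ht0, ht⟩ := spechtIncl_spechtTop hn m
  -- The factor `t⁻¹` compensates for the scalar between the Specht generators and the Young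
  -- idempotents.
  obtain ⟨g, hg, hgy⟩ := exists_tensorLift h hs l m (t⁻¹ • y)
  obtain ⟨f, hf⟩ := exists_wreathLift g hg u
  refine ⟨f, ?_⟩
  rw [hf, ht, hgy, map_smul, smul_assoc, smul_smul, ← wreathIdem_eq, smul_comm, smul_inv_smul₀ ht0, hy]

end Wreath

end BGG

end

theorem mainTheorem8 {F : Type u} [Field F] {A : Type v} [Ring A] [Algebra F A]
    [FiniteDimensional F A] {I : Type w} [Fintype I] [PartialOrder I]
    (Δ : I → Type x) [∀ i, AddCommGroup (Δ i)] [∀ i, Module F (Δ i)] [∀ i, Module A (Δ i)]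
    [∀ i, IsScalarTower F A (Δ i)]
    (hax : BGG.StandardAxioms F A Δ)
    (hcond : BGG.TightMultiplicities F A Δ ∨ BGG.SimplesHaveBGG A Δ ∨ BGG.RadicalsGenerated A Δ)
    (n : ℕ) (hn : 0 < n) (hchar : (n.factorial : F) ≠ 0) :
    BGG.StandardAxioms F (BGG.WreathAlg F A n) (BGG.WreathModule F A Δ (n := n)) ∧
    BGG.TightMultiplicities F (BGG.WreathAlg F A n) (BGG.WreathModule F A Δ (n := n)) ∧
    BGG.SimplesHaveBGG (BGG.WreathAlg F A n) (BGG.WreathModule F A Δ (n := n)) ∧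
    BGG.RadicalsGenerated (BGG.WreathAlg F A n) (BGG.WreathModule F A Δ (n := n)) := by
  classical
  obtain ⟨e, u, h⟩ := hax.exists_weightData
  have hw := h.wreath hchar
  have hs := BGG.WeightsSingular.wreath h (h.weightsSingular hcond) hchar
  exact ⟨hw.standardAxioms, hw.tightMultiplicities hs, hw.simplesHaveBGG hs,
    hw.radicalsGenerated hs⟩
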